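/- Let $M$ be a compact connected Riemann surface and $(L,h)\to M$ a holomorphic line bundle with a smooth Hermitian metric of positive curvature. If $e$ is a local holomorphic frame of $L$, write $h(e,e)=e^{-\phi}$, and let $\omega=\frac{\partial^2\phi}{\partial z\,\partial\bar z}\,\frac{\sqrt{-1}}2\,dz\wedge d\bar z>0$ be the Kähler form. For $n\ge 1$ let $H^0(M,L^n)$ be the (finite-dimensional) space of holomorphic sections of $L^n$ with the inner product $\langle s,t\rangle=\int_M h^n(s,t)\,\omega$, and let $\Pi_n(z,w)=\sum_j s_j(z)\otimes\overline{s_j(w)}$ be its Bergman kernel, $(s_j)$ being any orthonormal basis. Let $\nabla_{h^n}$ be the Chern connection of $(L^n,h^n)$; thus $\nabla_{h^n}(f e^{\otimes n})=\big(\frac{\partial f}{\partial z}-n\frac{\partial\phi}{\partial z}f\big)e^{\otimes n}\otimes dz$ for holomorphic $f$. Fix $q\in M$, put $H^0_q=\{s\in H^0(M,L^n):\nabla_{h^n}s(q)=0\}$, and assume $H^0_q\neq 0$. The conditional Gaussian measure given that $q$ is a critical point is the law of $s=\sum_j a_j t_j$, where $(t_j)$ is an orthonormal basis of $H^0_q$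 and the $a_j$ are independent standard complex Gaussian variables. Let $D_n(z|q)$ be the $(1,1)$-current of the conditional expectation of the zeros, counted with multiplicity: $$\int_M\psi\,D_n(z|q)=\mathbf E\Big(\sum_{z:\,s(z)=0}\psi(z)\Big),\qquad \psi\in C^\infty(M).$$ Then these expectations exist, and $$D_n(z|q)=\frac{\sqrt{-1}}{2\pi}\,\partial\bar\partial\log|\Pi_n^q(z,z)|,\qquad \Pi_n^q(z,z)=\Pi_n(z,z)-\frac{\big|\partial_{\bar w}\Pi_n(z,w)|_{w=q}\big|^2}{(\partial_z\partial_{\bar z}\Pi_n)(q,q)},$$ in the sense of currents. That is, for every coordinate patch $U$ with a holomorphic frame of $L$ over $U$, and every $\psi\in C^\infty(M)$ with support in $U$, $\int_M\psi\,D_n(z|q)=\frac1\pi\int_U\log|\Pi_n^q(z,z)|\,\frac{\partial^2\psi}{\partial z\,\partial\bar z}\,d\ell_z$, where $d\ell_z$ is Lebesgue measure and the integrand on the right is integrable. Here the variable $z$ of $\Pi_n^q(z,z)$ is expressed in the given frame over $U$, and the derivatives at $q$ are taken in any coordinate and any holomorphic frame around $q$ for which $\frac{\partial\phi}{\partial z}(q)=0$;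 such a coordinate and frame exist. (If $\nabla_{h^n}s(q)=0$ for all $s\in H^0(M,L^n)$, numerator and denominator of the quotient vanish and it is read as $0$.) Moreover, if the sections in $H^0_q$ have no common zero, then almost surely all zeros of $s$ are simple, so that multiplicities play no role. -/

import Mathlib

open Set MeasureTheory Bundle Manifold Topology
open scoped ContDiff TensorProduct ComplexConjugate ENNReal

set_option linter.unusedSectionVars false

noncomputable section

namespace RandomSections

/-! ### Wirtinger derivatives on the complex plane -/

/-- The operator `∂/∂z = (∂/∂x - i ∂/∂y) / 2`. -/
def wirtinger (f : ℂ → ℂ) (z : ℂ) : ℂ :=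
  (fderiv ℝ f z 1 - Complex.I * fderiv ℝ f z Complex.I) / 2

/-- The operator `∂/∂z̄ = (∂/∂x + i ∂/∂y) / 2`. -/
def wirtingerBar (f : ℂ → ℂ) (z : ℂ) : ℂ :=
  (fderiv ℝ f z 1 + Complex.I * fderiv ℝ f z Complex.I) / 2

/-! ### The line bundle `E` over the Riemann surface `M`, its frames and its tensor powers -/

section Bundle

variable {M : Type*} [TopologicalSpace M] [ChartedSpace ℂ M]
  (E : M → Type*) [∀ x, AddCommGroup (E x)] [∀ x, Module ℂ (E x)]
  [∀ x, TopologicalSpace (E x)] [TopologicalSpace (TotalSpace ℂ E)]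
  [FiberBundle ℂ E] [VectorBundle ℂ ℂ E]

/-- A holomorphic coordinate patch: a chart of the maximal holomorphic atlas. -/
def IsHolomorphicChart (c : OpenPartialHomeomorph M ℂ) : Prop :=
  c ∈ IsManifold.maximalAtlas 𝓘(ℂ) ω M

/-- `e` is a nowhere vanishing holomorphic section of `E` over the open set `U`
(the values of `e` outside `U` play no role). -/
structure IsHolomorphicFrame (U : Set M) (e : ∀ x, E x) : Prop where
  isOpen : IsOpen U
  holomorphic : ContMDiffOn 𝓘(ℂ) (𝓘(ℂ).prod 𝓘(ℂ)) ω (fun x => TotalSpace.mk' ℂ x (e x)) U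
  ne_zero : ∀ x ∈ U, e x ≠ 0

variable {E} in
/-- For `v ≠ 0` in the line `E x`, the coordinate of an element of `(E x)^{⊗ n}` with respect to
the basis vector `v ⊗ ⋯ ⊗ v`; see `eq_tensorCoord_smul`. -/
def tensorCoord {x : M} (n : ℕ) (v : E x) : (⨂[ℂ]^n (E x)) →ₗ[ℂ] ℂ :=
  PiTensorProduct.lift ((MultilinearMap.mkPiAlgebra ℂ (Fin n) ℂ).compLinearMap
    fun _ => ((trivializationAt ℂ E x).linearMapAt ℂ x v)⁻¹ •
      (trivializationAt ℂ E x).linearMapAt ℂ x)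

variable {E} in
/-- The element `v ⊗ ⋯ ⊗ v` of `(E x)^{⊗ n}`. -/
def tensorPow {x : M} (n : ℕ) (v : E x) : ⨂[ℂ]^n (E x) :=
  PiTensorProduct.tprod ℂ fun _ => v

variable {E} in
lemma linearMapAt_ne_zero {x : M} {v : E x} (hv : v ≠ 0) :
    (trivializationAt ℂ E x).linearMapAt ℂ x v ≠ 0 := by
  intro h0
  apply hv
  have hx : x ∈ (trivializationAt ℂ E x).baseSet := FiberBundle.mem_baseSet_trivializationAt ℂ E x
  have := (trivializationAt ℂ E x).symmₗ_linearMapAt (R := ℂ) hx v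
  rw [h0, map_zero] at this
  exact this.symm

variable {E} in
/-- `tensorCoord` is the coordinate with respect to `v ⊗ ⋯ ⊗ v`. -/
theorem eq_tensorCoord_smul {x : M} (n : ℕ) {v : E x} (hv : v ≠ 0) (u : ⨂[ℂ]^n (E x)) :
    u = tensorCoord n v u • tensorPow n v := by
  have hx : x ∈ (trivializationAt ℂ E x).baseSet := FiberBundle.mem_baseSet_trivializationAt ℂ E x
  set τ := (trivializationAt ℂ E x).linearMapAt ℂ x with hτ
  have hτv : τ v ≠ 0 := linearMapAt_ne_zero hv
  have hline : ∀ w : E x, w = ((τ v)⁻¹ * τ w) • v := by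
    intro w
    have hw := (trivializationAt ℂ E x).symmₗ_linearMapAt (R := ℂ) hx w
    have hv' := (trivializationAt ℂ E x).symmₗ_linearMapAt (R := ℂ) hx v
    rw [← hτ] at hw hv'
    have h1 : τ w = ((τ v)⁻¹ * τ w) • τ v := by
      rw [smul_eq_mul]; field_simp
    rw [h1, map_smul, hv'] at hw
    exact hw.symm
  have key : LinearMap.id = (tensorCoord n v).smulRight (tensorPow n v) := by
    apply PiTensorProduct.ext
    ext w
    simp only [LinearMap.compMultilinearMap_apply, LinearMap.id_apply,
      LinearMap.smulRight_apply, tensorCoord, PiTensorProduct.lift.tprod,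
      MultilinearMap.compLinearMap_apply, MultilinearMap.mkPiAlgebra_apply,
      LinearMap.smul_apply, smul_eq_mul, tensorPow]
    rw [← MultilinearMap.map_smul_univ]
    congr 1
    funext i
    exact hline (w i)
  exact LinearMap.congr_fun key u

/-- A smooth Hermitian metric on the holomorphic line bundle `E`, linear in the first and
conjugate-linear in the second argument. -/
structure HermitianMetric where
  /-- the Hermitian form on each fibre -/
  form : ∀ x, E x →ₗ[ℂ] E x →ₗ⋆[ℂ] ℂ
  conj_symm : ∀ x (u v : E x), conj (form x u v) = form x v u
  pos : ∀ x (u : E x), u ≠ 0 → 0 < (form x u u).re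
  smooth : ∀ (U : Set M) (e : ∀ x, E x), IsHolomorphicFrame E U e →
    ContMDiffOn 𝓘(ℝ, ℂ) 𝓘(ℝ, ℝ) ∞ (fun x => (form x (e x) (e x)).re) U

/-- A section of the tensor power `E^{⊗ n}` (no regularity). -/
abbrev PowSection (n : ℕ) : Type _ := ∀ x : M, ⨂[ℂ]^n (E x)

variable {E}

/-- The frame of `E` near `x` given by the preferred local trivialization of the bundle at `x`. -/
def baseFrame (x : M) : ∀ y, E y := fun y => (trivializationAt ℂ E x).symm y 1

/-- The function `f` with `s = f e^{⊗ n}`. -/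
def localRep {n : ℕ} (e : ∀ x, E x) (s : PowSection E n) (x : M) : ℂ :=
  tensorCoord n (e x) (s x)

variable (E) in
/-- The space `H⁰(M, E^{⊗ n})` of global holomorphic sections: in every local holomorphic frame
`e` of `E` one has `s = f e^{⊗ n}` with `f` holomorphic. -/
def holomorphicSections (n : ℕ) : Submodule ℂ (PowSection E n) where
  carrier := {s | ∀ (U : Set M) (e : ∀ x, E x), IsHolomorphicFrame E U e →
    MDifferentiableOn 𝓘(ℂ) 𝓘(ℂ) (localRep e s) U}
  add_mem' := by
    intro s t hs ht U e he
    have : localRep e (s + t) = localRep e s + localRep e t := by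
      funext x; simp [localRep]
    rw [this]
    exact (hs U e he).add (ht U e he)
  zero_mem' := by
    intro U e he
    have : localRep e (0 : PowSection E n) = fun _ => 0 := by
      funext x; simp [localRep]
    rw [this]
    exact mdifferentiableOn_const
  smul_mem' := by
    intro a s hs U e he
    have : localRep e (a • s) = a • localRep e s := by
      funext x; simp [localRep]
    rw [this]
    exact (hs U e he).const_smul a

/-- The local potential `φ = - log h(e, e)` of the metric in the frame `e`,
read in the coordinate `c`. -/
def potential (h : HermitianMetric E) (e : ∀ x, E x) (c : OpenPartialHomeomorph M ℂ) (ζ : ℂ) : ℂ :=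
  ((-Real.log (h.form (c.symm ζ) (e (c.symm ζ)) (e (c.symm ζ))).re : ℝ) : ℂ)

/-- The coefficient `∂²φ/∂z∂z̄` of the curvature form `∂²φ/∂z∂z̄ (i/2) dz ∧ dz̄`. -/
def curvature (h : HermitianMetric E) (e : ∀ x, E x) (c : OpenPartialHomeomorph M ℂ) (ζ : ℂ) : ℝ :=
  (wirtinger (wirtingerBar (potential h e c)) ζ).re

/-- The Hermitian line bundle `(E, h)` is positive: its curvature form is a positive
`(1,1)`-form. -/
def HermitianMetric.IsPositive (h : HermitianMetric E) : Prop :=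
  ∀ (c : OpenPartialHomeomorph M ℂ) (U : Set M) (e : ∀ x, E x), IsHolomorphicChart c →
    IsHolomorphicFrame E U e → ∀ x ∈ U ∩ c.source, 0 < curvature h e c (c x)

/-- The measure on the domain of the chart `c` given there by the Kähler form
`ω = ∂²φ/∂z∂z̄ (i/2) dz ∧ dz̄`; note that `(i/2) dz ∧ dz̄` is Lebesgue measure and that
`∂²φ/∂z∂z̄` does not depend on the local frame. -/
def chartMeasure [MeasurableSpace M] (h : HermitianMetric E) (c : OpenPartialHomeomorph M ℂ) :
    Measure M :=
  ((volume.restrict c.target).withDensity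
    fun ζ => ENNReal.ofReal (curvature h (baseFrame (c.symm ζ)) c ζ)).map c.symm

/-- The measure on `M` given by the Kähler form `ω`. The measures of the single charts agree on
the overlaps of the charts, so that their supremum is the measure obtained by gluing them. -/
def kahlerMeasure [MeasurableSpace M] (h : HermitianMetric E) : Measure M :=
  ⨆ x : M, chartMeasure h (chartAt ℂ x)

/-- The pointwise Hermitian product `hⁿ(s, t) = f ḡ h(e, e)ⁿ` of `s = f e^{⊗ n}` and
`t = g e^{⊗ n}`. It does not depend on the frame. -/
def pointwiseInner (h : HermitianMetric E) {n : ℕ} (s t : PowSection E n) (x : M) : ℂ :=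
  localRep (baseFrame x) s x * conj (localRep (baseFrame x) t x) *
    h.form x (baseFrame x x) (baseFrame x x) ^ n

/-- The inner product `⟨s, t⟩ = ∫_M hⁿ(s, t) ω`. -/
def sectionInner [MeasurableSpace M] (h : HermitianMetric E) {n : ℕ} (s t : PowSection E n) : ℂ :=
  ∫ x, pointwiseInner h s t x ∂(kahlerMeasure h)

/-- The coefficient `∂f/∂z - n ∂φ/∂z f` of `e^{⊗ n} ⊗ dz` in the Chern connection
`∇ s` of `s = f e^{⊗ n}`, at the point `x`, in the frame `e` and the coordinate `c`. -/
def chernCoeff (h : HermitianMetric E) {n : ℕ} (e : ∀ x, E x) (c : OpenPartialHomeomorph M ℂ)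
    (s : PowSection E n) (x : M) : ℂ :=
  deriv (localRep e s ∘ c.symm) (c x) - n * wirtinger (potential h e c) (c x) * localRep e s x

lemma differentiableAt_localRep [IsManifold 𝓘(ℂ) ω M] {n : ℕ} {s : PowSection E n}
    (hs : s ∈ holomorphicSections E n) {U : Set M} {e : ∀ x, E x} (he : IsHolomorphicFrame E U e)
    {c : OpenPartialHomeomorph M ℂ} (hc : IsHolomorphicChart c) {x : M} (hx : x ∈ U ∩ c.source) :
    DifferentiableAt ℂ (localRep e s ∘ c.symm) (c x) := by
  have h1 : MDifferentiableAt 𝓘(ℂ) 𝓘(ℂ) (localRep e s) x :=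
    (hs U e he x hx.1).mdifferentiableAt (he.isOpen.mem_nhds hx.1)
  have h2 : MDifferentiableAt 𝓘(ℂ) 𝓘(ℂ) c.symm (c x) := by
    have := contMDiffOn_symm_of_mem_maximalAtlas (I := 𝓘(ℂ)) (n := ω) hc
    exact ((this (c x) (c.map_source hx.2)).contMDiffAt
      (c.open_target.mem_nhds (c.map_source hx.2))).mdifferentiableAt (by simp)
  rw [← mdifferentiableAt_iff_differentiableAt]
  apply MDifferentiableAt.comp (c x) _ h2
  rw [c.left_inv hx.2]
  exact h1

/-- The subspace of `H⁰(M, E^{⊗ n})` of the sections `s` with `∇ s (q) = 0`, where `∇` is the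
Chern connection. (The vanishing does not depend on the frame and the coordinate.) -/
def criticalSections [IsManifold 𝓘(ℂ) ω M] (h : HermitianMetric E) (n : ℕ) (q : M) :
    Submodule ℂ (PowSection E n) where
  carrier := {s | s ∈ holomorphicSections E n ∧
    ∀ (c : OpenPartialHomeomorph M ℂ) (U : Set M) (e : ∀ x, E x), IsHolomorphicChart c →
      IsHolomorphicFrame E U e → q ∈ U ∩ c.source → chernCoeff h e c s q = 0}
  add_mem' := by
    rintro s t ⟨hs, hs'⟩ ⟨ht, ht'⟩
    refine ⟨add_mem hs ht, fun c U e hc he hq => ?_⟩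
    have h1 := hs' c U e hc he hq
    have h2 := ht' c U e hc he hq
    have h3 : localRep e (s + t) = localRep e s + localRep e t := by
      funext x; simp [localRep]
    have h4 : (localRep e s + localRep e t) ∘ c.symm
        = localRep e s ∘ c.symm + localRep e t ∘ c.symm := rfl
    unfold chernCoeff at h1 h2 ⊢
    rw [h3, h4, deriv_add (differentiableAt_localRep hs he hc hq)
      (differentiableAt_localRep ht he hc hq), Pi.add_apply]
    linear_combination h1 + h2
  zero_mem' := by
    refine ⟨zero_mem _, fun c U e hc he hq => ?_⟩
    have h3 : localRep e (0 : PowSection E n) = fun _ => 0 := by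
      funext x; simp [localRep]
    have h4 : ((fun _ => 0 : M → ℂ)) ∘ c.symm = fun _ => 0 := rfl
    simp [chernCoeff, h3, h4]
  smul_mem' := by
    rintro a s ⟨hs, hs'⟩
    refine ⟨Submodule.smul_mem _ a hs, fun c U e hc he hq => ?_⟩
    have h1 := hs' c U e hc he hq
    have h3 : localRep e (a • s) = a • localRep e s := by
      funext x; simp [localRep]
    have h4 : (a • localRep e s) ∘ c.symm = a • (localRep e s ∘ c.symm) := rfl
    unfold chernCoeff at h1 ⊢
    rw [h3, h4, deriv_const_smul a (differentiableAt_localRep hs he hc hq), Pi.smul_apply,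
      smul_eq_mul, smul_eq_mul]
    linear_combination a * h1

/-- `b` is an orthonormal basis of the space `W` of sections. -/
structure IsOrthonormalBasis [MeasurableSpace M] (h : HermitianMetric E) {n d : ℕ}
    (W : Submodule ℂ (PowSection E n)) (b : Fin d → PowSection E n) : Prop where
  orthonormal : ∀ i j, sectionInner h (b i) (b j) = if i = j then 1 else 0
  span_eq : Submodule.span ℂ (range b) = W

/-! ### Gaussian random sections and their zeros -/

/-- The standard complex Gaussian measure `e^{-|a|²} π^{-d} da` on `ℂ^d`. -/
def complexGaussian (d : ℕ) : Measure (Fin d → ℂ) :=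
  (volume : Measure (Fin d → ℂ)).withDensity
    fun a => ENNReal.ofReal (Real.exp (-∑ j, ‖a j‖ ^ 2) / Real.pi ^ d)

/-- The section `∑ a_j b_j`. If `b` is an orthonormal basis of `W` and `a` has the standard
complex Gaussian law, this is the Gaussian random section with values in `W`. -/
def randomSection {n d : ℕ} (b : Fin d → PowSection E n) (a : Fin d → ℂ) : PowSection E n :=
  ∑ j, a j • b j

/-- The multiplicity of `x` as a zero of `s` (it is `0` if `s x ≠ 0`, and `⊤` if `s` vanishes
near `x`). -/
def zeroOrder {n : ℕ} (s : PowSection E n) (x : M) : ℕ∞ :=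
  analyticOrderAt (localRep (baseFrame x) s ∘ (chartAt ℂ x).symm) (chartAt ℂ x x)

/-- The sum of `ψ` over the zeros of `s`, counted with multiplicities. -/
def zeroSum {n : ℕ} (s : PowSection E n) (ψ : M → ℝ) : ℝ :=
  ∑ᶠ x, ((zeroOrder s x).toNat : ℝ) * ψ x

/-- The kernel `Π(x, y) = ∑ b_j(x) ⊗ conj (b_j(y))`, in the frame `e` at `x` and the frame
`e'` at `y`. -/
def kernel {n d : ℕ} (b : Fin d → PowSection E n) (e e' : ∀ x, E x) (x y : M) : ℂ :=
  ∑ j, localRep e (b j) x * conj (localRep e' (b j) y)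

/-- `c` and `e` are a coordinate and a frame around `q` (`e` being a frame on `U`) such that the
potential `φ` of the metric in the frame `e` satisfies `∂φ(q) = 0`. -/
structure IsAdapted (h : HermitianMetric E) (q : M) (c : OpenPartialHomeomorph M ℂ) (U : Set M)
    (e : ∀ x, E x) : Prop where
  chart : IsHolomorphicChart c
  frame : IsHolomorphicFrame E U e
  mem : q ∈ U ∩ c.source
  wirtinger_potential : wirtinger (potential h e c) (c q) = 0

/-- The function
`Π^q(z,z) = Π(z,z) - |∂_{w̄} Π(z,w)|_{w=q}|² / (∂_z ∂_{z̄} Π)(q,q)`,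
in the frame `e` at `z`, the frame `e'` at `q` and the coordinate `c'` at `q`. -/
def conditionalKernel {n d : ℕ} (b : Fin d → PowSection E n) (q : M)
    (c' : OpenPartialHomeomorph M ℂ) (e' e : ∀ x, E x) (z : M) : ℂ :=
  kernel b e e z z -
    ((‖wirtingerBar (fun ζ => kernel b e e' z (c'.symm ζ)) (c' q)‖ ^ 2 : ℝ) : ℂ) /
      wirtinger (wirtingerBar fun ζ => kernel b e' e' (c'.symm ζ) (c'.symm ζ)) (c' q)

/-- The operator `∂²/∂z∂z̄` applied to the function `ψ`, read in the coordinate `c`. -/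
def ddbar (ψ : M → ℝ) (c : OpenPartialHomeomorph M ℂ) (ζ : ℂ) : ℝ :=
  (wirtinger (wirtingerBar fun ξ => ((ψ (c.symm ξ) : ℝ) : ℂ)) ζ).re

end Bundle

end RandomSections

end

/-!
The sections that are critical at `q` form a space `W` of holomorphic sections with orthonormal
basis `T`, and the random section is `∑ a_j T_j` with a Gaussian vector `a`. Two facts give the
formula for the expected zeros.

*The expected zeros of a Gaussian section of any such space are `(i/2π) ∂∂̄ log ∑ |T_j|²`.* By the
Poincaré–Lelong formula (`integral_log_norm_mul_ddbar`), the zeros of a single section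
`∑ a_j f_j e^{⊗ n}` are `(i/π) ∂∂̄ log |∑ a_j f_j|`. For fixed `z` the number `∑ a_j f_j(z)` is
Gaussian with variance `∑ |f_j(z)|²`, by unitary invariance of the Gaussian measure, so that the
expectation of `log |∑ a_j f_j(z)|` is `½ log ∑ |f_j(z)|² + c` with a universal constant `c`
(`exists_integral_log_norm_sum`). Fubini's theorem allows to interchange the expectation with the
integration against `∂∂̄ψ`, which annihilates the constant (`integral_sum_zeros`, and
`integral_zeroSum_of_tsupport_subset` on the surface). The Poincaré–Lelong formula follows by
factoring out the zeros from the case of `log |z - a|`, where `½ log (|z - a|² + ε)` is used as a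
smooth approximation. For general `ψ` the existence of the expectation follows by a partition of
unity, the sum over the zeros being finite (`integrable_zeroSum`).

*The function `Π^q(z,z)` is `∑ |T_j(z)|²`* (`conditionalKernel_eq_sum`). In a frame adapted to `q`
the covariant derivative at `q` is the ordinary derivative, so in coordinates with respect to an
orthonormal basis `S` of the space of all sections, `W` is the orthogonal complement of the vector
`(conj S_i'(q))_i`. Parseval's identity in this complement (`sum_norm_inner_sq_eq_sub`) is the
asserted formula, also if that vector is zero.

Adapted frames are obtained from an arbitrary frame by a factor `exp (α z)` (`exists_isAdapted`).
The space of holomorphic sections is finite-dimensional, since by the Schwarz lemma a section that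
vanishes to high order at finitely many suitable points is zero
(`finiteDimensional_holomorphicSections`). The zeros are almost surely simple in the absence of base
points: where `T_i` has no zeros, a double zero of `∑ a_j T_j` forces `a_i` to be a critical value
of a holomorphic function determined by the other coefficients, and the critical values form a null
set (`volume_setOf_double_zero`, `ae_zeroOrder_le_one`).
-/

noncomputable section

namespace RandomSections

/-! ### Wirtinger calculus -/

section Wirtinger

variable {f g : ℂ → ℂ} {z : ℂ}

lemma wirtinger_congr (h : f =ᶠ[𝓝 z] g) : wirtinger f z = wirtinger g z := by
  simp only [wirtinger, h.fderiv_eq]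

lemma wirtingerBar_congr (h : f =ᶠ[𝓝 z] g) : wirtingerBar f z = wirtingerBar g z := by
  simp only [wirtingerBar, h.fderiv_eq]

lemma fderiv_real_apply_of_differentiableAt (hf : DifferentiableAt ℂ f z) (v : ℂ) :
    fderiv ℝ f z v = deriv f z * v := by
  rw [hf.hasDerivAt.complexToReal_fderiv.fderiv]
  simp

lemma wirtinger_of_differentiableAt (hf : DifferentiableAt ℂ f z) : wirtinger f z = deriv f z := by
  simp only [wirtinger, fderiv_real_apply_of_differentiableAt hf]
  linear_combination (-deriv f z / 2) * Complex.I_mul_I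

lemma wirtingerBar_of_differentiableAt (hf : DifferentiableAt ℂ f z) : wirtingerBar f z = 0 := by
  simp only [wirtingerBar, fderiv_real_apply_of_differentiableAt hf]
  linear_combination (deriv f z / 2) * Complex.I_mul_I

lemma fderiv_conj (v : ℂ) :
    fderiv ℝ (fun ζ => conj (f ζ)) z v = conj (fderiv ℝ f z v) := by
  have := Complex.conjCLE.comp_fderiv (f := f) (x := z)
  have h2 : (Complex.conjCLE ∘ f) = fun ζ => conj (f ζ) := by
    funext ζ; simp
  rw [h2] at this
  rw [this]; simp

lemma wirtinger_conj : wirtinger (fun ζ => conj (f ζ)) z = conj (wirtingerBar f z) := by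
  simp only [wirtinger, wirtingerBar, fderiv_conj]
  simp [sub_eq_add_neg, Complex.conj_ofNat]

lemma wirtingerBar_conj : wirtingerBar (fun ζ => conj (f ζ)) z = conj (wirtinger f z) := by
  simp only [wirtinger, wirtingerBar, fderiv_conj]
  simp [sub_eq_add_neg, Complex.conj_ofNat]

lemma wirtinger_add (hf : DifferentiableAt ℝ f z) (hg : DifferentiableAt ℝ g z) :
    wirtinger (fun ζ => f ζ + g ζ) z = wirtinger f z + wirtinger g z := by
  simp only [wirtinger, fderiv_fun_add hf hg, _root_.add_apply]; ring

lemma wirtinger_sub (hf : DifferentiableAt ℝ f z) (hg : DifferentiableAt ℝ g z) :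
    wirtinger (fun ζ => f ζ - g ζ) z = wirtinger f z - wirtinger g z := by
  simp only [wirtinger, fderiv_fun_sub hf hg, _root_.sub_apply]; ring

lemma wirtinger_mul (hf : DifferentiableAt ℝ f z) (hg : DifferentiableAt ℝ g z) :
    wirtinger (fun ζ => f ζ * g ζ) z = wirtinger f z * g z + f z * wirtinger g z := by
  simp only [wirtinger, fderiv_fun_mul hf hg, _root_.add_apply,
    _root_.smul_apply, smul_eq_mul]; ring

lemma wirtingerBar_mul (hf : DifferentiableAt ℝ f z) (hg : DifferentiableAt ℝ g z) :
    wirtingerBar (fun ζ => f ζ * g ζ) z = wirtingerBar f z * g z + f z * wirtingerBar g z := by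
  simp only [wirtingerBar, fderiv_fun_mul hf hg, _root_.add_apply,
    _root_.smul_apply, smul_eq_mul]; ring

lemma wirtinger_sum {ι : Type*} (s : Finset ι) {F : ι → ℂ → ℂ}
    (hF : ∀ i ∈ s, DifferentiableAt ℝ (F i) z) :
    wirtinger (fun ζ => ∑ i ∈ s, F i ζ) z = ∑ i ∈ s, wirtinger (F i) z := by
  simp only [wirtinger, fderiv_fun_sum hF, _root_.sum_apply, Finset.mul_sum,
    ← Finset.sum_sub_distrib, Finset.sum_div]

lemma wirtingerBar_sum {ι : Type*} (s : Finset ι) {F : ι → ℂ → ℂ}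
    (hF : ∀ i ∈ s, DifferentiableAt ℝ (F i) z) :
    wirtingerBar (fun ζ => ∑ i ∈ s, F i ζ) z = ∑ i ∈ s, wirtingerBar (F i) z := by
  simp only [wirtingerBar, fderiv_fun_sum hF, _root_.sum_apply, Finset.mul_sum,
    ← Finset.sum_add_distrib, Finset.sum_div]

/-- Chain rule: precomposition with a holomorphic function. -/
lemma wirtinger_comp_right (hf : DifferentiableAt ℝ f (g z)) (hg : DifferentiableAt ℂ g z) :
    wirtinger (fun ζ => f (g ζ)) z = wirtinger f (g z) * deriv g z := by
  have h1 : fderiv ℝ (fun ζ => f (g ζ)) z = (fderiv ℝ f (g z)).comp (fderiv ℝ g z) :=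
    fderiv_comp z hf (hg.restrictScalars ℝ)
  have key : ∀ w : ℂ, fderiv ℝ f (g z) w
      = w.re * fderiv ℝ f (g z) 1 + w.im * fderiv ℝ f (g z) Complex.I := by
    intro w
    have hw : w = w.re • (1 : ℂ) + w.im • Complex.I := by
      simp
    conv_lhs => rw [hw, map_add, map_smul, map_smul]
    simp
  simp only [wirtinger, h1, ContinuousLinearMap.comp_apply,
    fderiv_real_apply_of_differentiableAt hg]
  rw [key (deriv g z * 1), key (deriv g z * Complex.I)]
  have hD := Complex.re_add_im (deriv g z)
  simp only [mul_one, Complex.mul_re, Complex.mul_im, Complex.I_re, Complex.I_im, mul_zero,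
    zero_sub, add_zero, Complex.ofReal_neg]
  linear_combination (fderiv ℝ f (g z) 1 - Complex.I * fderiv ℝ f (g z) Complex.I) / 2 * hD +
    (fderiv ℝ f (g z) Complex.I * (deriv g z).im / 2) * Complex.I_mul_I

/-- Chain rule: postcomposition with a holomorphic function. -/
lemma wirtinger_comp_left (hf : DifferentiableAt ℂ f (g z)) (hg : DifferentiableAt ℝ g z) :
    wirtinger (fun ζ => f (g ζ)) z = deriv f (g z) * wirtinger g z := by
  have h1 : fderiv ℝ (fun ζ => f (g ζ)) z = (fderiv ℝ f (g z)).comp (fderiv ℝ g z) :=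
    fderiv_comp z (hf.restrictScalars ℝ) hg
  simp only [wirtinger, h1, ContinuousLinearMap.comp_apply,
    fderiv_real_apply_of_differentiableAt hf]
  ring

lemma wirtingerBar_comp_left (hf : DifferentiableAt ℂ f (g z)) (hg : DifferentiableAt ℝ g z) :
    wirtingerBar (fun ζ => f (g ζ)) z = deriv f (g z) * wirtingerBar g z := by
  have h1 : fderiv ℝ (fun ζ => f (g ζ)) z = (fderiv ℝ f (g z)).comp (fderiv ℝ g z) :=
    fderiv_comp z (hf.restrictScalars ℝ) hg
  simp only [wirtingerBar, h1, ContinuousLinearMap.comp_apply,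
    fderiv_real_apply_of_differentiableAt hf]
  ring

end Wirtinger

/-! ### Integration by parts against test functions -/

section Parts

variable {u G : ℂ → ℂ} {V : Set ℂ}

lemma contDiff_fderiv_apply {k : ℕ∞} (hG : ContDiff ℝ (k + 1) G) (v : ℂ) :
    ContDiff ℝ k (fun z => fderiv ℝ G z v) :=
  (hG.fderiv_right le_rfl).clm_apply contDiff_const

lemma contDiffOn_fderiv_apply {k : ℕ∞} (hV : IsOpen V) (hu : ContDiffOn ℝ (k + 1) u V) (v : ℂ) :
    ContDiffOn ℝ k (fun z => fderiv ℝ u z v) V :=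
  (hu.fderiv_of_isOpen hV le_rfl).clm_apply contDiffOn_const

lemma contDiff_wirtinger {k : ℕ∞} (hG : ContDiff ℝ (k + 1) G) : ContDiff ℝ k (wirtinger G) :=
  ((contDiff_fderiv_apply hG 1).sub (contDiff_const.mul (contDiff_fderiv_apply hG _))).div_const 2

lemma contDiff_wirtingerBar {k : ℕ∞} (hG : ContDiff ℝ (k + 1) G) :
    ContDiff ℝ k (wirtingerBar G) :=
  ((contDiff_fderiv_apply hG 1).add (contDiff_const.mul (contDiff_fderiv_apply hG _))).div_const 2

lemma contDiffOn_wirtinger {k : ℕ∞} (hV : IsOpen V) (hu : ContDiffOn ℝ (k + 1) u V) :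
    ContDiffOn ℝ k (wirtinger u) V :=
  ((contDiffOn_fderiv_apply hV hu 1).sub
    (contDiffOn_const.mul (contDiffOn_fderiv_apply hV hu _))).div_const 2

lemma tsupport_wirtinger_subset : tsupport (wirtinger G) ⊆ tsupport G := by
  refine closure_minimal (fun z hz => ?_) (isClosed_tsupport G)
  by_contra h
  apply hz
  have : G =ᶠ[𝓝 z] fun _ => 0 := by
    rw [notMem_tsupport_iff_eventuallyEq] at h; exact h
  simp [wirtinger, this.fderiv_eq]

lemma tsupport_wirtingerBar_subset : tsupport (wirtingerBar G) ⊆ tsupport G := by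
  refine closure_minimal (fun z hz => ?_) (isClosed_tsupport G)
  by_contra h
  apply hz
  have : G =ᶠ[𝓝 z] fun _ => 0 := by
    rw [notMem_tsupport_iff_eventuallyEq] at h; exact h
  simp [wirtingerBar, this.fderiv_eq]

lemma integrable_mul_of_tsupport_subset (hV : IsOpen V) (hu : ContinuousOn u V)
    (hG : Continuous G) (hGc : HasCompactSupport G) (hGV : tsupport G ⊆ V) :
    Integrable (fun z => u z * G z) := by
  apply Continuous.integrable_of_hasCompactSupport _ hGc.mul_left
  apply continuous_of_tsupport
  intro z hz
  have : z ∈ V := hGV (tsupport_mul_subset_right hz)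
  exact (hu.continuousAt (hV.mem_nhds this)).mul hG.continuousAt

lemma integral_mul_fderiv_of_tsupport_subset (hV : IsOpen V) (hu : ContDiffOn ℝ 1 u V)
    (hG : ContDiff ℝ 1 G) (hGc : HasCompactSupport G) (hGV : tsupport G ⊆ V) (v : ℂ) :
    Integrable (fun z => u z * fderiv ℝ G z v) ∧ Integrable (fun z => fderiv ℝ u z v * G z) ∧
    ∫ z, u z * fderiv ℝ G z v = - ∫ z, fderiv ℝ u z v * G z := by
  have hG0 : ContDiff ℝ ((0 : ℕ∞) + 1) G := by simpa using hG
  have hu0 : ContDiffOn ℝ ((0 : ℕ∞) + 1) u V := by simpa using hu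
  have i1 : Integrable (fun z => fderiv ℝ u z v * G z) :=
    integrable_mul_of_tsupport_subset hV (contDiffOn_fderiv_apply hV hu0 v).continuousOn
      hG.continuous hGc hGV
  have i2 : Integrable (fun z => u z * fderiv ℝ G z v) :=
    integrable_mul_of_tsupport_subset hV hu.continuousOn
      (contDiff_fderiv_apply hG0 v).continuous (hGc.fderiv_apply ℝ v)
      ((tsupport_fderiv_apply_subset ℝ v).trans hGV)
  have i3 : Integrable (fun z => u z * G z) :=
    integrable_mul_of_tsupport_subset hV hu.continuousOn hG.continuous hGc hGV
  refine ⟨i2, i1, integral_mul_fderiv_eq_neg_fderiv_mul_of_integrable i1 i2 i3 ?_ ?_⟩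
  · intro z hz
    exact (hu.contDiffAt (hV.mem_nhds (hGV hz))).differentiableAt (by simp)
  · intro z _
    exact hG.differentiable (by simp) z

lemma integral_mul_wirtinger (hV : IsOpen V) (hu : ContDiffOn ℝ 1 u V)
    (hG : ContDiff ℝ 1 G) (hGc : HasCompactSupport G) (hGV : tsupport G ⊆ V) :
    ∫ z, u z * wirtinger G z = - ∫ z, wirtinger u z * G z := by
  obtain ⟨a1, b1, h1⟩ := integral_mul_fderiv_of_tsupport_subset hV hu hG hGc hGV 1
  obtain ⟨a2, b2, h2⟩ := integral_mul_fderiv_of_tsupport_subset hV hu hG hGc hGV Complex.I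
  have e1 : ∀ z, u z * wirtinger G z
      = (1 / 2) * (u z * fderiv ℝ G z 1) - (Complex.I / 2) * (u z * fderiv ℝ G z Complex.I) := by
    intro z; unfold wirtinger; ring
  have e2 : ∀ z, wirtinger u z * G z
      = (1 / 2) * (fderiv ℝ u z 1 * G z) - (Complex.I / 2) * (fderiv ℝ u z Complex.I * G z) := by
    intro z; unfold wirtinger; ring
  simp only [e1, e2]
  rw [integral_sub (a1.const_mul _) (a2.const_mul _), integral_sub (b1.const_mul _)
    (b2.const_mul _), integral_const_mul, integral_const_mul, integral_const_mul,
    integral_const_mul, h1, h2]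
  ring

lemma integral_mul_wirtingerBar (hV : IsOpen V) (hu : ContDiffOn ℝ 1 u V)
    (hG : ContDiff ℝ 1 G) (hGc : HasCompactSupport G) (hGV : tsupport G ⊆ V) :
    ∫ z, u z * wirtingerBar G z = - ∫ z, wirtingerBar u z * G z := by
  obtain ⟨a1, b1, h1⟩ := integral_mul_fderiv_of_tsupport_subset hV hu hG hGc hGV 1
  obtain ⟨a2, b2, h2⟩ := integral_mul_fderiv_of_tsupport_subset hV hu hG hGc hGV Complex.I
  have e1 : ∀ z, u z * wirtingerBar G z
      = (1 / 2) * (u z * fderiv ℝ G z 1) + (Complex.I / 2) * (u z * fderiv ℝ G z Complex.I) := by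
    intro z; unfold wirtingerBar; ring
  have e2 : ∀ z, wirtingerBar u z * G z
      = (1 / 2) * (fderiv ℝ u z 1 * G z) + (Complex.I / 2) * (fderiv ℝ u z Complex.I * G z) := by
    intro z; unfold wirtingerBar; ring
  simp only [e1, e2]
  rw [integral_add (a1.const_mul _) (a2.const_mul _), integral_add (b1.const_mul _)
    (b2.const_mul _), integral_const_mul, integral_const_mul, integral_const_mul,
    integral_const_mul, h1, h2]
  ring

/-- `∂∂̄` is symmetric: `∫ u ∂∂̄G = ∫ (∂̄∂u) G` for a test function `G` supported in the open set
on which `u` is twice differentiable. -/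
lemma integral_mul_wirtinger_wirtingerBar (hV : IsOpen V) (hu : ContDiffOn ℝ 2 u V)
    (hG : ContDiff ℝ 2 G) (hGc : HasCompactSupport G) (hGV : tsupport G ⊆ V) :
    ∫ z, u z * wirtinger (wirtingerBar G) z = ∫ z, wirtingerBar (wirtinger u) z * G z := by
  have hG1 : ContDiff ℝ (1 : ℕ∞) (wirtingerBar G) :=
    contDiff_wirtingerBar (by norm_cast)
  have hu1 : ContDiffOn ℝ (1 : ℕ∞) (wirtinger u) V :=
    contDiffOn_wirtinger hV (by norm_cast)
  rw [integral_mul_wirtinger hV (hu.of_le (by norm_num)) hG1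
    (hGc.mono' (subset_closure.trans tsupport_wirtingerBar_subset))
    (tsupport_wirtingerBar_subset.trans hGV),
    integral_mul_wirtingerBar hV hu1 (hG.of_le (by norm_num)) hGc hGV, neg_neg]

end Parts

/-! ### The logarithmic potential -/

section LogPotential

open Real (log)

lemma integrableOn_log_norm_closedBall (a : ℂ) (r : ℝ) :
    IntegrableOn (fun z : ℂ => log ‖z - a‖) (Metric.closedBall a r) := by
  have h0 : IntegrableOn (fun z : ℂ => log ‖z‖) (Metric.ball 0 (r + 1)) := by
    rw [integrableOn_fun_norm_addHaar (volume : Measure ℂ) (f := log)]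
    simp only [Complex.finrank_real_complex, smul_eq_mul]
    have : ContinuousOn (fun y : ℝ => y ^ (2 - 1) * log y) (Icc 0 (r + 1)) := by
      simpa using Real.continuous_mul_log.continuousOn
    exact (this.integrableOn_compact isCompact_Icc).mono_set Ioo_subset_Icc_self
  have h1 := ((measurePreserving_sub_right (volume : Measure ℂ) a).integrableOn_comp_preimage
    (MeasurableEquiv.subRight a).measurableEmbedding (f := fun z : ℂ => log ‖z‖)
    (s := Metric.ball 0 (r + 1))).2 h0
  refine IntegrableOn.mono_set h1 fun z hz => ?_
  simp only [Metric.mem_closedBall, dist_eq_norm] at hz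
  simp only [mem_preimage, Metric.mem_ball, dist_zero_right]
  linarith

lemma integrableOn_log_norm_sub (a : ℂ) {K : Set ℂ} (hK : IsCompact K) :
    IntegrableOn (fun z : ℂ => log ‖z - a‖) K := by
  obtain ⟨r, hr⟩ := hK.isBounded.subset_closedBall a
  exact (integrableOn_log_norm_closedBall a r).mono_set hr

/-- The total mass of the approximate identity that arises from `∂∂̄ log (|z|² + ε)`. -/
lemma integral_inv_one_add_sq_sq :
    ∫ z : ℂ, 1 / Real.pi * ((1 + ‖z‖ ^ 2) ^ 2)⁻¹ = 1 := by
  rw [integral_fun_norm_addHaar (volume : Measure ℂ) (fun r => 1 / Real.pi * ((1 + r ^ 2) ^ 2)⁻¹)]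
  have hv : (volume : Measure ℂ).real (Metric.ball 0 1) = Real.pi := by
    simp [Measure.real, Complex.volume_ball]
  simp only [Complex.finrank_real_complex, hv, smul_eq_mul]
  have hI : ∫ y in Ioi (0 : ℝ), y ^ (2 - 1) * (1 / Real.pi * ((1 + y ^ 2) ^ 2)⁻¹)
      = 0 - (-(1 / (2 * Real.pi)) * (1 + (0 : ℝ) ^ 2)⁻¹) := by
    refine integral_Ioi_of_hasDerivAt_of_nonneg' (g := fun y => -(1 / (2 * Real.pi)) * (1 + y ^ 2)⁻¹)
      (fun x _ => ?_) (fun x hx => ?_) ?_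
    · have hx : (1 + x ^ 2 : ℝ) ≠ 0 := by positivity
      have h1 : HasDerivAt (fun y : ℝ => 1 + y ^ 2) (2 * x) x := by
        simpa using (hasDerivAt_pow 2 x).const_add 1
      convert! (h1.inv hx).const_mul (-(1 / (2 * Real.pi))) using 1
      have := Real.pi_ne_zero
      field_simp
      norm_num
    · have : (0 : ℝ) < x := hx
      have := Real.pi_pos
      positivity
    · have h1 : Filter.Tendsto (fun y : ℝ => 1 + y ^ 2) Filter.atTop Filter.atTop :=
        Filter.tendsto_atTop_add_const_left _ _ (Filter.tendsto_pow_atTop (by norm_num))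
      simpa using (tendsto_inv_atTop_zero.comp h1).const_mul (-(1 / (2 * Real.pi)))
  rw [hI]
  have := Real.pi_ne_zero
  field_simp
  norm_num

/-- The regularization `|z - a|² + ε` of the squared distance, as a complex number. -/
def regDist (ε : ℝ) (a z : ℂ) : ℂ := (z - a) * conj (z - a) + ε

lemma regDist_eq (ε : ℝ) (a z : ℂ) : regDist ε a z = ((‖z - a‖ ^ 2 + ε : ℝ) : ℂ) := by
  rw [regDist, Complex.mul_conj, Complex.normSq_eq_norm_sq]; push_cast; rfl

lemma regDist_mem_slitPlane {ε : ℝ} (hε : 0 < ε) (a z : ℂ) :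
    regDist ε a z ∈ Complex.slitPlane := by
  rw [regDist_eq, Complex.ofReal_mem_slitPlane]; positivity

lemma contDiff_conj {k : ℕ∞ω} : ContDiff ℝ k (fun z : ℂ => conj z) :=
  Complex.conjCLE.contDiff

lemma contDiff_regDist (ε : ℝ) (a : ℂ) {k : ℕ∞ω} : ContDiff ℝ k (regDist ε a) := by
  have h1 : ContDiff ℝ k (fun z : ℂ => z - a) := contDiff_id.sub contDiff_const
  exact (h1.mul (contDiff_conj.comp h1)).add contDiff_const

lemma differentiableAt_conj_sub (a z : ℂ) : DifferentiableAt ℝ (fun ζ : ℂ => conj (ζ - a)) z :=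
  (contDiff_conj.comp (contDiff_id.sub contDiff_const) : ContDiff ℝ 1 _).differentiable
    (by simp) z

lemma wirtinger_regDist (ε : ℝ) (a z : ℂ) : wirtinger (regDist ε a) z = conj (z - a) := by
  have h1 : DifferentiableAt ℂ (fun ζ : ℂ => ζ - a) z := by fun_prop
  unfold regDist
  rw [wirtinger_add ((h1.restrictScalars ℝ).fun_mul (differentiableAt_conj_sub a z))
    (differentiableAt_const _), wirtinger_mul (h1.restrictScalars ℝ)
    (differentiableAt_conj_sub a z), wirtinger_conj,
    wirtinger_of_differentiableAt h1, wirtingerBar_of_differentiableAt h1,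
    wirtinger_of_differentiableAt (differentiableAt_const _)]
  simp

lemma wirtingerBar_regDist (ε : ℝ) (a z : ℂ) : wirtingerBar (regDist ε a) z = z - a := by
  have h1 : regDist ε a = fun ζ => conj (regDist ε a ζ) := by
    funext ζ; simp [regDist_eq]
  rw [h1, wirtingerBar_conj, wirtinger_regDist]; simp

lemma contDiff_log_regDist {ε : ℝ} (hε : 0 < ε) (a : ℂ) {k : ℕ∞ω} :
    ContDiff ℝ k (fun z => (1 / 2) * Complex.log (regDist ε a z)) := by
  refine contDiff_const.mul (contDiff_iff_contDiffAt.2 fun z => ?_)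
  exact ((Complex.contDiffAt_log (regDist_mem_slitPlane hε a z)).restrict_scalars ℝ).comp z
    (contDiff_regDist ε a).contDiffAt

lemma ddbar_log_regDist {ε : ℝ} (hε : 0 < ε) (a z : ℂ) :
    wirtingerBar (wirtinger fun z => (1 / 2) * Complex.log (regDist ε a z)) z =
      ((1 / 2 * (ε / (‖z - a‖ ^ 2 + ε) ^ 2) : ℝ) : ℂ) := by
  have hd : ∀ ζ, DifferentiableAt ℝ (regDist ε a) ζ := fun ζ =>
    (contDiff_regDist ε a (k := 1)).differentiable (by simp) ζ
  have hne : ∀ ζ, regDist ε a ζ ≠ 0 := fun ζ =>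
    Complex.slitPlane_ne_zero (regDist_mem_slitPlane hε a ζ)
  have h1 : (wirtinger fun z => (1 / 2) * Complex.log (regDist ε a z)) =
      fun ζ => conj (ζ - a) * (1 / 2 * (regDist ε a ζ)⁻¹) := by
    funext ζ
    have hl : HasDerivAt (fun w => (1 / 2 : ℂ) * Complex.log w) (1 / 2 * (regDist ε a ζ)⁻¹)
      (regDist ε a ζ) := (Complex.hasDerivAt_log (regDist_mem_slitPlane hε a ζ)).const_mul _
    rw [wirtinger_comp_left (f := fun w => (1 / 2 : ℂ) * Complex.log w) hl.differentiableAt (hd ζ),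
      hl.deriv, wirtinger_regDist, mul_comm]
  have hl : HasDerivAt (fun w : ℂ => (1 / 2 : ℂ) * w⁻¹) (1 / 2 * (-(regDist ε a z ^ 2)⁻¹))
      (regDist ε a z) := (hasDerivAt_inv (hne z)).const_mul _
  have h2 : DifferentiableAt ℝ (fun ζ => 1 / 2 * (regDist ε a ζ)⁻¹) z :=
    DifferentiableAt.comp (g := fun w : ℂ => (1 / 2 : ℂ) * w⁻¹) z
      (hl.differentiableAt.restrictScalars ℝ) (hd z)
  have h3 : DifferentiableAt ℂ (fun ζ : ℂ => ζ - a) z := by fun_prop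
  rw [h1, wirtingerBar_mul (differentiableAt_conj_sub a z) h2, wirtingerBar_conj,
    wirtinger_of_differentiableAt h3,
    wirtingerBar_comp_left (f := fun w : ℂ => (1 / 2 : ℂ) * w⁻¹) hl.differentiableAt (hd z),
    hl.deriv, wirtingerBar_regDist]
  have h4 : conj (z - a) * (z - a) = regDist ε a z - ε := by rw [regDist]; ring
  have h5 := hne z
  have h6 : deriv (fun ζ : ℂ => ζ - a) z = 1 := by simp
  rw [h6]
  push_cast
  have h7 : ((‖z - a‖ : ℂ) ^ 2 + ε) = regDist ε a z := by rw [regDist_eq]; push_cast; rfl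
  rw [h7]
  field_simp
  simp only [map_one, one_mul]
  linear_combination (-(1 / 1 : ℂ)) * h4

lemma log_regDist_eq {ε : ℝ} (hε : 0 ≤ ε) (a z : ℂ) :
    (1 / 2) * Complex.log (regDist ε a z) = ((1 / 2 * log (‖z - a‖ ^ 2 + ε) : ℝ) : ℂ) := by
  rw [regDist_eq, ← Complex.ofReal_log (by positivity)]; push_cast; rfl

/-- `log |z - a|` is, up to the factor `2/π`, the fundamental solution of `∂∂̄`. It is the
limit of `½ log (|z - a|² + ε)`, whose `∂∂̄` is an approximate identity. -/
theorem integral_log_norm_sub_mul_ddbar (a : ℂ) {G : ℂ → ℂ} (hG : ContDiff ℝ 2 G)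
    (hGc : HasCompactSupport G) :
    ∫ z, (log ‖z - a‖ : ℂ) * wirtinger (wirtingerBar G) z = Real.pi / 2 * G a := by
  set W := wirtinger (wirtingerBar G) with hW
  have hG1 : ContDiff ℝ (1 : ℕ∞) (wirtingerBar G) := contDiff_wirtingerBar (by norm_cast)
  have hWc : Continuous W := (contDiff_wirtinger (k := 0) (by simpa using hG1)).continuous
  have hWs : tsupport W ⊆ tsupport G :=
    tsupport_wirtinger_subset.trans tsupport_wirtingerBar_subset
  have hWcs : HasCompactSupport W := hGc.mono' (subset_closure.trans hWs)
  -- the parameter `c` corresponds to `ε = c⁻²`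
  have key : ∀ c : ℝ, 0 < c →
      ∫ z, ((1 / 2 * log (‖z - a‖ ^ 2 + (c ^ 2)⁻¹) : ℝ) : ℂ) * W z =
      Real.pi / 2 * ∫ z, (c ^ (Module.finrank ℝ ℂ) *
        (1 / Real.pi * ((1 + ‖c • (a - z)‖ ^ 2) ^ 2)⁻¹)) • G z := by
    intro c hc
    have hε : 0 < (c ^ 2)⁻¹ := by positivity
    have h1 := integral_mul_wirtinger_wirtingerBar isOpen_univ
      (contDiff_log_regDist hε a).contDiffOn hG hGc (subset_univ _)
    simp only [ddbar_log_regDist hε a] at h1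
    simp only [log_regDist_eq hε.le a] at h1
    rw [h1, ← integral_const_mul]
    refine integral_congr_ae (Filter.Eventually.of_forall fun z => ?_)
    simp only [Complex.finrank_real_complex, Complex.real_smul, norm_mul, Complex.norm_real,
      Real.norm_eq_abs, abs_of_pos hc, norm_sub_rev a z]
    have hpi : (Real.pi : ℂ) ≠ 0 := by exact_mod_cast Real.pi_ne_zero
    have h2 : (1 / 2 * ((c ^ 2)⁻¹ / (‖z - a‖ ^ 2 + (c ^ 2)⁻¹) ^ 2) : ℝ) =
        Real.pi / 2 * (c ^ 2 * (1 / Real.pi * ((1 + (c * ‖z - a‖) ^ 2) ^ 2)⁻¹)) := by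
      have := Real.pi_ne_zero
      have h3 : ‖z - a‖ ^ 2 + (c ^ 2)⁻¹ = (1 + (c * ‖z - a‖) ^ 2) / c ^ 2 := by
        field_simp; ring
      rw [h3]
      have h4 : 1 + (c * ‖z - a‖) ^ 2 ≠ 0 := by positivity
      field_simp
    rw [h2]; push_cast; ring
  have lim1 : Filter.Tendsto (fun c : ℝ =>
      Real.pi / 2 * ∫ z, (c ^ (Module.finrank ℝ ℂ) *
        (1 / Real.pi * ((1 + ‖c • (a - z)‖ ^ 2) ^ 2)⁻¹)) • G z) Filter.atTop
      (𝓝 ((Real.pi / 2 : ℂ) * G a)) := by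
    refine Filter.Tendsto.const_mul _ ?_
    refine tendsto_integral_comp_smul_smul_of_integrable'
      (φ := fun z : ℂ => 1 / Real.pi * ((1 + ‖z‖ ^ 2) ^ 2)⁻¹) (fun z => ?_)
      integral_inv_one_add_sq_sq ?_ (hG.continuous.integrable_of_hasCompactSupport hGc)
      hG.continuous.continuousAt
    · have := Real.pi_pos
      positivity
    · have h1 : Filter.Tendsto (fun y : ℝ => 1 / Real.pi * (1 + y ^ 2)⁻¹) Filter.atTop (𝓝 0) := by
        have h1 : Filter.Tendsto (fun y : ℝ => 1 + y ^ 2) Filter.atTop Filter.atTop :=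
          Filter.tendsto_atTop_add_const_left _ _ (Filter.tendsto_pow_atTop (by norm_num))
        simpa using (tendsto_inv_atTop_zero.comp h1).const_mul (1 / Real.pi)
      refine squeeze_zero (fun z => ?_) (fun z => ?_)
        (h1.comp (tendsto_norm_cobounded_atTop (E := ℂ)))
      · have := Real.pi_pos
        positivity
      · simp only [Complex.finrank_real_complex, Function.comp]
        have hp := Real.pi_pos
        have h2 : ‖z‖ ^ 2 * ((1 + ‖z‖ ^ 2) ^ 2)⁻¹ ≤ (1 + ‖z‖ ^ 2)⁻¹ := by
          have : (0 : ℝ) < 1 + ‖z‖ ^ 2 := by positivity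
          rw [← div_eq_mul_inv, div_le_iff₀ (by positivity), sq (1 + ‖z‖ ^ 2), ← mul_assoc,
            inv_mul_cancel₀ this.ne', one_mul]
          linarith
        calc ‖z‖ ^ 2 * (1 / Real.pi * ((1 + ‖z‖ ^ 2) ^ 2)⁻¹)
            = 1 / Real.pi * (‖z‖ ^ 2 * ((1 + ‖z‖ ^ 2) ^ 2)⁻¹) := by ring
          _ ≤ _ := by gcongr
  have lim2 : Filter.Tendsto (fun c : ℝ =>
      ∫ z, ((1 / 2 * log (‖z - a‖ ^ 2 + (c ^ 2)⁻¹) : ℝ) : ℂ) * W z) Filter.atTop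
      (𝓝 (∫ z, (log ‖z - a‖ : ℂ) * W z)) := by
    have hKint : ∀ u : ℂ → ℝ, IntegrableOn u (tsupport G) →
        Integrable (fun z => |u z| * ‖W z‖) := by
      intro u hu
      have hb : ∃ B, ∀ z, ‖W z‖ ≤ B := by
        obtain ⟨B, hB⟩ := hWcs.exists_bound_of_continuous hWc
        exact ⟨B, hB⟩
      obtain ⟨B, hB⟩ := hb
      have h1 : IntegrableOn (fun z => |u z| * ‖W z‖) (tsupport G) :=
        Integrable.mul_bdd (c := B) hu.abs hWc.norm.aestronglyMeasurable
          (Filter.Eventually.of_forall fun z => by simpa using hB z)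
      refine (integrableOn_iff_integrable_of_support_subset fun z hz => ?_).1 h1
      by_contra hzG
      exact hz (by simp [image_eq_zero_of_notMem_tsupport (fun h => hzG (hWs h))])
    have hcont : Continuous fun z : ℂ => 1 / 2 * log (‖z - a‖ ^ 2 + 1) := by
      refine continuous_const.mul (Continuous.log (by fun_prop) fun z => by positivity)
    -- for `c ≥ 1` the integrand lies between those of `ε = 0` and `ε = 1`
    refine tendsto_integral_filter_of_dominated_convergence
      (fun z => |log ‖z - a‖| * ‖W z‖ + |1 / 2 * log (‖z - a‖ ^ 2 + 1)| * ‖W z‖) ?_ ?_ ?_ ?_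
    · filter_upwards [Filter.eventually_gt_atTop 0] with c hc
      have : Continuous fun z : ℂ => 1 / 2 * log (‖z - a‖ ^ 2 + (c ^ 2)⁻¹) :=
        continuous_const.mul (Continuous.log (by fun_prop) fun z => by positivity)
      exact ((Complex.continuous_ofReal.comp this).mul hWc).aestronglyMeasurable
    · filter_upwards [Filter.eventually_ge_atTop 1] with c hc
      have hne : ∀ᵐ z : ℂ, z ≠ a := by simp [ae_iff, measure_singleton]
      filter_upwards [hne] with z hz
      have hz' : 0 < ‖z - a‖ := norm_pos_iff.2 (sub_ne_zero.2 hz)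
      have hc1 : (c ^ 2)⁻¹ ≤ 1 := inv_le_one_of_one_le₀ (one_le_pow₀ hc)
      have hc0 : 0 < (c ^ 2)⁻¹ := by positivity
      have e1 : log ‖z - a‖ = 1 / 2 * log (‖z - a‖ ^ 2) := by
        rw [Real.log_pow]; push_cast; ring
      have l1 : log ‖z - a‖ ≤ 1 / 2 * log (‖z - a‖ ^ 2 + (c ^ 2)⁻¹) := by
        rw [e1]; gcongr; linarith
      have l2 : 1 / 2 * log (‖z - a‖ ^ 2 + (c ^ 2)⁻¹) ≤ 1 / 2 * log (‖z - a‖ ^ 2 + 1) := by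
        gcongr
      rw [norm_mul, Complex.norm_real, Real.norm_eq_abs, ← add_mul]
      refine mul_le_mul_of_nonneg_right ?_ (norm_nonneg _)
      rw [abs_le]
      have m1 := neg_abs_le (log ‖z - a‖)
      have m2 := le_abs_self (1 / 2 * log (‖z - a‖ ^ 2 + 1))
      have m3 := abs_nonneg (log ‖z - a‖)
      have m4 := abs_nonneg (1 / 2 * log (‖z - a‖ ^ 2 + 1))
      constructor <;> linarith
    · exact (hKint _ (integrableOn_log_norm_sub a hGc)).add
        (hKint _ (hcont.continuousOn.integrableOn_compact hGc))
    · have hne : ∀ᵐ z : ℂ, z ≠ a := by simp [ae_iff, measure_singleton]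
      filter_upwards [hne] with z hz
      have hz' : 0 < ‖z - a‖ := norm_pos_iff.2 (sub_ne_zero.2 hz)
      have e1 : log ‖z - a‖ = 1 / 2 * log (‖z - a‖ ^ 2 + 0) := by
        rw [add_zero, Real.log_pow]; push_cast; ring
      refine Filter.Tendsto.mul_const _ ?_
      refine (Complex.continuous_ofReal.tendsto _).comp ?_
      rw [e1]
      refine Filter.Tendsto.const_mul _ (Filter.Tendsto.log ?_ (by positivity))
      exact tendsto_const_nhds.add
        (tendsto_inv_atTop_zero.comp (Filter.tendsto_pow_atTop (by norm_num)))
  refine tendsto_nhds_unique lim2 (lim1.congr' ?_)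
  filter_upwards [Filter.eventually_gt_atTop 0] with c hc
  exact (key c hc).symm

end LogPotential

/-! ### The Poincaré–Lelong formula in the plane -/

section PoincareLelong

open Real (log)

lemma integrable_ofReal_mul {u : ℂ → ℝ} {W : ℂ → ℂ} {K : Set ℂ} (hK : IsCompact K)
    (hu : IntegrableOn u K) (hW : Continuous W) (hWK : tsupport W ⊆ K) :
    Integrable (fun z => (u z : ℂ) * W z) := by
  have hWc : HasCompactSupport W := hK.of_isClosed_subset (isClosed_tsupport W) hWK
  obtain ⟨B, hB⟩ := hWc.exists_bound_of_continuous hW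
  have h1 : IntegrableOn (fun z => (u z : ℂ) * W z) K :=
    Integrable.mul_bdd (c := B) hu.ofReal hW.aestronglyMeasurable (Filter.Eventually.of_forall hB)
  refine (integrableOn_iff_integrable_of_support_subset fun z hz => ?_).1 h1
  by_contra hzK
  exact hz (by simp [image_eq_zero_of_notMem_tsupport (fun h => hzK (hWK h))])

lemma continuous_ddbar {G : ℂ → ℂ} (hG : ContDiff ℝ 2 G) :
    Continuous (wirtinger (wirtingerBar G)) :=
  (contDiff_wirtinger (k := 0) (by
    simpa using contDiff_wirtingerBar (k := 1) (by norm_cast))).continuous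

lemma tsupport_ddbar_subset {G : ℂ → ℂ} : tsupport (wirtinger (wirtingerBar G)) ⊆ tsupport G :=
  tsupport_wirtinger_subset.trans tsupport_wirtingerBar_subset

lemma integral_ddbar_eq_zero {G : ℂ → ℂ} (hG : ContDiff ℝ 2 G) (hGc : HasCompactSupport G) :
    ∫ z, wirtinger (wirtingerBar G) z = 0 := by
  have h := integral_mul_wirtinger_wirtingerBar (u := fun _ => 1) isOpen_univ contDiffOn_const hG hGc
    (subset_univ _)
  have h1 : (wirtinger fun _ : ℂ => (1 : ℂ)) = fun _ => 0 := by
    funext z; simp [wirtinger]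
  have h2 : ∀ z, (wirtingerBar fun _ : ℂ => (0 : ℂ)) z = 0 := by
    intro z; simp [wirtingerBar]
  simpa [h1, h2] using h

lemma ofReal_log_norm_eq (w : ℂ) : (log ‖w‖ : ℂ) = 1 / 2 * Complex.log (w * conj w) := by
  rw [Complex.mul_conj, Complex.normSq_eq_norm_sq, ← Complex.ofReal_log (by positivity),
    Real.log_pow]
  push_cast; ring

lemma mul_conj_mem_slitPlane {w : ℂ} (hw : w ≠ 0) : w * conj w ∈ Complex.slitPlane := by
  rw [Complex.mul_conj, Complex.ofReal_mem_slitPlane]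
  exact Complex.normSq_pos.2 hw

lemma contDiffAt_log_norm {g : ℂ → ℂ} {z : ℂ} (hg : AnalyticAt ℂ g z) (hg0 : g z ≠ 0) :
    ContDiffAt ℝ 2 (fun z => (log ‖g z‖ : ℂ)) z := by
  simp only [ofReal_log_norm_eq]
  have hgR : ContDiffAt ℝ 2 g z := hg.contDiffAt.restrict_scalars ℝ
  have hgc : ContDiffAt ℝ 2 (fun ζ => conj (g ζ)) z := contDiff_conj.contDiffAt.comp z hgR
  exact contDiffAt_const.mul (ContDiffAt.comp (g := Complex.log) z
    ((Complex.contDiffAt_log (mul_conj_mem_slitPlane hg0)).restrict_scalars ℝ) (hgR.mul hgc))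

lemma wirtinger_log_norm {g : ℂ → ℂ} {z : ℂ} (hg : AnalyticAt ℂ g z) (hg0 : g z ≠ 0) :
    wirtinger (fun z => (log ‖g z‖ : ℂ)) z = 1 / 2 * (deriv g z / g z) := by
  simp only [ofReal_log_norm_eq]
  have hgR : ContDiffAt ℝ 2 g z := hg.contDiffAt.restrict_scalars ℝ
  have d1 := hgR.differentiableAt (by simp)
  have d2 : DifferentiableAt ℝ (fun ζ => conj (g ζ)) z :=
    (contDiff_conj.contDiffAt.comp z hgR).differentiableAt (by simp)
  have hl : HasDerivAt (fun w => (1 / 2 : ℂ) * Complex.log w) (1 / 2 * (g z * conj (g z))⁻¹)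
    (g z * conj (g z)) := (Complex.hasDerivAt_log (mul_conj_mem_slitPlane hg0)).const_mul _
  rw [wirtinger_comp_left (f := fun w => (1 / 2 : ℂ) * Complex.log w)
    (g := fun z => g z * conj (g z)) hl.differentiableAt (d1.mul d2), hl.deriv,
    wirtinger_mul d1 d2, wirtinger_conj, wirtinger_of_differentiableAt hg.differentiableAt,
    wirtingerBar_of_differentiableAt hg.differentiableAt]
  have h4 : conj (g z) ≠ 0 := by simpa using hg0
  rw [map_zero]
  field_simp
  ring

/-- `log |g|` is harmonic where `g` is holomorphic without zeros. -/
lemma integral_log_norm_mul_ddbar_of_ne_zero {g G : ℂ → ℂ} (hG : ContDiff ℝ 2 G)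
    (hGc : HasCompactSupport G) (hg : AnalyticOnNhd ℂ g (tsupport G))
    (hg0 : ∀ z ∈ tsupport G, g z ≠ 0) :
    ∫ z, (log ‖g z‖ : ℂ) * wirtinger (wirtingerBar G) z = 0 := by
  set V := {z | AnalyticAt ℂ g z ∧ g z ≠ 0} with hV
  have hVo : IsOpen V := by
    rw [isOpen_iff_mem_nhds]
    rintro z ⟨h1, h2⟩
    filter_upwards [h1.eventually_analyticAt, h1.continuousAt.eventually_ne h2] with w h3 h4
      using ⟨h3, h4⟩
  have hGV : tsupport G ⊆ V := fun z hz => ⟨hg z hz, hg0 z hz⟩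
  have hu : ContDiffOn ℝ 2 (fun z => (log ‖g z‖ : ℂ)) V := fun z hz =>
    (contDiffAt_log_norm hz.1 hz.2).contDiffWithinAt
  have h3 : ∀ z ∈ V, wirtingerBar (wirtinger fun z => (log ‖g z‖ : ℂ)) z = 0 := by
    intro z hz
    rw [wirtingerBar_congr (g := fun z => 1 / 2 * (deriv g z / g z))
      (Filter.eventuallyEq_of_mem (hVo.mem_nhds hz) fun w hw => wirtinger_log_norm hw.1 hw.2)]
    exact wirtingerBar_of_differentiableAt
      ((hz.1.deriv.differentiableAt.div hz.1.differentiableAt hz.2).const_mul _)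
  rw [integral_mul_wirtinger_wirtingerBar hVo hu hG hGc hGV]
  refine integral_eq_zero_of_ae (Filter.Eventually.of_forall fun z => ?_)
  by_cases hz : z ∈ tsupport G
  · simp only [h3 z (hGV hz), zero_mul, Pi.zero_apply]
  · simp [image_eq_zero_of_notMem_tsupport hz]

/-- On a compact set, a holomorphic function is a polynomial times a holomorphic function without
zeros. -/
lemma exists_log_norm_factorization {f : ℂ → ℂ} {K : Set ℂ} (hK : IsCompact K)
    (hf : AnalyticOnNhd ℂ f K) (hord : ∀ z ∈ K, analyticOrderAt f z ≠ ⊤) :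
    ∃ (s : Finset ℂ) (g : ℂ → ℂ), (∀ z ∈ s, z ∈ K) ∧ (∀ z ∈ K, z ∉ s → f z ≠ 0) ∧
      AnalyticOnNhd ℂ g K ∧ (∀ z ∈ K, g z ≠ 0) ∧
      ∀ᵐ z ∂volume.restrict K,
        log ‖f z‖ = ∑ u ∈ s, ((analyticOrderAt f u).toNat : ℝ) * log ‖z - u‖ + log ‖g z‖ := by
  have hDfin : (MeromorphicOn.divisor f K).support.Finite :=
    (MeromorphicOn.divisor f K).finiteSupport hK
  have hDval : ∀ u ∈ K, MeromorphicOn.divisor f K u = ((analyticOrderAt f u).toNat : ℤ) := by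
    intro u hu
    rw [MeromorphicOn.AnalyticOnNhd.divisor_apply hf hu]
    obtain ⟨k, hk⟩ := ENat.ne_top_iff_exists.1 (hord u hu)
    rw [← hk]; rfl
  obtain ⟨g, hg, hg0, hfg⟩ := MeromorphicOn.extract_zeros_poles hf.meromorphicOn
    (fun u => by
      rw [(hf u u.2).meromorphicOrderAt_eq]
      simpa using hord u u.2) hDfin
  have hlog := MeromorphicOn.extract_zeros_poles_log hg0 hfg
  refine ⟨hDfin.toFinset, g, ?_, ?_, hg, fun z hz => hg0 ⟨z, hz⟩, ?_⟩
  · intro z hz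
    by_contra h
    exact (Finite.mem_toFinset _).1 hz ((MeromorphicOn.divisor f K).apply_eq_zero_of_notMem h)
  · intro z hz hzs hfz
    apply hzs
    rw [Finite.mem_toFinset, Function.mem_support, hDval z hz]
    have h0 : analyticOrderAt f z ≠ 0 := by rwa [(hf z hz).analyticOrderAt_ne_zero]
    intro h
    have h' : (analyticOrderAt f z).toNat = 0 := by exact_mod_cast h
    rcases (ENat.toNat_eq_zero).1 h' with h | h
    · exact h0 h
    · exact hord z hz h
  · filter_upwards [ae_restrict_le_codiscreteWithin (μ := volume) hK.measurableSet hlog] with z hz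
    rw [hz]
    simp only [Pi.add_apply]
    congr 1
    rw [finsum_eq_sum_of_support_subset (s := hDfin.toFinset), Finset.sum_apply]
    · refine Finset.sum_congr rfl fun u hu => ?_
      have huK : u ∈ K := by
        by_contra h
        exact (Finite.mem_toFinset _).1 hu ((MeromorphicOn.divisor f K).apply_eq_zero_of_notMem h)
      simp [hDval u huK]
    · intro u hu
      simp only [Finite.coe_toFinset, Function.mem_support]
      intro h
      apply hu
      funext w
      simp [h]

lemma integrableOn_log_norm_of_analyticOnNhd {f : ℂ → ℂ} {K : Set ℂ} (hK : IsCompact K)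
    (hf : AnalyticOnNhd ℂ f K) (hord : ∀ z ∈ K, analyticOrderAt f z ≠ ⊤) :
    IntegrableOn (fun z => log ‖f z‖) K := by
  obtain ⟨s, g, hs, -, hg, hg0, hfg⟩ := exists_log_norm_factorization hK hf hord
  refine Integrable.congr (Integrable.add ?_ ?_) (hfg.mono fun z hz => hz.symm)
  · exact integrable_finsetSum _ fun u _ => (integrableOn_log_norm_sub u hK).const_mul _
  · have : ContinuousOn (fun z => log ‖g z‖) K := fun z hz =>
      ((hg z hz).continuousAt.continuousWithinAt.norm).log (norm_ne_zero_iff.2 (hg0 z hz))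
    exact this.integrableOn_compact hK

/-- The zeros of a holomorphic function form a null set; in particular the value of `log 0` does
not matter. -/
lemma volume_zeros_eq_zero {f : ℂ → ℂ} {K : Set ℂ} (hK : IsCompact K)
    (hf : AnalyticOnNhd ℂ f K) (hord : ∀ z ∈ K, analyticOrderAt f z ≠ ⊤) :
    ∀ᵐ z ∂volume.restrict K, f z ≠ 0 := by
  obtain ⟨s, g, hs, hs', -⟩ := exists_log_norm_factorization hK hf hord
  rw [ae_restrict_iff' hK.measurableSet]
  have : ∀ᵐ z : ℂ, z ∉ (s : Set ℂ) :=
    compl_mem_ae_iff.2 (s.finite_toSet.measure_zero _)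
  filter_upwards [this] with z hz hzK using hs' z hzK hz

/-- The Poincaré–Lelong formula in the plane: `[f = 0] = (i/π) ∂∂̄ log |f|`. -/
theorem integral_log_norm_mul_ddbar {f G : ℂ → ℂ} (hG : ContDiff ℝ 2 G)
    (hGc : HasCompactSupport G) (hf : AnalyticOnNhd ℂ f (tsupport G))
    (hord : ∀ z ∈ tsupport G, analyticOrderAt f z ≠ ⊤) :
    ∫ z, (log ‖f z‖ : ℂ) * wirtinger (wirtingerBar G) z =
      Real.pi / 2 * ∑ᶠ z, ((analyticOrderAt f z).toNat : ℂ) * G z := by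
  have hK : IsCompact (tsupport G) := hGc
  obtain ⟨s, g, hs, hs', hg, hg0, hfg⟩ := exists_log_norm_factorization hK hf hord
  set W := wirtinger (wirtingerBar G) with hW
  have hWc : Continuous W := continuous_ddbar hG
  have hWK : tsupport W ⊆ tsupport G := tsupport_ddbar_subset
  have hW0 : ∀ z, z ∉ tsupport G → W z = 0 := fun z hz =>
    image_eq_zero_of_notMem_tsupport fun h => hz (hWK h)
  have e1 : ∫ z, (log ‖f z‖ : ℂ) * W z =
      ∫ z, (∑ u ∈ s, ((analyticOrderAt f u).toNat : ℂ) * ((log ‖z - u‖ : ℂ) * W z)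
        + (log ‖g z‖ : ℂ) * W z) := by
    refine integral_congr_ae ?_
    rw [ae_restrict_iff' hK.measurableSet] at hfg
    filter_upwards [hfg] with z hz
    by_cases hzG : z ∈ tsupport G
    · rw [hz hzG]
      push_cast
      rw [add_mul, Finset.sum_mul]
      simp only [mul_assoc]
    · simp [hW0 z hzG]
  have i1 : ∀ u, Integrable (fun z => (log ‖z - u‖ : ℂ) * W z) := fun u =>
    integrable_ofReal_mul hK (integrableOn_log_norm_sub u hK) hWc hWK
  have i2 : Integrable (fun z => (log ‖g z‖ : ℂ) * W z) := by
    refine integrable_ofReal_mul hK ?_ hWc hWK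
    have : ContinuousOn (fun z => log ‖g z‖) (tsupport G) := fun z hz =>
      ((hg z hz).continuousAt.continuousWithinAt.norm).log (norm_ne_zero_iff.2 (hg0 z hz))
    exact this.integrableOn_compact hK
  rw [e1, integral_add (integrable_finsetSum _ fun u _ => (i1 u).const_mul _) i2,
    integral_finsetSum _ fun u _ => (i1 u).const_mul _,
    integral_log_norm_mul_ddbar_of_ne_zero hG hGc hg hg0, add_zero]
  simp only [integral_const_mul]
  rw [finsum_eq_sum_of_support_subset (s := s), Finset.mul_sum]
  · refine Finset.sum_congr rfl fun u _ => ?_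
    rw [integral_log_norm_sub_mul_ddbar u hG hGc]; ring
  · intro z hz
    by_contra hzs
    apply hz
    by_cases hzG : z ∈ tsupport G
    · have : analyticOrderAt f z = 0 := (hf z hzG).analyticOrderAt_eq_zero.2 (hs' z hzG hzs)
      simp [this]
    · simp [image_eq_zero_of_notMem_tsupport hzG]

end PoincareLelong

/-! ### Complex Gaussian vectors -/

section Gaussian

open Real (log)

variable {d : ℕ}

lemma gaussianDensity_eq_prod (a : Fin d → ℂ) :
    Real.exp (-∑ j, ‖a j‖ ^ 2) / Real.pi ^ d = ∏ j, (Real.exp (-‖a j‖ ^ 2) / Real.pi) := by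
  rw [Finset.prod_div_distrib, ← Real.exp_sum, Finset.sum_neg_distrib]
  simp

lemma gaussianDensity_nonneg (a : Fin d → ℂ) :
    0 ≤ Real.exp (-∑ j, ‖a j‖ ^ 2) / Real.pi ^ d := by
  have := Real.pi_pos
  positivity

lemma measurable_gaussianDensity :
    Measurable fun a : Fin d → ℂ => ENNReal.ofReal (Real.exp (-∑ j, ‖a j‖ ^ 2) / Real.pi ^ d) := by
  fun_prop

lemma complexGaussian_absolutelyContinuous : complexGaussian d ≪ volume :=
  withDensity_absolutelyContinuous _ _

lemma integral_exp_neg_norm_sq : ∫ z : ℂ, Real.exp (-‖z‖ ^ 2) / Real.pi = 1 := by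
  have h := Complex.integral_exp_neg_rpow (p := 2) (by norm_num)
  have h2 : ∀ z : ℂ, Real.exp (-‖z‖ ^ (2 : ℝ)) = Real.exp (-‖z‖ ^ 2) := by
    intro z; norm_num
  simp only [h2] at h
  rw [integral_div, h]
  have := Real.pi_ne_zero
  norm_num [Real.Gamma_two]

lemma integrable_exp_neg_norm_sq : Integrable fun z : ℂ => Real.exp (-‖z‖ ^ 2) / Real.pi :=
  integrable_of_integral_eq_one integral_exp_neg_norm_sq

instance isProbabilityMeasure_complexGaussian : IsProbabilityMeasure (complexGaussian d) := by
  constructor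
  rw [complexGaussian, withDensity_apply _ MeasurableSet.univ, Measure.restrict_univ,
    ← ofReal_integral_eq_lintegral_ofReal]
  · simp only [gaussianDensity_eq_prod]
    rw [integral_fintype_prod_volume_eq_pow (fun z : ℂ => Real.exp (-‖z‖ ^ 2) / Real.pi),
      integral_exp_neg_norm_sq]
    simp
  · simp only [gaussianDensity_eq_prod]
    exact Integrable.fintype_prod fun _ => integrable_exp_neg_norm_sq
  · exact Filter.Eventually.of_forall gaussianDensity_nonneg

lemma integrable_log_norm_mul_exp :
    Integrable fun z : ℂ => log ‖z‖ * (Real.exp (-‖z‖ ^ 2) / Real.pi) := by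
  rw [integrable_fun_norm_addHaar (volume : Measure ℂ)
    (f := fun r => log r * (Real.exp (-r ^ 2) / Real.pi))]
  simp only [Complex.finrank_real_complex, smul_eq_mul]
  have hg : IntegrableOn (fun y : ℝ => (1 + y ^ 2) * (Real.exp (-y ^ 2) / Real.pi)) (Ioi 0) := by
    have h1 : Integrable fun y : ℝ => Real.exp (-y ^ 2) := by
      simpa using integrable_exp_neg_mul_sq (b := 1) one_pos
    have h2 : Integrable fun y : ℝ => y ^ 2 * Real.exp (-y ^ 2) := by
      simpa using integrable_rpow_mul_exp_neg_mul_sq (b := 1) one_pos (s := 2) (by norm_num)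
    refine (((h1.add h2).div_const Real.pi).integrableOn).congr_fun (fun y _ => ?_)
      measurableSet_Ioi
    simp only [Pi.add_apply]
    ring
  refine Integrable.mono' hg ?_ ?_
  · refine ContinuousOn.aestronglyMeasurable ?_ measurableSet_Ioi
    refine (continuous_pow _).continuousOn.mul (ContinuousOn.mul ?_ (by fun_prop))
    exact Real.continuousOn_log.mono fun x hx => (ne_of_gt hx : x ≠ 0)
  · refine (ae_restrict_iff' measurableSet_Ioi).2 (Filter.Eventually.of_forall fun y hy => ?_)
    have hy0 : (0 : ℝ) < y := hy
    have hp := Real.pi_pos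
    rw [← mul_assoc, norm_mul, Real.norm_eq_abs (Real.exp _ / _), abs_of_pos (by positivity)]
    refine mul_le_mul_of_nonneg_right ?_ (by positivity)
    rw [Real.norm_eq_abs, show 2 - 1 = 1 from rfl, pow_one, abs_mul, abs_of_pos hy0]
    rcases le_total y 1 with h | h
    · have h1 := Real.abs_log_mul_self_lt y hy0 h
      rw [abs_mul, abs_of_pos hy0] at h1
      nlinarith [sq_nonneg y]
    · rw [abs_of_nonneg (Real.log_nonneg h)]
      have := Real.log_le_sub_one_of_pos hy0
      nlinarith

lemma integrable_complexGaussian_iff {φ : (Fin d → ℂ) → ℝ} :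
    Integrable φ (complexGaussian d) ↔
      Integrable fun a => φ a * (Real.exp (-∑ j, ‖a j‖ ^ 2) / Real.pi ^ d) := by
  rw [complexGaussian, integrable_withDensity_iff measurable_gaussianDensity
    (Filter.Eventually.of_forall fun _ => ENNReal.ofReal_lt_top)]
  simp only [ENNReal.toReal_ofReal (gaussianDensity_nonneg _)]

lemma integrable_log_norm_apply (i : Fin d) :
    Integrable (fun a : Fin d → ℂ => log ‖a i‖) (complexGaussian d) := by
  rw [integrable_complexGaussian_iff]
  have h := Integrable.fintype_prod (μ := fun _ : Fin d => (volume : Measure ℂ))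
    (f := fun j z => (if j = i then log ‖z‖ else 1) * (Real.exp (-‖z‖ ^ 2) / Real.pi)) (fun j => by
      by_cases hj : j = i
      · simpa [hj] using integrable_log_norm_mul_exp
      · simpa [hj] using integrable_exp_neg_norm_sq)
  refine h.congr (Filter.Eventually.of_forall fun a => ?_)
  simp only [gaussianDensity_eq_prod, Finset.prod_mul_distrib]
  congr 1
  simp

lemma ae_apply_ne_zero (i : Fin d) : ∀ᵐ a ∂complexGaussian d, a i ≠ 0 := by
  refine complexGaussian_absolutelyContinuous.ae_le ?_
  refine compl_mem_ae_iff.2 ?_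
  exact Measure.pi_hyperplane (fun _ : Fin d => (volume : Measure ℂ)) i 0

/-- The action of a unitary map on coordinate vectors. -/
def unitaryCoord (U : EuclideanSpace ℂ (Fin d) ≃ₗᵢ[ℂ] EuclideanSpace ℂ (Fin d)) :
    (Fin d → ℂ) ≃L[ℝ] (Fin d → ℂ) :=
  (((WithLp.linearEquiv 2 ℂ (Fin d → ℂ)).symm.trans
    (U.toLinearEquiv.trans (WithLp.linearEquiv 2 ℂ (Fin d → ℂ)))).restrictScalars
      ℝ).toContinuousLinearEquiv

lemma unitaryCoord_apply (U : EuclideanSpace ℂ (Fin d) ≃ₗᵢ[ℂ] EuclideanSpace ℂ (Fin d))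
    (a : Fin d → ℂ) (i : Fin d) : unitaryCoord U a i = U (WithLp.toLp 2 a) i := rfl

lemma sum_norm_sq_unitaryCoord (U : EuclideanSpace ℂ (Fin d) ≃ₗᵢ[ℂ] EuclideanSpace ℂ (Fin d))
    (a : Fin d → ℂ) : ∑ j, ‖unitaryCoord U a j‖ ^ 2 = ∑ j, ‖a j‖ ^ 2 := by
  simp only [unitaryCoord_apply]
  rw [← EuclideanSpace.norm_sq_eq, U.norm_map, EuclideanSpace.norm_sq_eq]

/-- Lebesgue measure on `ℂ^d` is unitarily invariant: a linear image of it is a multiple of it,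
and the Euclidean unit ball shows that the factor is `1`. -/
lemma measurePreserving_unitaryCoord_volume
    (U : EuclideanSpace ℂ (Fin d) ≃ₗᵢ[ℂ] EuclideanSpace ℂ (Fin d)) :
    MeasurePreserving (unitaryCoord U) (volume : Measure (Fin d → ℂ)) volume := by
  refine ⟨(unitaryCoord U).continuous.measurable, ?_⟩
  have hH : (Measure.map (unitaryCoord U) (volume : Measure (Fin d → ℂ))).IsAddHaarMeasure :=
    (unitaryCoord U).isAddHaarMeasure_map _
  have hc := Measure.isAddLeftInvariant_eq_smul
    (Measure.map (unitaryCoord U) (volume : Measure (Fin d → ℂ))) volume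
  set c := Measure.addHaarScalarFactor
    (Measure.map (unitaryCoord U) (volume : Measure (Fin d → ℂ))) volume
  set B : Set (Fin d → ℂ) := {a | ∑ j, ‖a j‖ ^ 2 < 1} with hB
  have hBo : IsOpen B := isOpen_lt (by fun_prop) continuous_const
  have hpre : unitaryCoord U ⁻¹' B = B := by
    ext a; simp [hB, sum_norm_sq_unitaryCoord]
  have h1 : (Measure.map (unitaryCoord U) (volume : Measure (Fin d → ℂ))) B = volume B := by
    rw [Measure.map_apply (unitaryCoord U).continuous.measurable hBo.measurableSet, hpre]
  have hB0 : (volume : Measure (Fin d → ℂ)) B ≠ 0 :=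
    (hBo.measure_pos _ ⟨0, by simp [hB]⟩).ne'
  have hBt : (volume : Measure (Fin d → ℂ)) B ≠ ⊤ := by
    have hsub : B ⊆ Metric.closedBall 0 1 := by
      intro a ha
      rw [mem_closedBall_zero_iff, pi_norm_le_iff_of_nonneg zero_le_one]
      intro i
      have h2 : ‖a i‖ ^ 2 ≤ ∑ j, ‖a j‖ ^ 2 :=
        Finset.single_le_sum (f := fun j => ‖a j‖ ^ 2) (fun j _ => by positivity)
          (Finset.mem_univ i)
      have h3 : ‖a i‖ ^ 2 < 1 := lt_of_le_of_lt h2 ha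
      nlinarith [norm_nonneg (a i)]
    exact ((measure_mono hsub).trans_lt measure_closedBall_lt_top).ne
  rw [hc, Measure.smul_apply, ENNReal.smul_def, smul_eq_mul] at h1
  have hc1 : c = 1 := by
    have := (ENNReal.mul_eq_right hB0 hBt).1 h1
    simpa using this
  rw [hc, hc1, one_smul]

lemma measurePreserving_unitaryCoord
    (U : EuclideanSpace ℂ (Fin d) ≃ₗᵢ[ℂ] EuclideanSpace ℂ (Fin d)) :
    MeasurePreserving (unitaryCoord U) (complexGaussian d) (complexGaussian d) := by
  refine ⟨(unitaryCoord U).continuous.measurable, ?_⟩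
  ext s hs
  have hm := (unitaryCoord U).continuous.measurable
  rw [Measure.map_apply hm hs, complexGaussian, withDensity_apply _ (hm hs), withDensity_apply _ hs,
    ← (measurePreserving_unitaryCoord_volume U).setLIntegral_comp_preimage hs
      measurable_gaussianDensity]
  simp only [sum_norm_sq_unitaryCoord]

lemma exists_unitary_apply_eq_inner (i : Fin d) {u : EuclideanSpace ℂ (Fin d)} (hu : ‖u‖ = 1) :
    ∃ U : EuclideanSpace ℂ (Fin d) ≃ₗᵢ[ℂ] EuclideanSpace ℂ (Fin d), ∀ v, U v i = inner ℂ u v := by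
  have ho : Orthonormal ℂ (({i} : Set (Fin d)).domRestrict fun _ => u) := by
    constructor
    · intro j; exact hu
    · rintro ⟨j, hj⟩ ⟨k, hk⟩ hjk
      exact absurd (Subtype.ext ((mem_singleton_iff.1 hj).trans (mem_singleton_iff.1 hk).symm)) hjk
  obtain ⟨b, hb⟩ := ho.exists_orthonormalBasis_extension_of_card_eq (by simp)
  refine ⟨b.repr, fun v => ?_⟩
  rw [b.repr_apply_apply, hb i rfl]

/-- A linear form `∑ a_j w_j` of a complex Gaussian vector has the law of `|w| a_i`. -/
lemma exists_measurePreserving_sum_eq (i : Fin d) (w : Fin d → ℂ) (hw : w ≠ 0) :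
    ∃ L : (Fin d → ℂ) ≃L[ℝ] (Fin d → ℂ),
      MeasurePreserving L (complexGaussian d) (complexGaussian d) ∧
      ∀ a, ∑ j, a j * w j = (√(∑ j, ‖w j‖ ^ 2) : ℂ) * L a i := by
  set v : EuclideanSpace ℂ (Fin d) := WithLp.toLp 2 fun j => conj (w j) with hv
  have hvn : ‖v‖ = √(∑ j, ‖w j‖ ^ 2) := by
    rw [EuclideanSpace.norm_eq]; simp [hv]
  have hv0 : v ≠ 0 := by
    intro h
    apply hw
    funext j
    have := congrArg (fun x : EuclideanSpace ℂ (Fin d) => x j) h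
    simpa [hv] using this
  have hn0 : (‖v‖ : ℂ) ≠ 0 := by exact_mod_cast norm_ne_zero_iff.2 hv0
  obtain ⟨U, hU⟩ := exists_unitary_apply_eq_inner i (u := ((‖v‖ : ℂ)⁻¹) • v) (by
    rw [norm_smul, norm_inv, Complex.norm_real, norm_norm, inv_mul_cancel₀ (norm_ne_zero_iff.2 hv0)])
  refine ⟨unitaryCoord U, measurePreserving_unitaryCoord U, fun a => ?_⟩
  rw [unitaryCoord_apply, hU, inner_smul_left, ← hvn, map_inv₀, Complex.conj_ofReal, ← mul_assoc,
    mul_inv_cancel₀ hn0, one_mul, EuclideanSpace.inner_eq_star_dotProduct]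
  simp [hv, dotProduct]

/-- The first moment of `log |∑ a_j w_j|` for a complex Gaussian vector `a` is `log |w|` up to a
constant that does not depend on `w`; the absolute moment has a similar bound, which gives joint
integrability when `w` varies. -/
theorem exists_integral_log_norm_sum (hd : 0 < d) :
    ∃ c C : ℝ, ∀ w : Fin d → ℂ, w ≠ 0 →
      Integrable (fun a => log ‖∑ j, a j * w j‖) (complexGaussian d) ∧
      ∫ a, log ‖∑ j, a j * w j‖ ∂complexGaussian d = 1 / 2 * log (∑ j, ‖w j‖ ^ 2) + c ∧
      ∫ a, |log ‖∑ j, a j * w j‖| ∂complexGaussian d ≤ |1 / 2 * log (∑ j, ‖w j‖ ^ 2)| + C := by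
  set i : Fin d := ⟨0, hd⟩ with hi
  refine ⟨∫ a, log ‖a i‖ ∂complexGaussian d, ∫ a, |log ‖a i‖| ∂complexGaussian d, fun w hw => ?_⟩
  obtain ⟨L, hL, hLw⟩ := exists_measurePreserving_sum_eq i w hw
  set r := 1 / 2 * log (∑ j, ‖w j‖ ^ 2) with hr
  have hpos : 0 < ∑ j, ‖w j‖ ^ 2 := by
    obtain ⟨j, hj⟩ := Function.ne_iff.1 hw
    exact Finset.sum_pos' (fun j _ => by positivity)
      ⟨j, Finset.mem_univ j, by have := norm_pos_iff.2 hj; positivity⟩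
  have hae : ∀ᵐ a ∂complexGaussian d, log ‖∑ j, a j * w j‖ = r + log ‖L a i‖ := by
    have := hL.quasiMeasurePreserving.ae (ae_apply_ne_zero i)
    filter_upwards [this] with a ha
    rw [hLw, norm_mul, Complex.norm_real, Real.norm_eq_abs, abs_of_nonneg (Real.sqrt_nonneg _),
      Real.log_mul (Real.sqrt_pos.2 hpos).ne' (norm_ne_zero_iff.2 ha), Real.log_sqrt hpos.le, hr]
    ring
  have hme : MeasurableEmbedding L := L.toHomeomorph.measurableEmbedding
  have hint : Integrable (fun a => log ‖L a i‖) (complexGaussian d) :=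
    (hL.integrable_comp_emb hme (g := fun a : Fin d → ℂ => log ‖a i‖)).2
      (integrable_log_norm_apply i)
  refine ⟨((integrable_const r).add hint).congr (hae.mono fun a ha => ha.symm), ?_, ?_⟩
  · rw [integral_congr_ae hae, integral_add (integrable_const r) hint, integral_const,
      hL.integral_comp hme (fun a : Fin d → ℂ => log ‖a i‖)]
    simp
  · calc ∫ a, |log ‖∑ j, a j * w j‖| ∂complexGaussian d
        = ∫ a, |r + log ‖L a i‖| ∂complexGaussian d :=
          integral_congr_ae (hae.mono fun a ha => by simp only [ha])
      _ ≤ ∫ a, (|r| + |log ‖L a i‖|) ∂complexGaussian d :=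
          integral_mono ((integrable_const r).add hint).abs ((integrable_const _).add hint.abs)
            fun a => abs_add_le _ _
      _ = _ := by
          rw [integral_add (integrable_const _) hint.abs, integral_const,
            hL.integral_comp hme (fun a : Fin d → ℂ => |log ‖a i‖|)]
          simp

end Gaussian

/-! ### The expected zeros of a Gaussian holomorphic function in the plane -/

section Expectation

open Real (log)

variable {m : ℕ} {f : Fin m → ℂ → ℂ} {K : Set ℂ}

lemma analyticOnNhd_sum_mul (hf : ∀ j, AnalyticOnNhd ℂ (f j) K) (a : Fin m → ℂ) :
    AnalyticOnNhd ℂ (fun z => ∑ j, a j * f j z) K := fun z hz =>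
  Finset.univ.analyticAt_fun_sum fun j _ => analyticAt_const.mul (hf j z hz)

lemma analyticOrderAt_ne_top_of_sum (i : Fin m)
    (hord : ∀ a : Fin m → ℂ, a ≠ 0 → ∀ z ∈ K, analyticOrderAt (fun z => ∑ j, a j * f j z) z ≠ ⊤) :
    ∀ z ∈ K, analyticOrderAt (f i) z ≠ ⊤ := by
  have h := hord (Pi.single i 1) (by simp)
  simpa [Pi.single_apply] using h

lemma integrableOn_log_sum_norm_sq (hm : 0 < m) (hK : IsCompact K)
    (hf : ∀ j, AnalyticOnNhd ℂ (f j) K)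
    (hord : ∀ a : Fin m → ℂ, a ≠ 0 → ∀ z ∈ K, analyticOrderAt (fun z => ∑ j, a j * f j z) z ≠ ⊤) :
    IntegrableOn (fun z => log (∑ j, ‖f j z‖ ^ 2)) K := by
  set i : Fin m := ⟨0, hm⟩
  have hi := analyticOrderAt_ne_top_of_sum i hord
  have hc : ContinuousOn (fun z => ∑ j, ‖f j z‖ ^ 2) K :=
    continuousOn_finsetSum _ fun j _ => ((hf j).continuousOn.norm).pow 2
  obtain ⟨B, hB⟩ := hK.exists_bound_of_continuousOn hc
  have hint := (integrableOn_log_norm_of_analyticOnNhd hK (hf i) hi)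
  have hg : IntegrableOn (fun z => 2 * |log ‖f i z‖| + |log B|) K :=
    (hint.abs.const_mul 2).add (integrableOn_const hK.measure_lt_top.ne)
  refine Integrable.mono' hg ?_ ?_
  · exact (Real.measurable_log.comp_aemeasurable
      (hc.aemeasurable hK.measurableSet)).aestronglyMeasurable
  · filter_upwards [volume_zeros_eq_zero hK (hf i) hi, self_mem_ae_restrict hK.measurableSet]
      with z hz hzK
    have h0 : 0 < ‖f i z‖ ^ 2 := by have := norm_pos_iff.2 hz; positivity
    have h1 : ‖f i z‖ ^ 2 ≤ ∑ j, ‖f j z‖ ^ 2 :=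
      Finset.single_le_sum (f := fun j => ‖f j z‖ ^ 2) (fun j _ => by positivity)
        (Finset.mem_univ i)
    have h2 : ∑ j, ‖f j z‖ ^ 2 ≤ B := (le_abs_self _).trans (hB z hzK)
    have l1 := Real.log_le_log h0 h1
    have l2 := Real.log_le_log (h0.trans_le h1) h2
    rw [Real.log_pow] at l1
    push_cast at l1
    rw [Real.norm_eq_abs, abs_le]
    have m1 := neg_abs_le (log ‖f i z‖)
    have m2 := le_abs_self (log B)
    have m3 := abs_nonneg (log ‖f i z‖)
    have m4 := abs_nonneg (log B)
    constructor <;> linarith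

/-- The joint integrability that permits to interchange expectation and integration. -/
lemma integrable_prod_log_norm_sum_mul (hm : 0 < m) (hK : IsCompact K)
    (hf : ∀ j, AnalyticOnNhd ℂ (f j) K)
    (hord : ∀ a : Fin m → ℂ, a ≠ 0 → ∀ z ∈ K, analyticOrderAt (fun z => ∑ j, a j * f j z) z ≠ ⊤)
    {W : ℂ → ℂ} (hW : Continuous W) (hWK : tsupport W ⊆ K) :
    Integrable (fun p : (Fin m → ℂ) × ℂ => (log ‖∑ j, p.1 j * f j p.2‖ : ℂ) * W p.2)
      ((complexGaussian m).prod volume) := by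
  have hW0 : ∀ z, z ∉ K → W z = 0 := fun z hz =>
    image_eq_zero_of_notMem_tsupport fun h => hz (hWK h)
  have hmeas : Measurable fun p : (Fin m → ℂ) × ℂ =>
      (log ‖∑ j, p.1 j * f j p.2‖ : ℂ) * W p.2 := by
    have h1 : (fun p : (Fin m → ℂ) × ℂ => (log ‖∑ j, p.1 j * f j p.2‖ : ℂ) * W p.2) =
        fun p => (log ‖∑ j, p.1 j * K.indicator (f j) p.2‖ : ℂ) * W p.2 := by
      funext p
      by_cases hp : p.2 ∈ K
      · simp only [indicator_of_mem hp]
      · simp only [hW0 _ hp, mul_zero]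
    have h2 : ∀ j, Measurable (K.indicator (f j)) := fun j =>
      measurable_of_restrict_of_restrict_compl hK.measurableSet
        (by
          have : K.domRestrict (K.indicator (f j)) = K.domRestrict (f j) := by
            ext x; simp
          exact this ▸ (continuousOn_iff_continuous_domRestrict.1 (hf j).continuousOn).measurable)
        (by
          have : Kᶜ.domRestrict (K.indicator (f j)) = fun _ => 0 := by
            ext x; exact indicator_of_notMem x.2 _
          exact this ▸ measurable_const)
    rw [h1]
    fun_prop
  obtain ⟨c, C, hgauss⟩ := exists_integral_log_norm_sum hm
  set i : Fin m := ⟨0, hm⟩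
  have hi := analyticOrderAt_ne_top_of_sum i hord
  have hne : ∀ᵐ z : ℂ, z ∈ K → (fun j => f j z) ≠ 0 := by
    have := (ae_restrict_iff' hK.measurableSet).1 (volume_zeros_eq_zero hK (hf i) hi)
    filter_upwards [this] with z hz hzK h
    exact hz hzK (congrFun h i)
  rw [integrable_prod_iff' hmeas.aestronglyMeasurable]
  refine ⟨?_, ?_⟩
  · filter_upwards [hne] with z hz
    by_cases hzK : z ∈ K
    · exact ((hgauss _ (hz hzK)).1.ofReal).mul_const _
    · simp only [hW0 z hzK, mul_zero]
      exact integrable_zero _ _ _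
  · have hS := integrableOn_log_sum_norm_sq hm hK hf hord
    have hb : IntegrableOn (fun z => |1 / 2 * log (∑ j, ‖f j z‖ ^ 2)| + C) K :=
      ((hS.const_mul (1 / 2)).abs).add (integrableOn_const hK.measure_lt_top.ne)
    have hb2 := (integrable_ofReal_mul hK hb hW hWK).norm
    refine Integrable.mono' hb2 hmeas.aestronglyMeasurable.norm.prod_swap.integral_prod_right' ?_
    filter_upwards [hne] with z hz
    by_cases hzK : z ∈ K
    · simp only [norm_mul, Complex.norm_real, Real.norm_eq_abs]
      rw [integral_mul_const, abs_mul, abs_of_nonneg (norm_nonneg (W z)),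
        abs_of_nonneg (integral_nonneg fun _ => abs_nonneg _)]
      refine mul_le_mul_of_nonneg_right ?_ (norm_nonneg _)
      exact ((hgauss _ (hz hzK)).2.2).trans (le_abs_self _)
    · simp [hW0 z hzK]

lemma ae_ne_zero (hm : 0 < m) : ∀ᵐ a ∂complexGaussian m, a ≠ 0 := by
  filter_upwards [ae_apply_ne_zero (⟨0, hm⟩ : Fin m)] with a ha h
  exact ha (by rw [h]; rfl)

/-- The expected zero current of the Gaussian combination of the `f j` is
`(i/2π) ∂∂̄ log ∑ |f j|²`. -/
theorem integral_sum_zeros (hm : 0 < m) {G : ℂ → ℂ} (hG : ContDiff ℝ 2 G)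
    (hGc : HasCompactSupport G) (hf : ∀ j, AnalyticOnNhd ℂ (f j) (tsupport G))
    (hord : ∀ a : Fin m → ℂ, a ≠ 0 → ∀ z ∈ tsupport G,
      analyticOrderAt (fun z => ∑ j, a j * f j z) z ≠ ⊤) :
    Integrable (fun a : Fin m → ℂ =>
      ∑ᶠ z, ((analyticOrderAt (fun z => ∑ j, a j * f j z) z).toNat : ℂ) * G z)
      (complexGaussian m) ∧
    Integrable (fun z => (log (∑ j, ‖f j z‖ ^ 2) : ℂ) * wirtinger (wirtingerBar G) z) ∧
    ∫ a, ∑ᶠ z, ((analyticOrderAt (fun z => ∑ j, a j * f j z) z).toNat : ℂ) * G z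
      ∂complexGaussian m =
      1 / Real.pi * ∫ z, (log (∑ j, ‖f j z‖ ^ 2) : ℂ) * wirtinger (wirtingerBar G) z := by
  have hK : IsCompact (tsupport G) := hGc
  set W := wirtinger (wirtingerBar G) with hWdef
  have hW : Continuous W := continuous_ddbar hG
  have hWK : tsupport W ⊆ tsupport G := tsupport_ddbar_subset
  have hW0 : ∀ z, z ∉ tsupport G → W z = 0 := fun z hz =>
    image_eq_zero_of_notMem_tsupport fun h => hz (hWK h)
  have hF := integrable_prod_log_norm_sum_mul hm hK hf hord hW hWK
  have hpi : (Real.pi : ℂ) ≠ 0 := by exact_mod_cast Real.pi_ne_zero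
  have hPL : ∀ᵐ a ∂complexGaussian m,
      ∑ᶠ z, ((analyticOrderAt (fun z => ∑ j, a j * f j z) z).toNat : ℂ) * G z =
      2 / Real.pi * ∫ z, (log ‖∑ j, a j * f j z‖ : ℂ) * W z := by
    filter_upwards [ae_ne_zero hm] with a ha
    rw [integral_log_norm_mul_ddbar hG hGc (analyticOnNhd_sum_mul hf a) (hord a ha)]
    field_simp
  have hlog := integrable_ofReal_mul hK (integrableOn_log_sum_norm_sq hm hK hf hord) hW hWK
  refine ⟨(hF.integral_prod_left.const_mul (2 / Real.pi : ℂ)).congr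
    (hPL.mono fun a ha => ha.symm), hlog, ?_⟩
  obtain ⟨c, C, hgauss⟩ := exists_integral_log_norm_sum hm
  set i : Fin m := ⟨0, hm⟩
  have hi := analyticOrderAt_ne_top_of_sum i hord
  -- the expectation contributes the constant `c`, which `∂∂̄G` integrates to zero
  have hinner : ∀ᵐ z : ℂ, ∫ a, (log ‖∑ j, a j * f j z‖ : ℂ) * W z ∂complexGaussian m =
      1 / 2 * ((log (∑ j, ‖f j z‖ ^ 2) : ℂ) * W z) + c * W z := by
    have := (ae_restrict_iff' hK.measurableSet).1 (volume_zeros_eq_zero hK (hf i) hi)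
    filter_upwards [this] with z hz
    by_cases hzK : z ∈ tsupport G
    · rw [integral_mul_const, integral_complex_ofReal,
        (hgauss _ (fun h => hz hzK (congrFun h i))).2.1]
      push_cast; ring
    · simp [hW0 z hzK]
  have hWint : Integrable W :=
    hW.integrable_of_hasCompactSupport (hK.of_isClosed_subset (isClosed_tsupport W) hWK)
  have hswap : ∫ a, ∫ z, (log ‖∑ j, a j * f j z‖ : ℂ) * W z ∂volume ∂complexGaussian m =
      ∫ z, ∫ a, (log ‖∑ j, a j * f j z‖ : ℂ) * W z ∂complexGaussian m ∂volume :=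
    integral_integral_swap hF
  have hW1 : ∫ z, W z = 0 := integral_ddbar_eq_zero hG hGc
  rw [integral_congr_ae hPL, integral_const_mul, hswap, integral_congr_ae hinner,
    integral_add (hlog.const_mul _) (hWint.const_mul _),
    integral_const_mul, integral_const_mul, hW1, mul_zero, add_zero]
  ring

end Expectation

/-! ### Almost surely all zeros are simple: the planar statement -/

section SimpleZeros

variable {m : ℕ} {f : Fin m → ℂ → ℂ} {K : Set ℂ}

/-- The set of critical values of a holomorphic function is a null set. -/
lemma volume_image_deriv_eq_zero (h : ℂ → ℂ) (S : Set ℂ)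
    (hd : ∀ z ∈ S, HasDerivAt h 0 z) : volume (h '' S) = 0 := by
  refine addHaar_image_eq_zero_of_det_fderivWithin_eq_zero volume (f' := fun _ => (0 : ℂ →L[ℝ] ℂ))
    (fun z hz => ?_) (fun z _ => ?_)
  · have := (hd z hz).hasFDerivAt.restrictScalars ℝ
    simpa using this.hasFDerivWithinAt
  · simp [ContinuousLinearMap.det]

lemma isClosed_setOf_double_zero (hK : IsCompact K) (hf : ∀ j, AnalyticOnNhd ℂ (f j) K) :
    IsClosed {a : Fin m → ℂ | ∃ z ∈ K, ∑ j, a j * f j z = 0 ∧ ∑ j, a j * deriv (f j) z = 0} := by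
  have : CompactSpace K := isCompact_iff_compactSpace.1 hK
  have c0 : ∀ j, Continuous fun z : K => f j z := fun j =>
    continuousOn_iff_continuous_domRestrict.1 (hf j).continuousOn
  have c1 : ∀ j, Continuous fun z : K => deriv (f j) z := fun j =>
    continuousOn_iff_continuous_domRestrict.1 (hf j).deriv.continuousOn
  have hC : IsClosed {p : (Fin m → ℂ) × K |
      ∑ j, p.1 j * f j p.2 = 0 ∧ ∑ j, p.1 j * deriv (f j) p.2 = 0} := by
    refine IsClosed.inter (isClosed_eq ?_ continuous_const) (isClosed_eq ?_ continuous_const)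
    · exact continuous_finsetSum _ fun j _ =>
        ((continuous_apply j).comp continuous_fst).mul ((c0 j).comp continuous_snd)
    · exact continuous_finsetSum _ fun j _ =>
        ((continuous_apply j).comp continuous_fst).mul ((c1 j).comp continuous_snd)
  convert isClosedMap_fst_of_compactSpace _ hC using 1
  ext a
  simp only [mem_ofPred_eq, mem_image, Prod.exists, exists_and_right, exists_eq_right,
    Subtype.exists]
  exact exists_congr fun z => by tauto

/-- If `f i` has no zeros on the compact set `K`, almost no combination of the `f j` has a double
zero on `K`: for fixed `a j`, `j ≠ i`, a double zero forces `a i` to be a critical value of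
`-(∑ j ≠ i, a j f j) / f i`. -/
lemma volume_setOf_double_zero (hK : IsCompact K) (hf : ∀ j, AnalyticOnNhd ℂ (f j) K)
    (i : Fin m) (hi : ∀ z ∈ K, f i z ≠ 0) :
    volume {a : Fin m → ℂ |
      ∃ z ∈ K, ∑ j, a j * f j z = 0 ∧ ∑ j, a j * deriv (f j) z = 0} = 0 := by
  obtain ⟨k, rfl⟩ : ∃ k, m = k + 1 := ⟨m - 1, by have := i.2; omega⟩
  set B : Set (Fin (k + 1) → ℂ) :=
    {a | ∃ z ∈ K, ∑ j, a j * f j z = 0 ∧ ∑ j, a j * deriv (f j) z = 0} with hB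
  have hBm : MeasurableSet B := (isClosed_setOf_double_zero hK hf).measurableSet
  have hmp := (volume_preserving_piFinSuccAbove (fun _ : Fin (k + 1) => ℂ) i).symm
  -- separate the coefficient `a i` and apply Fubini's theorem
  rw [← hmp.measure_preimage hBm.nullMeasurableSet, Measure.volume_eq_prod,
    Measure.prod_apply_symm (hmp.measurable hBm)]
  refine lintegral_eq_zero_of_ae_eq_zero (Filter.Eventually.of_forall fun b => ?_)
  set h : ℂ → ℂ := fun z => -(∑ j, b j * f (i.succAbove j) z) / f i z with hh
  have hsub : (fun x : ℂ => (x, b)) ⁻¹'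
      ((MeasurableEquiv.piFinSuccAbove (fun _ : Fin (k + 1) => ℂ) i).symm ⁻¹' B) ⊆
      h '' {z ∈ K | HasDerivAt h 0 z} := by
    rintro t ⟨z, hz, h0, h1⟩
    have e0 : t * f i z + ∑ j, b j * f (i.succAbove j) z = 0 := by
      rw [Fin.sum_univ_succAbove _ i] at h0
      simpa [MeasurableEquiv.piFinSuccAbove_symm_apply, Fin.insertNthEquiv] using h0
    have e1 : t * deriv (f i) z + ∑ j, b j * deriv (f (i.succAbove j)) z = 0 := by
      rw [Fin.sum_univ_succAbove _ i] at h1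
      simpa [MeasurableEquiv.piFinSuccAbove_symm_apply, Fin.insertNthEquiv] using h1
    have hne := hi z hz
    refine ⟨z, ⟨hz, ?_⟩, ?_⟩
    · have d1 : HasDerivAt (fun z => -(∑ j, b j * f (i.succAbove j) z))
          (-(∑ j, b j * deriv (f (i.succAbove j)) z)) z :=
        (HasDerivAt.fun_sum fun j _ =>
          ((hf (i.succAbove j) z hz).differentiableAt.hasDerivAt.const_mul (b j))).fun_neg
      have d2 := (hf i z hz).differentiableAt.hasDerivAt
      convert! d1.div d2 hne using 1
      rw [eq_comm, div_eq_zero_iff]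
      left
      linear_combination (-(f i z)) * e1 + deriv (f i) z * e0
    · rw [hh]
      simp only
      rw [div_eq_iff hne]
      linear_combination -e0
  exact measure_mono_null hsub (volume_image_deriv_eq_zero h _ fun z hz => hz.2)

lemma ae_analyticOrderAt_le_one (hK : IsCompact K) (hf : ∀ j, AnalyticOnNhd ℂ (f j) K)
    (i : Fin m) (hi : ∀ z ∈ K, f i z ≠ 0) :
    ∀ᵐ a ∂complexGaussian m, ∀ z ∈ K, analyticOrderAt (fun z => ∑ j, a j * f j z) z ≤ 1 := by
  refine complexGaussian_absolutelyContinuous.ae_le ?_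
  filter_upwards [compl_mem_ae_iff.2 (volume_setOf_double_zero hK hf i hi)] with a ha z hz
  by_contra hlt
  rw [not_le] at hlt
  have h2 : ((2 : ℕ) : ℕ∞) ≤ analyticOrderAt (fun z => ∑ j, a j * f j z) z := by
    have := Order.add_one_le_of_lt hlt
    simpa [one_add_one_eq_two] using this
  rw [natCast_le_analyticOrderAt_iff_iteratedDeriv_eq_zero (analyticOnNhd_sum_mul hf a z hz)] at h2
  refine ha ⟨z, hz, ?_, ?_⟩
  · simpa using h2 0 (by norm_num)
  · have h1 := h2 1 (by norm_num)
    rw [iteratedDeriv_one, deriv_fun_sum fun j _ =>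
      ((hf j z hz).differentiableAt.const_mul (a j))] at h1
    rw [← h1]
    exact Finset.sum_congr rfl fun j _ => (deriv_const_mul _ (hf j z hz).differentiableAt).symm

end SimpleZeros

/-! ### Frames, charts and local representatives of sections -/

section Frames

variable {M : Type*} [TopologicalSpace M] [ChartedSpace ℂ M]
  {E : M → Type*} [∀ x, AddCommGroup (E x)] [∀ x, Module ℂ (E x)]
  [∀ x, TopologicalSpace (E x)] [TopologicalSpace (TotalSpace ℂ E)]
  [FiberBundle ℂ E] [VectorBundle ℂ ℂ E]

lemma tensorCoord_smul {x : M} (n : ℕ) (c : ℂ) (v : E x) :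
    tensorCoord n (c • v) = (c⁻¹) ^ n • tensorCoord n v := by
  apply PiTensorProduct.ext
  ext w
  simp only [tensorCoord, LinearMap.compMultilinearMap_apply, PiTensorProduct.lift.tprod,
    MultilinearMap.compLinearMap_apply, MultilinearMap.mkPiAlgebra_apply, LinearMap.smul_apply,
    smul_eq_mul, map_smul, mul_inv, mul_assoc, Finset.prod_mul_distrib]
  simp

/-- The function `g` with `e' = g • e`, for two frames `e` and `e'`. -/
def frameRatio (e e' : ∀ x, E x) (x : M) : ℂ :=
  ((trivializationAt ℂ E x).linearMapAt ℂ x (e x))⁻¹ *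
    (trivializationAt ℂ E x).linearMapAt ℂ x (e' x)

lemma linearMapAt_eq {x y : M} (hy : y ∈ (trivializationAt ℂ E x).baseSet) (v : E y) :
    (trivializationAt ℂ E x).linearMapAt ℂ y v = (trivializationAt ℂ E x ⟨y, v⟩).2 := by
  rw [Trivialization.coe_linearMapAt_of_mem _ hy]

/-- Two vectors of a line have the same ratio in every trivialization. -/
lemma eq_frameRatio_smul_of_mem {x y : M} (hy : y ∈ (trivializationAt ℂ E x).baseSet) {v w : E y}
    (hv : v ≠ 0) :
    (trivializationAt ℂ E x).linearMapAt ℂ y v ≠ 0 ∧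
    w = (((trivializationAt ℂ E x).linearMapAt ℂ y v)⁻¹ *
      (trivializationAt ℂ E x).linearMapAt ℂ y w) • v := by
  set τ := (trivializationAt ℂ E x).linearMapAt ℂ y with hτ
  have hinj : ∀ u u' : E y, τ u = τ u' → u = u' := by
    intro u u' h
    have h1 := (trivializationAt ℂ E x).symmₗ_linearMapAt (R := ℂ) hy u
    have h2 := (trivializationAt ℂ E x).symmₗ_linearMapAt (R := ℂ) hy u'
    rw [← hτ] at h1 h2
    rw [← h1, ← h2, h]
  have hτv : τ v ≠ 0 := fun h => hv (hinj _ _ (by rw [h, map_zero]))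
  refine ⟨hτv, hinj _ _ ?_⟩
  rw [map_smul, smul_eq_mul]
  field_simp

lemma eq_frameRatio_smul {e : ∀ x, E x} (e' : ∀ x, E x) {x : M} (hx : e x ≠ 0) :
    e' x = frameRatio e e' x • e x :=
  (eq_frameRatio_smul_of_mem (FiberBundle.mem_baseSet_trivializationAt ℂ E x) hx).2

lemma frameRatio_ne_zero {e e' : ∀ x, E x} {x : M} (hx : e x ≠ 0) (hx' : e' x ≠ 0) :
    frameRatio e e' x ≠ 0 :=
  mul_ne_zero (inv_ne_zero (linearMapAt_ne_zero hx)) (linearMapAt_ne_zero hx')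

lemma frameRatio_eq_of_mem {e : ∀ x, E x} (e' : ∀ x, E x) {x y : M}
    (hy : y ∈ (trivializationAt ℂ E x).baseSet) (he : e y ≠ 0) :
    frameRatio e e' y = ((trivializationAt ℂ E x).linearMapAt ℂ y (e y))⁻¹ *
      (trivializationAt ℂ E x).linearMapAt ℂ y (e' y) := by
  have h1 := eq_frameRatio_smul e' he
  have h2 := (eq_frameRatio_smul_of_mem hy (w := e' y) he).2
  have h3 := h1.symm.trans h2
  rw [← sub_eq_zero, ← sub_smul] at h3
  rcases smul_eq_zero.1 h3 with h | h
  · exact sub_eq_zero.1 h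
  · exact absurd h he

lemma localRep_eq_of_frameRatio {n : ℕ} {e : ∀ x, E x} (e' : ∀ x, E x) {x : M} (hx : e x ≠ 0)
    (s : PowSection E n) :
    localRep e' s x = ((frameRatio e e' x)⁻¹) ^ n * localRep e s x := by
  simp only [localRep]
  conv_lhs => rw [eq_frameRatio_smul e' hx, tensorCoord_smul]
  rfl

lemma localRep_eq_zero_iff {n : ℕ} {e : ∀ x, E x} {x : M} (hx : e x ≠ 0) (s : PowSection E n) :
    localRep e s x = 0 ↔ s x = 0 := by
  constructor
  · intro h
    rw [eq_tensorCoord_smul n hx (s x)]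
    change localRep e s x • _ = _
    rw [h, zero_smul]
  · intro h
    simp [localRep, h]

lemma localRep_add {n : ℕ} (e : ∀ x, E x) (s t : PowSection E n) (x : M) :
    localRep e (s + t) x = localRep e s x + localRep e t x := by
  simp [localRep]

lemma localRep_smul {n : ℕ} (e : ∀ x, E x) (a : ℂ) (s : PowSection E n) (x : M) :
    localRep e (a • s) x = a * localRep e s x := by
  simp [localRep]

lemma localRep_sum {n : ℕ} (e : ∀ x, E x) {ι : Type*} (I : Finset ι) (a : ι → ℂ)
    (s : ι → PowSection E n) (x : M) :
    localRep e (∑ j ∈ I, a j • s j) x = ∑ j ∈ I, a j * localRep e (s j) x := by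
  simp [localRep]

lemma localRep_randomSection {n m : ℕ} (e : ∀ x, E x) (b : Fin m → PowSection E n)
    (a : Fin m → ℂ) (x : M) :
    localRep e (randomSection b a) x = ∑ j, a j * localRep e (b j) x :=
  localRep_sum e _ a b x

lemma contMDiffAt_linearMapAt {U : Set M} {e : ∀ x, E x} (he : IsHolomorphicFrame E U e) {x : M}
    (hx : x ∈ U) :
    ContMDiffAt 𝓘(ℂ) 𝓘(ℂ) ω
      (fun y => (trivializationAt ℂ E x).linearMapAt ℂ y (e y)) x := by
  have h := (contMDiffAt_section x).1 ((he.holomorphic x hx).contMDiffAt (he.isOpen.mem_nhds hx))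
  refine h.congr_of_eventuallyEq ?_
  filter_upwards [(trivializationAt ℂ E x).open_baseSet.mem_nhds
    (FiberBundle.mem_baseSet_trivializationAt ℂ E x)] with y hy
  exact linearMapAt_eq hy (e y)

/-- The transition function between two holomorphic frames is holomorphic. -/
lemma contMDiffAt_frameRatio {U U' : Set M} {e e' : ∀ x, E x} (he : IsHolomorphicFrame E U e)
    (he' : IsHolomorphicFrame E U' e') {x : M} (hx : x ∈ U) (hx' : x ∈ U') :
    ContMDiffAt 𝓘(ℂ) 𝓘(ℂ) ω (frameRatio e e') x := by
  have h1 := (contMDiffAt_linearMapAt he hx).inv₀ (linearMapAt_ne_zero (he.ne_zero x hx))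
  refine (h1.mul (contMDiffAt_linearMapAt he' hx')).congr_of_eventuallyEq ?_
  filter_upwards [he.isOpen.mem_nhds hx, (trivializationAt ℂ E x).open_baseSet.mem_nhds
    (FiberBundle.mem_baseSet_trivializationAt ℂ E x)] with y hy hyB
  exact frameRatio_eq_of_mem e' hyB (he.ne_zero y hy)

lemma baseFrame_ne_zero {x y : M} (hy : y ∈ (trivializationAt ℂ E x).baseSet) :
    baseFrame x y ≠ (0 : E y) := by
  intro h
  have h1 := (trivializationAt ℂ E x).linearMapAt_symmₗ (R := ℂ) hy 1
  rw [(trivializationAt ℂ E x).symmₗ_apply (R := ℂ) hy] at h1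
  change (trivializationAt ℂ E x).linearMapAt ℂ y (baseFrame x y) = 1 at h1
  rw [h, map_zero] at h1
  exact zero_ne_one h1

lemma isHolomorphicFrame_baseFrame [ContMDiffVectorBundle ω ℂ E 𝓘(ℂ)] (x : M) :
    IsHolomorphicFrame E (trivializationAt ℂ E x).baseSet (baseFrame x) where
  isOpen := (trivializationAt ℂ E x).open_baseSet
  ne_zero := fun y hy => baseFrame_ne_zero hy
  holomorphic := by
    intro y hy
    refine ContMDiffAt.contMDiffWithinAt ((contMDiffAt_section y).2 ?_)
    have hy' := FiberBundle.mem_baseSet_trivializationAt ℂ E y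
    have h1 := (contMDiffAt_coordChangeL (n := ω) (IB := 𝓘(ℂ)) (e := trivializationAt ℂ E x)
      (e' := trivializationAt ℂ E y) hy hy').clm_apply
      (contMDiffAt_const (c := (1 : ℂ)))
    refine h1.congr_of_eventuallyEq ?_
    filter_upwards [(trivializationAt ℂ E x).open_baseSet.mem_nhds hy,
      (trivializationAt ℂ E y).open_baseSet.mem_nhds hy'] with w hw hw'
    exact (Trivialization.coordChangeL_apply _ _ ⟨hw, hw'⟩ _).symm

lemma mem_baseSet_self (x : M) : x ∈ (trivializationAt ℂ E x).baseSet :=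
  FiberBundle.mem_baseSet_trivializationAt ℂ E x

/-! #### Charts -/

variable [IsManifold 𝓘(ℂ) ω M]

lemma isHolomorphicChart_chartAt (x : M) : IsHolomorphicChart (chartAt ℂ x) :=
  IsManifold.chart_mem_maximalAtlas x

lemma analyticAt_comp_symm {F : M → ℂ} {c : OpenPartialHomeomorph M ℂ} (hc : IsHolomorphicChart c)
    {x : M} (hx : x ∈ c.source) (hF : ContMDiffAt 𝓘(ℂ) 𝓘(ℂ) ω F x) :
    AnalyticAt ℂ (F ∘ c.symm) (c x) := by
  have h2 : ContMDiffAt 𝓘(ℂ) 𝓘(ℂ) ω c.symm (c x) :=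
    contMDiffAt_symm_of_mem_maximalAtlas hc (c.map_source hx)
  have h3 : ContMDiffAt 𝓘(ℂ) 𝓘(ℂ) ω (F ∘ c.symm) (c x) :=
    ContMDiffAt.comp (c x) (by rwa [c.left_inv hx]) h2
  exact (contMDiffAt_iff_contDiffAt.1 h3).analyticAt

lemma analyticAt_transition {c c' : OpenPartialHomeomorph M ℂ} (hc : IsHolomorphicChart c)
    (hc' : IsHolomorphicChart c') {x : M} (hx : x ∈ c.source) (hx' : x ∈ c'.source) :
    AnalyticAt ℂ (c ∘ c'.symm) (c' x) :=
  analyticAt_comp_symm hc' hx' (contMDiffAt_of_mem_maximalAtlas hc hx)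

lemma eventually_symm_mem {c : OpenPartialHomeomorph M ℂ} {x : M} (hx : x ∈ c.source) {s : Set M}
    (hs : s ∈ 𝓝 x) : ∀ᶠ ζ in 𝓝 (c x), c.symm ζ ∈ s := by
  have h := c.continuousAt_symm (c.map_source hx)
  exact h (by rwa [c.left_inv hx])

lemma comp_symm_eventuallyEq {F : M → ℂ} {c c' : OpenPartialHomeomorph M ℂ} {x : M}
    (hx : x ∈ c.source) (hx' : x ∈ c'.source) :
    F ∘ c'.symm =ᶠ[𝓝 (c' x)] (F ∘ c.symm) ∘ (c ∘ c'.symm) := by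
  filter_upwards [eventually_symm_mem hx' (c.open_source.mem_nhds hx)] with ζ hζ
  simp [c.left_inv hζ]

lemma deriv_transition_ne_zero {c c' : OpenPartialHomeomorph M ℂ} (hc : IsHolomorphicChart c)
    (hc' : IsHolomorphicChart c') {x : M} (hx : x ∈ c.source) (hx' : x ∈ c'.source) :
    deriv (c ∘ c'.symm) (c' x) ≠ 0 := by
  have h1 := (analyticAt_transition hc hc' hx hx').differentiableAt
  have h2 := (analyticAt_transition hc' hc hx' hx).differentiableAt
  have hpt : (c ∘ c'.symm) (c' x) = c x := by simp [c'.left_inv hx']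
  rw [← hpt] at h2
  have h3 : (c' ∘ c.symm) ∘ (c ∘ c'.symm) =ᶠ[𝓝 (c' x)] id := by
    filter_upwards [eventually_symm_mem hx' (c.open_source.mem_nhds hx),
      c'.open_target.mem_nhds (c'.map_source hx')] with ζ hζ hζ'
    simp [c.left_inv hζ, c'.right_inv hζ']
  have h4 := h3.deriv_eq
  rw [deriv_comp _ h2 h1, deriv_id] at h4
  intro h0
  rw [h0, mul_zero] at h4
  exact zero_ne_one h4

/-! #### Holomorphic sections in a chart and a frame -/

variable {n : ℕ} {s t : PowSection E n} {U : Set M} {e : ∀ x, E x}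
  {c : OpenPartialHomeomorph M ℂ} {x : M}

lemma analyticAt_localRep (hs : s ∈ holomorphicSections E n) (he : IsHolomorphicFrame E U e)
    (hc : IsHolomorphicChart c) (hx : x ∈ U ∩ c.source) :
    AnalyticAt ℂ (localRep e s ∘ c.symm) (c x) := by
  rw [Complex.analyticAt_iff_eventually_differentiableAt]
  filter_upwards [eventually_symm_mem hx.2 ((he.isOpen.inter c.open_source).mem_nhds hx),
    c.open_target.mem_nhds (c.map_source hx.2)] with ζ hζ hζ'
  have := differentiableAt_localRep hs he hc hζ
  rwa [c.right_inv hζ'] at this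

/-- The vanishing order of a section can be computed in every frame and every chart. -/
lemma zeroOrder_eq [ContMDiffVectorBundle ω ℂ E 𝓘(ℂ)] (hs : s ∈ holomorphicSections E n)
    (he : IsHolomorphicFrame E U e) (hc : IsHolomorphicChart c) (hx : x ∈ U ∩ c.source) :
    zeroOrder s x = analyticOrderAt (localRep e s ∘ c.symm) (c x) := by
  set c₀ := chartAt ℂ x with hc₀
  have hxc₀ : x ∈ c₀.source := mem_chart_source ℂ x
  have hb := isHolomorphicFrame_baseFrame (E := E) x
  have h1 : localRep (baseFrame x) s ∘ c₀.symm =ᶠ[𝓝 (c₀ x)]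
      (fun ζ => (frameRatio e (baseFrame x) (c₀.symm ζ))⁻¹ ^ n) * (localRep e s ∘ c₀.symm) := by
    filter_upwards [eventually_symm_mem hxc₀ (he.isOpen.mem_nhds hx.1)] with ζ hζ
    exact localRep_eq_of_frameRatio _ (he.ne_zero _ hζ) s
  have hr0 : frameRatio e (baseFrame x) x ≠ 0 :=
    frameRatio_ne_zero (he.ne_zero x hx.1) (baseFrame_ne_zero (mem_baseSet_self x))
  have hra : AnalyticAt ℂ (fun ζ => (frameRatio e (baseFrame x) (c₀.symm ζ))⁻¹ ^ n) (c₀ x) := by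
    have := analyticAt_comp_symm (isHolomorphicChart_chartAt x) hxc₀
      (contMDiffAt_frameRatio he hb hx.1 (mem_baseSet_self x))
    exact (this.inv (by simpa [c₀.left_inv hxc₀] using hr0)).pow n
  have hro : analyticOrderAt (fun ζ => (frameRatio e (baseFrame x) (c₀.symm ζ))⁻¹ ^ n) (c₀ x) = 0 := by
    rw [hra.analyticOrderAt_eq_zero]
    simpa [c₀.left_inv hxc₀] using fun h => absurd h hr0
  have hcc := isHolomorphicChart_chartAt x
  rw [zeroOrder, analyticOrderAt_congr h1, analyticOrderAt_mul hra
    (analyticAt_localRep hs he hcc ⟨hx.1, hxc₀⟩), hro, zero_add,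
    analyticOrderAt_congr (comp_symm_eventuallyEq hx.2 hxc₀),
    analyticOrderAt_comp_of_deriv_ne_zero (analyticAt_transition hc hcc hx.2 hxc₀)
      (deriv_transition_ne_zero hc hcc hx.2 hxc₀)]
  simp

lemma zeroOrder_eq_top_iff [ContMDiffVectorBundle ω ℂ E 𝓘(ℂ)] :
    zeroOrder s x = ⊤ ↔ ∀ᶠ y in 𝓝 x, s y = 0 := by
  have hxc := mem_chart_source ℂ x
  have hB := (trivializationAt ℂ E x).open_baseSet.mem_nhds (mem_baseSet_self x)
  rw [zeroOrder, analyticOrderAt_eq_top]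
  constructor
  · intro h
    have hcont := (chartAt ℂ x).continuousAt hxc
    filter_upwards [hcont.eventually h, hB, (chartAt ℂ x).open_source.mem_nhds hxc] with y hy hyB hyc
    rw [Function.comp_apply, (chartAt ℂ x).left_inv hyc] at hy
    exact (localRep_eq_zero_iff (baseFrame_ne_zero hyB) s).1 hy
  · intro h
    filter_upwards [eventually_symm_mem hxc h] with ζ hζ
    simp [localRep, hζ]

/-- The identity theorem for holomorphic sections. -/
theorem eq_zero_of_zeroOrder_eq_top [ConnectedSpace M] [ContMDiffVectorBundle ω ℂ E 𝓘(ℂ)]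
    (hs : s ∈ holomorphicSections E n) (hx : zeroOrder s x = ⊤) : s = 0 := by
  have hopen : IsOpen {y : M | zeroOrder s y = ⊤} := by
    rw [isOpen_iff_mem_nhds]
    intro y hy
    have := eventually_eventually_nhds.2 (zeroOrder_eq_top_iff.1 hy)
    filter_upwards [this] with w hw using zeroOrder_eq_top_iff.2 hw
  have hclosed : IsClosed {y : M | zeroOrder s y = ⊤} := by
    rw [← closure_subset_iff_isClosed]
    intro y hy
    have hyc := mem_chart_source ℂ y
    have hb := isHolomorphicFrame_baseFrame (E := E) y
    have ha := analyticAt_localRep hs hb (isHolomorphicChart_chartAt y) ⟨mem_baseSet_self y, hyc⟩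
    rcases ha.eventually_eq_zero_or_eventually_ne_zero with h | h
    · exact analyticOrderAt_eq_top.2 h
    · rw [eventually_nhdsWithin_iff] at h
      have hev := ((chartAt ℂ y).continuousAt hyc).eventually h
      have hN := Filter.inter_mem hev (Filter.inter_mem ((chartAt ℂ y).open_source.mem_nhds hyc)
        (hb.isOpen.mem_nhds (mem_baseSet_self y)))
      obtain ⟨w, ⟨hw1, hw2, hw3⟩, hwZ⟩ := mem_closure_iff_nhds.1 hy _ hN
      have hwz : s w = 0 := (zeroOrder_eq_top_iff.1 hwZ).self_of_nhds
      by_cases hwy : w = y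
      · rw [← hwy]; exact hwZ
      · exfalso
        refine hw1 (fun h => hwy ((chartAt ℂ y).injOn hw2 hyc h)) ?_
        rw [Function.comp_apply, (chartAt ℂ y).left_inv hw2]
        exact (localRep_eq_zero_iff (hb.ne_zero _ hw3) s).2 hwz
  have huniv := IsClopen.eq_univ ⟨hclosed, hopen⟩ ⟨x, hx⟩
  funext y
  have hy : y ∈ {y : M | zeroOrder s y = ⊤} := huniv ▸ mem_univ y
  exact (zeroOrder_eq_top_iff.1 hy).self_of_nhds

end Frames

/-! ### The Hermitian metric and its Chern connection -/

section Metric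

variable {M : Type*} [TopologicalSpace M] [ChartedSpace ℂ M] [IsManifold 𝓘(ℂ) ω M]
  {E : M → Type*} [∀ x, AddCommGroup (E x)] [∀ x, Module ℂ (E x)]
  [∀ x, TopologicalSpace (E x)] [TopologicalSpace (TotalSpace ℂ E)]
  [FiberBundle ℂ E] [VectorBundle ℂ ℂ E]

/-- Real smoothness on `M` is smoothness in every holomorphic chart. -/
lemma contDiffAt_comp_symm_of_real {F' : Type*} [NormedAddCommGroup F'] [NormedSpace ℝ F']
    {F : M → F'} {c : OpenPartialHomeomorph M ℂ} (hc : IsHolomorphicChart c) {x : M}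
    (hx : x ∈ c.source) {k : ℕ∞ω} (hF : ContMDiffAt 𝓘(ℝ, ℂ) 𝓘(ℝ, F') k F x) :
    ContDiffAt ℝ k (F ∘ c.symm) (c x) := by
  have h1 : ContDiffAt ℝ k (F ∘ (chartAt ℂ x).symm) (chartAt ℂ x x) := by
    have := (contMDiffAt_iff.1 hF).2
    simpa [mfld_simps, chartAt_self_eq, contDiffWithinAt_univ] using this
  have hxc := mem_chart_source ℂ x
  have h2 : ContDiffAt ℝ k (chartAt ℂ x ∘ c.symm) (c x) :=
    (analyticAt_transition (isHolomorphicChart_chartAt x) hc hxc hx).contDiffAt.restrict_scalars ℝ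
  have h3 : ContDiffAt ℝ k ((F ∘ (chartAt ℂ x).symm) ∘ (chartAt ℂ x ∘ c.symm)) (c x) :=
    ContDiffAt.comp (c x) (by simpa [c.left_inv hx] using h1) h2
  refine h3.congr_of_eventuallyEq ?_
  filter_upwards [eventually_symm_mem hx ((chartAt ℂ x).open_source.mem_nhds hxc)] with ζ hζ
  simp [(chartAt ℂ x).left_inv hζ]

variable (h : HermitianMetric E)

lemma form_self_eq (x : M) (u : E x) : h.form x u u = ((h.form x u u).re : ℂ) :=
  (Complex.conj_eq_iff_real.1 (h.conj_symm x u u)).elim fun r hr => by rw [hr]; simp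

lemma form_smul_self (x : M) (a : ℂ) (u : E x) :
    h.form x (a • u) (a • u) = ((‖a‖ ^ 2 : ℝ) : ℂ) * h.form x u u := by
  rw [map_smulₛₗ, LinearMap.map_smulₛₗ, LinearMap.smul_apply]
  simp only [RingHom.id_apply, smul_eq_mul]
  rw [mul_left_comm, ← mul_assoc, Complex.mul_conj, Complex.normSq_eq_norm_sq]

lemma form_smul_self_re (x : M) (a : ℂ) (u : E x) :
    (h.form x (a • u) (a • u)).re = ‖a‖ ^ 2 * (h.form x u u).re := by
  rw [form_smul_self, Complex.re_ofReal_mul]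

lemma contMDiffAt_form {U : Set M} {e : ∀ x, E x} (he : IsHolomorphicFrame E U e) {x : M}
    (hx : x ∈ U) :
    ContMDiffAt 𝓘(ℝ, ℂ) 𝓘(ℝ, ℝ) ∞ (fun y => (h.form y (e y) (e y)).re) x :=
  (h.smooth U e he x hx).contMDiffAt (he.isOpen.mem_nhds hx)

variable {n : ℕ} {s t : PowSection E n} {U : Set M} {e : ∀ x, E x}
  {c : OpenPartialHomeomorph M ℂ} {x : M}

/-- The pointwise product `hⁿ(s, t)` in an arbitrary frame. -/
lemma pointwiseInner_eq (hx : e x ≠ 0) :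
    pointwiseInner h s t x = localRep e s x * conj (localRep e t x) *
      h.form x (e x) (e x) ^ n := by
  have hb : baseFrame x x ≠ (0 : E x) := baseFrame_ne_zero (mem_baseSet_self x)
  set r := frameRatio e (baseFrame x) x with hr
  have hr0 : r ≠ 0 := frameRatio_ne_zero hx hb
  have h1 : h.form x (baseFrame x x) (baseFrame x x)
      = ((‖r‖ ^ 2 : ℝ) : ℂ) * h.form x (e x) (e x) := by
    conv_lhs => rw [eq_frameRatio_smul (baseFrame x) hx]
    exact form_smul_self h x r _
  have h2 : ((‖r‖ ^ 2 : ℝ) : ℂ) = r * conj r := by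
    rw [Complex.mul_conj, Complex.normSq_eq_norm_sq]
  have h3 : conj r ≠ 0 := by simpa using hr0
  rw [pointwiseInner, localRep_eq_of_frameRatio (baseFrame x) hx s,
    localRep_eq_of_frameRatio (baseFrame x) hx t, h1, h2, ← hr]
  simp only [map_mul, map_pow, map_inv₀, inv_pow, mul_pow]
  field_simp

lemma continuousAt_localRep (hs : s ∈ holomorphicSections E n) (he : IsHolomorphicFrame E U e)
    (hx : x ∈ U) : ContinuousAt (localRep e s) x :=
  ((hs U e he x hx).mdifferentiableAt (he.isOpen.mem_nhds hx)).continuousAt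

lemma continuous_pointwiseInner [ContMDiffVectorBundle ω ℂ E 𝓘(ℂ)]
    (hs : s ∈ holomorphicSections E n) (ht : t ∈ holomorphicSections E n) :
    Continuous (pointwiseInner h s t) := by
  rw [continuous_iff_continuousAt]
  intro x
  have hb := isHolomorphicFrame_baseFrame (E := E) x
  have hxb : x ∈ (trivializationAt ℂ E x).baseSet := mem_baseSet_self x
  have h1 : pointwiseInner h s t =ᶠ[𝓝 x] fun y =>
      localRep (baseFrame x) s y * conj (localRep (baseFrame x) t y) *
        ((h.form y (baseFrame x y) (baseFrame x y)).re : ℂ) ^ n := by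
    filter_upwards [hb.isOpen.mem_nhds hxb] with y hy
    rw [← form_self_eq, pointwiseInner_eq h (hb.ne_zero y hy)]
  refine ContinuousAt.congr ?_ h1.symm
  refine ((continuousAt_localRep hs hb hxb).mul
    (Complex.continuous_conj.continuousAt.comp (continuousAt_localRep ht hb hxb))).mul ?_
  exact (Complex.continuous_ofReal.continuousAt.comp
    (contMDiffAt_form h hb hxb).continuousAt).pow n

lemma contDiffAt_potential (he : IsHolomorphicFrame E U e) (hc : IsHolomorphicChart c)
    (hx : x ∈ U ∩ c.source) : ContDiffAt ℝ ∞ (potential h e c) (c x) := by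
  set H : ℂ → ℝ := (fun y => (h.form y (e y) (e y)).re) ∘ c.symm with hH
  have h1 : ContDiffAt ℝ ∞ H (c x) :=
    contDiffAt_comp_symm_of_real hc hx.2 (contMDiffAt_form h he hx.1)
  have h2 : ContDiffAt ℝ ∞ (fun ζ => -Real.log (H ζ)) (c x) := by
    refine ContDiffAt.neg (h1.log ?_)
    have hHx : H (c x) = (h.form x (e x) (e x)).re :=
      congrArg (fun y => (h.form y (e y) (e y)).re) (c.left_inv hx.2)
    rw [hHx]
    exact (h.pos x _ (he.ne_zero x hx.1)).ne'
  exact Complex.ofRealCLM.contDiff.contDiffAt.comp (c x) h2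

lemma differentiableAt_potential (he : IsHolomorphicFrame E U e) (hc : IsHolomorphicChart c)
    (hx : x ∈ U ∩ c.source) : DifferentiableAt ℝ (potential h e c) (c x) :=
  (contDiffAt_potential h he hc hx).differentiableAt (by simp)

/-- Change of the connection form `∂φ` under a change of frame. -/
lemma wirtinger_potential_of_frame_eq (he : IsHolomorphicFrame E U e) (hc : IsHolomorphicChart c)
    (hx : x ∈ U ∩ c.source) {e' : ∀ x, E x} {γ : ℂ → ℂ} (hγ : AnalyticAt ℂ γ (c x))
    (hγ0 : γ (c x) ≠ 0) (hee : ∀ᶠ ζ in 𝓝 (c x), e' (c.symm ζ) = γ ζ • e (c.symm ζ)) :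
    wirtinger (potential h e' c) (c x) =
      wirtinger (potential h e c) (c x) - deriv γ (c x) / γ (c x) := by
  have h1 : potential h e' c =ᶠ[𝓝 (c x)]
      fun ζ => potential h e c ζ - 2 * (Real.log ‖γ ζ‖ : ℂ) := by
    filter_upwards [hee, eventually_symm_mem hx.2 (he.isOpen.mem_nhds hx.1),
      hγ.continuousAt.eventually_ne hγ0] with ζ hζ hζU hζ0
    have hp := h.pos _ _ (he.ne_zero _ hζU)
    simp only [potential]
    rw [hζ, form_smul_self_re, Real.log_mul (by positivity) hp.ne', Real.log_pow]
    push_cast; ring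
  have h2 : DifferentiableAt ℝ (fun ζ => (Real.log ‖γ ζ‖ : ℂ)) (c x) :=
    (contDiffAt_log_norm hγ hγ0).differentiableAt (by simp)
  have h3 : DifferentiableAt ℝ (fun _ : ℂ => (2 : ℂ)) (c x) := differentiableAt_const _
  rw [wirtinger_congr h1, wirtinger_sub (differentiableAt_potential h he hc hx) (h3.fun_mul h2),
    wirtinger_mul h3 h2, wirtinger_of_differentiableAt (differentiableAt_const _),
    wirtinger_log_norm hγ hγ0]
  simp

/-- The coefficient of the Chern connection transforms like a section under a change of frame. -/
lemma chernCoeff_of_frameRatio (hs : s ∈ holomorphicSections E n) (he : IsHolomorphicFrame E U e)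
    {U' : Set M} {e' : ∀ x, E x} (he' : IsHolomorphicFrame E U' e') (hc : IsHolomorphicChart c)
    (hx : x ∈ U ∩ c.source) (hx' : x ∈ U') :
    chernCoeff h e' c s x = ((frameRatio e e' x)⁻¹) ^ n * chernCoeff h e c s x := by
  set γ := frameRatio e e' ∘ c.symm with hγdef
  have hγ : AnalyticAt ℂ γ (c x) :=
    analyticAt_comp_symm hc hx.2 (contMDiffAt_frameRatio he he' hx.1 hx')
  have hγx : γ (c x) = frameRatio e e' x := by simp [hγdef, c.left_inv hx.2]
  have hγ0 : γ (c x) ≠ 0 := by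
    rw [hγx]; exact frameRatio_ne_zero (he.ne_zero x hx.1) (he'.ne_zero x hx')
  have hU := eventually_symm_mem hx.2 (he.isOpen.mem_nhds hx.1)
  have h1 := wirtinger_potential_of_frame_eq h he hc hx hγ hγ0
    (hU.mono fun ζ hζ => eq_frameRatio_smul e' (he.ne_zero _ hζ))
  have h2 : localRep e' s ∘ c.symm =ᶠ[𝓝 (c x)]
      fun ζ => (γ ζ)⁻¹ ^ n * (localRep e s ∘ c.symm) ζ := by
    filter_upwards [hU] with ζ hζ
    exact localRep_eq_of_frameRatio e' (he.ne_zero _ hζ) s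
  have hA := (analyticAt_localRep hs he hc hx).differentiableAt.hasDerivAt
  have h3 : deriv (localRep e' s ∘ c.symm) (c x) = _ :=
    h2.deriv_eq.trans (((hγ.differentiableAt.hasDerivAt.fun_inv hγ0).fun_pow n).mul hA).deriv
  -- `n - 1` is truncated, but its factor `n` vanishes for `n = 0`
  have hn : (n : ℂ) * (γ (c x))⁻¹ ^ (n - 1) = n * (γ (c x))⁻¹ ^ n * γ (c x) := by
    rcases Nat.eq_zero_or_pos n with h0 | h0
    · simp [h0]
    · obtain ⟨k, rfl⟩ : ∃ k, n = k + 1 := ⟨n - 1, by omega⟩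
      rw [Nat.add_sub_cancel, pow_succ, mul_assoc, mul_assoc, inv_mul_cancel₀ hγ0, mul_one]
  have hAx : (localRep e s ∘ c.symm) (c x) = localRep e s x := by simp [c.left_inv hx.2]
  rw [chernCoeff, h3, h1, localRep_eq_of_frameRatio e' (he.ne_zero x hx.1) s, ← hγx, hn, hAx,
    chernCoeff]
  field_simp
  ring

/-- The coefficient of the Chern connection transforms like a `(1,0)`-form under a change of
chart. -/
lemma chernCoeff_of_transition (hs : s ∈ holomorphicSections E n) (he : IsHolomorphicFrame E U e)
    (hc : IsHolomorphicChart c) (hx : x ∈ U ∩ c.source) {c' : OpenPartialHomeomorph M ℂ}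
    (hc' : IsHolomorphicChart c') (hx' : x ∈ c'.source) :
    chernCoeff h e c' s x = deriv (c ∘ c'.symm) (c' x) * chernCoeff h e c s x := by
  have hψ := (analyticAt_transition hc hc' hx.2 hx').differentiableAt
  have hψx : (c ∘ c'.symm) (c' x) = c x := by simp [c'.left_inv hx']
  have hA := (analyticAt_localRep hs he hc hx).differentiableAt
  rw [← hψx] at hA
  have h1 : potential h e c' =ᶠ[𝓝 (c' x)] fun ζ => potential h e c ((c ∘ c'.symm) ζ) := by
    filter_upwards [eventually_symm_mem hx' (c.open_source.mem_nhds hx.2)] with ζ hζ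
    exact congrArg (fun y => ((-Real.log (h.form y (e y) (e y)).re : ℝ) : ℂ)) (c.left_inv hζ).symm
  have hP := differentiableAt_potential h he hc hx
  rw [← hψx] at hP
  rw [chernCoeff, (comp_symm_eventuallyEq (F := localRep e s) hx.2 hx').deriv_eq,
    deriv_comp _ hA hψ, wirtinger_congr h1, wirtinger_comp_right hP hψ, hψx, chernCoeff]
  ring

/-- The vanishing of the covariant derivative can be tested in a single frame and chart. -/
lemma mem_criticalSections_iff {q : M} (he : IsHolomorphicFrame E U e)
    (hc : IsHolomorphicChart c) (hq : q ∈ U ∩ c.source) :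
    s ∈ criticalSections h n q ↔ s ∈ holomorphicSections E n ∧ chernCoeff h e c s q = 0 := by
  constructor
  · rintro ⟨h1, h2⟩
    exact ⟨h1, h2 c U e hc he hq⟩
  · rintro ⟨h1, h2⟩
    refine ⟨h1, fun c' U' e' hc' he' hq' => ?_⟩
    rw [chernCoeff_of_transition h h1 he' hc ⟨hq'.1, hq.2⟩ hc' hq'.2,
      chernCoeff_of_frameRatio h h1 he he' hc hq hq'.1, h2, mul_zero, mul_zero]

/-- In an adapted frame the covariant derivative at `q` is the ordinary derivative. -/
lemma IsAdapted.mem_criticalSections_iff {h : HermitianMetric E} {q : M}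
    (ha : IsAdapted h q c U e) :
    s ∈ criticalSections h n q ↔
      s ∈ holomorphicSections E n ∧ deriv (localRep e s ∘ c.symm) (c q) = 0 := by
  rw [RandomSections.mem_criticalSections_iff h ha.frame ha.chart ha.mem, chernCoeff,
    ha.wirtinger_potential]
  simp

/-- Adapted frames exist: multiply a frame by `exp (α z)` with `α = ∂φ(q)`. -/
lemma exists_isAdapted [ContMDiffVectorBundle ω ℂ E 𝓘(ℂ)] (q : M) :
    ∃ (c : OpenPartialHomeomorph M ℂ) (U : Set M) (e : ∀ x, E x), IsAdapted h q c U e := by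
  set c := chartAt ℂ q with hcdef
  have hc : IsHolomorphicChart c := isHolomorphicChart_chartAt q
  have hqc : q ∈ c.source := mem_chart_source ℂ q
  have hb := isHolomorphicFrame_baseFrame (E := E) q
  have hqb : q ∈ (trivializationAt ℂ E q).baseSet := mem_baseSet_self q
  set α := wirtinger (potential h (baseFrame q) c) (c q) with hα
  set e' : ∀ x, E x := fun y => Complex.exp (α * (c y - c q)) • baseFrame q y with he'
  have hframe : IsHolomorphicFrame E ((trivializationAt ℂ E q).baseSet ∩ c.source) e' := by
    refine ⟨hb.isOpen.inter c.open_source, fun y hy => ?_, fun y hy =>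
      smul_ne_zero (Complex.exp_ne_zero _) (hb.ne_zero y hy.1)⟩
    refine ContMDiffAt.contMDiffWithinAt ((contMDiffAt_section y).2 ?_)
    have h1 : ContMDiffAt 𝓘(ℂ) 𝓘(ℂ) ω (fun w => Complex.exp (α * (c w - c q))) y := by
      have h2 : ContDiff ℂ ω fun ζ : ℂ => Complex.exp (α * (ζ - c q)) := by fun_prop
      exact h2.contMDiff.contMDiffAt.comp y (contMDiffAt_of_mem_maximalAtlas hc hy.2)
    refine (h1.mul (contMDiffAt_linearMapAt hb hy.1)).congr_of_eventuallyEq ?_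
    filter_upwards [(trivializationAt ℂ E y).open_baseSet.mem_nhds (mem_baseSet_self y)] with w hw
    rw [← linearMapAt_eq hw, he', map_smul, smul_eq_mul]
    rfl
  refine ⟨c, _, e', hc, hframe, ⟨⟨hqb, hqc⟩, hqc⟩, ?_⟩
  have hd : HasDerivAt (fun ζ : ℂ => Complex.exp (α * (ζ - c q)))
      (Complex.exp (α * (c q - c q)) * (α * 1)) (c q) :=
    (((hasDerivAt_id (c q)).sub_const (c q)).const_mul α).cexp
  rw [wirtinger_potential_of_frame_eq h hb hc ⟨hqb, hqc⟩
    (γ := fun ζ => Complex.exp (α * (ζ - c q))) (by fun_prop) (Complex.exp_ne_zero _) ?_, hd.deriv,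
    ← hα]
  · simp
  · filter_upwards [c.open_target.mem_nhds (c.map_source hqc)] with ζ hζ
    simp only [he', c.right_inv hζ]

end Metric

/-! ### Finite dimension of the space of holomorphic sections -/

/-- Schwarz lemma for functions vanishing to order `k` at the centre of a disc. -/
lemma norm_le_of_le_analyticOrderAt {z₀ : ℂ} {r : ℝ} (hr : 0 < r) {V : Set ℂ} (hV : IsOpen V)
    (hrV : Metric.closedBall z₀ r ⊆ V) (k : ℕ) {f : ℂ → ℂ} (hf : DifferentiableOn ℂ f V) {B : ℝ}
    (hB : ∀ z ∈ Metric.closedBall z₀ r, ‖f z‖ ≤ B) (hk : (k : ℕ∞) ≤ analyticOrderAt f z₀) :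
    ∀ z ∈ Metric.closedBall z₀ r, ‖f z‖ ≤ B * (‖z - z₀‖ / r) ^ k := by
  induction k generalizing f B with
  | zero => simpa using hB
  | succ k ih =>
    have hz₀V : z₀ ∈ V := hrV (Metric.mem_closedBall_self hr.le)
    have hVn : V ∈ 𝓝 z₀ := hV.mem_nhds hz₀V
    have hf0 : f z₀ = 0 := apply_eq_zero_of_analyticOrderAt_ne_zero (by
      intro h; rw [h] at hk; simp at hk)
    have hg : DifferentiableOn ℂ (dslope f z₀) V := (Complex.differentiableOn_dslope hVn).2 hf
    have hfg : ∀ z, f z = (z - z₀) * dslope f z₀ z := by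
      intro z
      have := sub_smul_dslope f z₀ z
      rw [hf0, sub_zero, smul_eq_mul] at this
      exact this.symm
    have hgB : ∀ z ∈ Metric.closedBall z₀ r, ‖dslope f z₀ z‖ ≤ B / r := by
      intro z hz
      refine Complex.norm_le_of_forall_mem_frontier_norm_le (U := Metric.ball z₀ r)
        Metric.isBounded_ball ?_ ?_ (by rwa [closure_ball _ hr.ne'])
      · refine DifferentiableOn.diffContOnCl ?_
        rw [closure_ball _ hr.ne']
        exact hg.mono hrV
      · intro w hw
        rw [frontier_ball _ hr.ne'] at hw
        have h1 := hB w (Metric.sphere_subset_closedBall hw)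
        have hwn : ‖w - z₀‖ = r := by rw [← dist_eq_norm]; exact hw
        rw [hfg w, norm_mul, hwn] at h1
        rw [le_div_iff₀ hr]; linarith
    have hgo : (k : ℕ∞) ≤ analyticOrderAt (dslope f z₀) z₀ := by
      have ha : AnalyticAt ℂ (dslope f z₀) z₀ := hg.analyticAt hVn
      have hid : AnalyticAt ℂ (fun z => z - z₀) z₀ := by fun_prop
      have h1 : analyticOrderAt f z₀ = 1 + analyticOrderAt (dslope f z₀) z₀ := by
        have h2 : f = (fun z => z - z₀) * dslope f z₀ := funext hfg
        have h3 : analyticOrderAt (fun z : ℂ => z - z₀) z₀ = 1 :=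
          hid.analyticOrderAt_eq_one_of_zero_deriv_ne_zero (by simp) (by simp)
        conv_lhs => rw [h2, analyticOrderAt_mul hid ha, h3]
      rw [h1, Nat.cast_add, Nat.cast_one, add_comm 1] at hk
      exact (ENat.add_le_add_iff_right ENat.one_ne_top).1 hk
    intro z hz
    have := ih hg hgB hgo z hz
    rw [hfg z, norm_mul]
    calc ‖z - z₀‖ * ‖dslope f z₀ z‖ ≤ ‖z - z₀‖ * (B / r * (‖z - z₀‖ / r) ^ k) := by gcongr
      _ = B * (‖z - z₀‖ / r) ^ (k + 1) := by rw [pow_succ]; ring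

section FiniteDimension

variable {M : Type*} [TopologicalSpace M] [ChartedSpace ℂ M] [IsManifold 𝓘(ℂ) ω M]
  {E : M → Type*} [∀ x, AddCommGroup (E x)] [∀ x, Module ℂ (E x)]
  [∀ x, TopologicalSpace (E x)] [TopologicalSpace (TotalSpace ℂ E)]
  [FiberBundle ℂ E] [VectorBundle ℂ ℂ E] [ContMDiffVectorBundle ω ℂ E 𝓘(ℂ)]

/-- The local representative of a section in the standard chart and frame at `x`. -/
def stdRep {n : ℕ} (s : PowSection E n) (x : M) : ℂ → ℂ :=
  localRep (baseFrame x) s ∘ (chartAt ℂ x).symm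

/-- The open subset of the plane on which the standard chart and frame at `x` are defined. -/
def stdDomain (E : M → Type*) [∀ x, AddCommGroup (E x)] [∀ x, Module ℂ (E x)]
    [∀ x, TopologicalSpace (E x)] [TopologicalSpace (TotalSpace ℂ E)]
    [FiberBundle ℂ E] [VectorBundle ℂ ℂ E] (x : M) : Set ℂ :=
  (chartAt ℂ x).target ∩ (chartAt ℂ x).symm ⁻¹' (trivializationAt ℂ E x).baseSet

lemma isOpen_stdDomain (x : M) : IsOpen (stdDomain E x) :=
  (chartAt ℂ x).symm.isOpen_inter_preimage (trivializationAt ℂ E x).open_baseSet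

lemma mem_stdDomain (x : M) : chartAt ℂ x x ∈ stdDomain E x := by
  refine ⟨mem_chart_target ℂ x, ?_⟩
  simpa using mem_baseSet_self x

lemma analyticAt_stdRep {n : ℕ} {s : PowSection E n} (hs : s ∈ holomorphicSections E n) {x : M}
    {ζ : ℂ} (hζ : ζ ∈ stdDomain E x) : AnalyticAt ℂ (stdRep s x) ζ := by
  have := analyticAt_localRep hs (isHolomorphicFrame_baseFrame (E := E) x)
    (isHolomorphicChart_chartAt x) ⟨hζ.2, (chartAt ℂ x).map_target hζ.1⟩
  rwa [(chartAt ℂ x).right_inv hζ.1] at this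

variable (h : HermitianMetric E) (n : ℕ)

/-- Near `x`, sections with a zero of high order at `x` are small: their squared pointwise norm is
at most half of its supremum over `M`. -/
lemma exists_order_bound (x : M) : ∃ N ∈ 𝓝 x, ∃ k : ℕ, ∀ s ∈ holomorphicSections E n,
    (k : ℕ∞) ≤ analyticOrderAt (stdRep s x) (chartAt ℂ x x) →
    ∀ p : ℝ, (∀ y, (pointwiseInner h s s y).re ≤ p) →
    ∀ y ∈ N, (pointwiseInner h s s y).re ≤ p / 2 := by
  set c := chartAt ℂ x with hc
  have hxc : x ∈ c.source := mem_chart_source ℂ x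
  have hb := isHolomorphicFrame_baseFrame (E := E) x
  obtain ⟨r, hr, hrD⟩ := Metric.nhds_basis_closedBall.mem_iff.1
    ((isOpen_stdDomain (E := E) x).mem_nhds (mem_stdDomain x))
  set H : ℂ → ℝ := fun ζ => (h.form (c.symm ζ) (baseFrame x (c.symm ζ))
    (baseFrame x (c.symm ζ))).re ^ n with hH
  have hHpos : ∀ ζ ∈ Metric.closedBall (c x) r, 0 < H ζ := fun ζ hζ =>
    pow_pos (h.pos _ _ (hb.ne_zero _ (hrD hζ).2)) n
  have hHc : ContinuousOn H (Metric.closedBall (c x) r) := by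
    intro ζ hζ
    have h1 := (contMDiffAt_form h hb (hrD hζ).2).continuousAt
    have h2 : ContinuousAt c.symm ζ := c.continuousAt_symm (hrD hζ).1
    exact ((ContinuousAt.comp (f := c.symm) h1 h2).pow n).continuousWithinAt
  have hK : IsCompact (Metric.closedBall (c x) r) := isCompact_closedBall _ _
  have hKne : (Metric.closedBall (c x) r).Nonempty := ⟨c x, Metric.mem_closedBall_self hr.le⟩
  obtain ⟨ζ₁, hζ₁, hmin⟩ := hK.exists_isMinOn hKne hHc
  obtain ⟨ζ₂, hζ₂, hmax⟩ := hK.exists_isMaxOn hKne hHc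
  have hm : 0 < H ζ₁ := hHpos _ hζ₁
  obtain ⟨k, hk⟩ := exists_pow_lt_of_lt_one (show (0 : ℝ) < H ζ₁ / (2 * H ζ₂) from
    div_pos hm (by have := hHpos _ hζ₂; positivity)) (show (1 / 4 : ℝ) < 1 by norm_num)
  refine ⟨c.source ∩ c ⁻¹' Metric.ball (c x) (r / 2), ?_, k, ?_⟩
  · exact Filter.inter_mem (c.open_source.mem_nhds hxc)
      (c.continuousAt hxc (Metric.ball_mem_nhds _ (by positivity)))
  intro s hs hord p hp y hy
  have hval : ∀ ζ ∈ Metric.closedBall (c x) r,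
      (pointwiseInner h s s (c.symm ζ)).re = ‖stdRep s x ζ‖ ^ 2 * H ζ := by
    intro ζ hζ
    rw [pointwiseInner_eq h (hb.ne_zero _ (hrD hζ).2), Complex.mul_conj,
      Complex.normSq_eq_norm_sq, form_self_eq, ← Complex.ofReal_pow, ← Complex.ofReal_mul,
      Complex.ofReal_re]
    rfl
  have hp0 : 0 ≤ p := by
    have h1 := hp (c.symm (c x))
    rw [hval _ (Metric.mem_closedBall_self hr.le)] at h1
    have := hHpos _ (Metric.mem_closedBall_self (x := c x) hr.le)
    exact le_trans (by positivity) h1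
  have hB : ∀ ζ ∈ Metric.closedBall (c x) r, ‖stdRep s x ζ‖ ≤ √(p / H ζ₁) := by
    intro ζ hζ
    refine Real.le_sqrt_of_sq_le ((le_div_iff₀ hm).2 ?_)
    calc ‖stdRep s x ζ‖ ^ 2 * H ζ₁ ≤ ‖stdRep s x ζ‖ ^ 2 * H ζ := by
          gcongr; exact hmin hζ
      _ = (pointwiseInner h s s (c.symm ζ)).re := (hval ζ hζ).symm
      _ ≤ p := hp _
  have hyb : c y ∈ Metric.closedBall (c x) r := by
    have := hy.2
    simp only [mem_preimage, Metric.mem_ball] at this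
    rw [Metric.mem_closedBall]; linarith
  have hS := norm_le_of_le_analyticOrderAt hr (isOpen_stdDomain (E := E) x) hrD k
    (fun ζ hζ => (analyticAt_stdRep hs hζ).differentiableAt.differentiableWithinAt) hB hord _ hyb
  have hhalf : ‖c y - c x‖ / r ≤ 1 / 2 := by
    have := hy.2
    simp only [mem_preimage, Metric.mem_ball, dist_eq_norm] at this
    rw [div_le_iff₀ hr]; linarith
  have hS2 : ‖stdRep s x (c y)‖ ≤ √(p / H ζ₁) * (1 / 2) ^ k := hS.trans (by gcongr)
  have hyv := hval _ hyb
  rw [c.left_inv hy.1] at hyv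
  have hM : 0 < H ζ₂ := hHpos _ hζ₂
  rw [hyv]
  calc ‖stdRep s x (c y)‖ ^ 2 * H (c y) ≤ (√(p / H ζ₁) * (1 / 2) ^ k) ^ 2 * H ζ₂ := by
        gcongr
        · exact (hHpos _ hyb).le
        · exact hmax hyb
    _ = p / H ζ₁ * (1 / 4) ^ k * H ζ₂ := by
        rw [mul_pow, Real.sq_sqrt (by positivity), ← pow_mul, mul_comm k 2, pow_mul]
        norm_num
    _ ≤ p / H ζ₁ * (H ζ₁ / (2 * H ζ₂)) * H ζ₂ := by gcongr
    _ = p / 2 := by field_simp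

/-- The jet of order `k` at `x`, as a linear map on holomorphic sections. -/
def jet (x : M) (k : ℕ) : holomorphicSections E n →ₗ[ℂ] (Fin k → ℂ) where
  toFun s j := iteratedDeriv j (stdRep s.1 x) (chartAt ℂ x x)
  map_add' s t := by
    funext j
    have h1 : stdRep (s + t).1 x = fun ζ => stdRep s.1 x ζ + stdRep t.1 x ζ := by
      funext ζ; exact localRep_add _ _ _ _
    rw [h1, iteratedDeriv_fun_add (analyticAt_stdRep s.2 (mem_stdDomain x)).contDiffAt
      (analyticAt_stdRep t.2 (mem_stdDomain x)).contDiffAt]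
    rfl
  map_smul' a s := by
    funext j
    have h1 : stdRep (a • s).1 x = fun ζ => a * stdRep s.1 x ζ := by
      funext ζ; exact localRep_smul _ _ _ _
    rw [h1, iteratedDeriv_const_mul_field]
    rfl

/-- The space of holomorphic sections is finite-dimensional: a section with zeros of sufficiently
high order at finitely many well-chosen points vanishes, by the Schwarz lemma applied at the
maximum of its norm. -/
theorem finiteDimensional_holomorphicSections [CompactSpace M] [Nonempty M]
    (h : HermitianMetric E) : FiniteDimensional ℂ (holomorphicSections E n) := by
  choose N hN k hk using exists_order_bound h n
  obtain ⟨I, hI⟩ := isCompact_univ.elim_nhds_subcover N (fun x _ => hN x)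
  have hinj : Function.Injective
      (LinearMap.pi fun x : I => jet (E := E) n x.1 (k x.1)) := by
    rw [← LinearMap.ker_eq_bot, LinearMap.ker_eq_bot']
    rintro ⟨s, hs⟩ h0
    have hcont : Continuous fun y => (pointwiseInner h s s y).re :=
      Complex.continuous_re.comp (continuous_pointwiseInner h hs hs)
    obtain ⟨y, -, hy⟩ := isCompact_univ.exists_isMaxOn univ_nonempty hcont.continuousOn
    have hmax : ∀ w, (pointwiseInner h s s w).re ≤ (pointwiseInner h s s y).re :=
      fun w => hy (mem_univ w)
    obtain ⟨x, hxI, hyx⟩ := mem_iUnion₂.1 (hI.2 (mem_univ y))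
    have hord : (k x : ℕ∞) ≤ analyticOrderAt (stdRep s x) (chartAt ℂ x x) := by
      rw [natCast_le_analyticOrderAt_iff_iteratedDeriv_eq_zero
        (analyticAt_stdRep hs (mem_stdDomain x))]
      intro i hi
      exact congrFun (congrFun h0 ⟨x, hxI⟩) ⟨i, hi⟩
    have hle := hk x s hs hord _ hmax y hyx
    have hle0 : (pointwiseInner h s s y).re ≤ 0 := by linarith
    ext w : 2
    have hb : baseFrame w w ≠ (0 : E w) := baseFrame_ne_zero (mem_baseSet_self w)
    have hw := (hmax w).trans hle0
    rw [pointwiseInner_eq h hb, Complex.mul_conj, Complex.normSq_eq_norm_sq, form_self_eq,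
      ← Complex.ofReal_pow, ← Complex.ofReal_mul, Complex.ofReal_re] at hw
    have hpos := pow_pos (h.pos _ _ hb) n
    have hz : ‖localRep (baseFrame w) s w‖ ^ 2 ≤ 0 := by
      by_contra hlt
      rw [not_le] at hlt
      exact absurd hw (not_le.2 (mul_pos hlt hpos))
    have hz' : localRep (baseFrame w) s w = 0 := by
      have : ‖localRep (baseFrame w) s w‖ = 0 := by
        nlinarith [norm_nonneg (localRep (baseFrame w) s w)]
      simpa using this
    exact (localRep_eq_zero_iff hb s).1 hz'
  exact FiniteDimensional.of_injective _ hinj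

end FiniteDimension

/-! ### The conditional Bergman kernel -/

/-- Parseval's identity for an orthonormal basis `u` of the orthogonal complement of `w`. For
`w = 0` the quotient is `0`. -/
lemma sum_norm_inner_sq_eq_sub {V : Type*} [NormedAddCommGroup V] [InnerProductSpace ℂ V] {m : ℕ}
    {u : Fin m → V} (hu : Orthonormal ℂ u) {w : V} (huw : ∀ k, inner ℂ (u k) w = 0)
    (hspan : ∀ v, inner ℂ w v = 0 → v ∈ Submodule.span ℂ (range u)) (v : V) :
    ∑ k, ‖inner ℂ (u k) v‖ ^ 2 = ‖v‖ ^ 2 - ‖inner ℂ w v‖ ^ 2 / ‖w‖ ^ 2 := by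
  set a : ℂ := inner ℂ w v / (‖w‖ ^ 2 : ℝ) with ha
  set v' := v - a • w with hv'
  have hwv' : inner ℂ w v' = 0 := by
    rw [hv', inner_sub_right, inner_smul_right, inner_self_eq_norm_sq_to_K, ha]
    by_cases hw : w = 0
    · simp [hw]
    · have : ((‖w‖ : ℂ)) ≠ 0 := by exact_mod_cast norm_ne_zero_iff.2 hw
      push_cast
      simp only [RCLike.ofReal_eq_complex_ofReal] at *
      field_simp
      ring
  have hin : ∀ k, inner ℂ (u k) v' = inner ℂ (u k) v := by
    intro k
    rw [hv', inner_sub_right, inner_smul_right, huw, mul_zero, sub_zero]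
  obtain ⟨b, hb⟩ := (Submodule.mem_span_range_iff_exists_fun ℂ).1 (hspan v' hwv')
  have hbk : ∀ k, inner ℂ (u k) v' = b k := by
    intro k
    rw [← hb, hu.inner_right_fintype]
  have h1 : (‖v'‖ ^ 2 : ℂ) = ∑ k, ((‖b k‖ ^ 2 : ℝ) : ℂ) := by
    have h2 : inner ℂ v' v' = ∑ k, conj (b k) * b k := by
      conv_lhs => rw [← hb]
      rw [hu.inner_sum]
    rw [inner_self_eq_norm_sq_to_K] at h2
    rw [show (‖v'‖ ^ 2 : ℂ) = _ from h2]
    refine Finset.sum_congr rfl fun k _ => ?_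
    rw [mul_comm, Complex.mul_conj, Complex.normSq_eq_norm_sq]
  have h3 : (‖v'‖ ^ 2 : ℂ) = (‖v‖ ^ 2 : ℂ) - ((‖inner ℂ w v‖ ^ 2 / ‖w‖ ^ 2 : ℝ) : ℂ) := by
    have h4 : inner ℂ v' v' = inner ℂ v v' := by
      conv_lhs => rw [hv', inner_sub_left, inner_smul_left, ← hv', hwv', mul_zero, sub_zero]
    have h5 : inner ℂ v v' = inner ℂ v v - a * inner ℂ v w := by
      rw [hv', inner_sub_right, inner_smul_right]
    have h6 : a * inner ℂ v w = ((‖inner ℂ w v‖ ^ 2 / ‖w‖ ^ 2 : ℝ) : ℂ) := by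
      rw [ha, ← inner_conj_symm v w, div_mul_eq_mul_div, Complex.mul_conj,
        Complex.normSq_eq_norm_sq]
      push_cast; rfl
    rw [inner_self_eq_norm_sq_to_K] at h4
    rw [show (‖v'‖ ^ 2 : ℂ) = _ from h4, h5, h6, inner_self_eq_norm_sq_to_K]
    rfl
  have h7 : ((∑ k, ‖inner ℂ (u k) v‖ ^ 2 : ℝ) : ℂ) =
      ((‖v‖ ^ 2 - ‖inner ℂ w v‖ ^ 2 / ‖w‖ ^ 2 : ℝ) : ℂ) := by
    simp only [← hin, hbk]
    push_cast
    rw [h1] at h3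
    push_cast at h3
    exact h3
  exact_mod_cast h7

section Kernel

variable {M : Type*} [TopologicalSpace M] [ChartedSpace ℂ M] [IsManifold 𝓘(ℂ) ω M]
  [MeasurableSpace M] [BorelSpace M]
  {E : M → Type*} [∀ x, AddCommGroup (E x)] [∀ x, Module ℂ (E x)]
  [∀ x, TopologicalSpace (E x)] [TopologicalSpace (TotalSpace ℂ E)]
  [FiberBundle ℂ E] [VectorBundle ℂ ℂ E] [ContMDiffVectorBundle ω ℂ E 𝓘(ℂ)]
  {h : HermitianMetric E} {n d m : ℕ}

lemma norm_pointwiseInner_le (s t : PowSection E n) (x : M) :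
    ‖pointwiseInner h s t x‖ ≤
      (1 / 2) * (‖pointwiseInner h s s x‖ + ‖pointwiseInner h t t x‖) := by
  simp only [pointwiseInner, norm_mul, RCLike.norm_conj]
  have h1 := norm_nonneg (h.form x (baseFrame x x) (baseFrame x x) ^ n)
  nlinarith [mul_nonneg (sq_nonneg (‖localRep (baseFrame x) s x‖ - ‖localRep (baseFrame x) t x‖)) h1]

lemma pointwiseInner_sum (S : Fin d → PowSection E n) (a b : Fin d → ℂ) (x : M) :
    pointwiseInner h (∑ i, a i • S i) (∑ j, b j • S j) x =
      ∑ i, ∑ j, a i * conj (b j) * pointwiseInner h (S i) (S j) x := by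
  simp only [pointwiseInner, localRep_sum, map_sum, map_mul]
  rw [Finset.sum_mul_sum, Finset.sum_mul]
  refine Finset.sum_congr rfl fun i _ => ?_
  rw [Finset.sum_mul]
  exact Finset.sum_congr rfl fun j _ => by ring

/-- The sections of an orthonormal family are square-integrable, for otherwise the integral
`∫ |s|²` would be `0`. -/
lemma integrable_pointwiseInner {S : Fin d → PowSection E n}
    (hS : ∀ i, S i ∈ holomorphicSections E n)
    (ho : ∀ i j, sectionInner h (S i) (S j) = if i = j then 1 else 0) (i j : Fin d) :
    Integrable (pointwiseInner h (S i) (S j)) (kahlerMeasure h) := by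
  have hd : ∀ i, Integrable (pointwiseInner h (S i) (S i)) (kahlerMeasure h) := by
    intro i
    by_contra hni
    have h1 := ho i i
    rw [sectionInner, integral_undef hni, if_pos rfl] at h1
    exact zero_ne_one h1
  refine Integrable.mono' (((hd i).norm.add (hd j).norm).const_mul (1 / 2))
    (continuous_pointwiseInner h (hS i) (hS j)).aestronglyMeasurable
    (Filter.Eventually.of_forall fun x => norm_pointwiseInner_le _ _ x)

lemma sectionInner_sum {S : Fin d → PowSection E n} (hS : ∀ i, S i ∈ holomorphicSections E n)
    (ho : ∀ i j, sectionInner h (S i) (S j) = if i = j then 1 else 0) (a b : Fin d → ℂ) :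
    sectionInner h (∑ i, a i • S i) (∑ j, b j • S j) = ∑ i, a i * conj (b i) := by
  have hint := integrable_pointwiseInner hS ho
  have hval : ∀ i j, ∫ x, pointwiseInner h (S i) (S j) x ∂kahlerMeasure h
      = if i = j then 1 else 0 := ho
  rw [sectionInner]
  simp only [pointwiseInner_sum]
  rw [integral_finsetSum _ fun i _ => integrable_finsetSum _ fun j _ => (hint i j).const_mul _]
  refine Finset.sum_congr rfl fun i _ => ?_
  rw [integral_finsetSum _ fun j _ => (hint i j).const_mul _]
  simp only [integral_const_mul, hval]
  simp

lemma eq_of_sum_smul_eq {S : Fin d → PowSection E n} (hS : ∀ i, S i ∈ holomorphicSections E n)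
    (ho : ∀ i j, sectionInner h (S i) (S j) = if i = j then 1 else 0) {a b : Fin d → ℂ}
    (hab : ∑ i, a i • S i = ∑ i, b i • S i) : a = b := by
  funext j
  have h1 := sectionInner_sum hS ho a (Pi.single j 1)
  have h2 := sectionInner_sum hS ho b (Pi.single j 1)
  rw [hab, h2] at h1
  simpa [Pi.single_apply, apply_ite] using h1.symm

lemma holomorphicSections_of_isOrthonormalBasis {W : Submodule ℂ (PowSection E n)}
    (hW : W ≤ holomorphicSections E n) {S : Fin d → PowSection E n}
    (hS : IsOrthonormalBasis h W S) (i : Fin d) : S i ∈ holomorphicSections E n :=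
  hW (hS.span_eq ▸ Submodule.subset_span (mem_range_self i))

lemma criticalSections_le (q : M) : criticalSections h n q ≤ holomorphicSections E n :=
  fun _ hs => hs.1

variable {q : M} {c' : OpenPartialHomeomorph M ℂ} {U' : Set M} {e' : ∀ x, E x}

/-- The kernel derivatives occurring in the conditional kernel, in terms of the derivatives at `q`
of the sections. -/
lemma conditionalKernel_eq_of_isAdapted (ha : IsAdapted h q c' U' e')
    {S : Fin d → PowSection E n} (hS : ∀ i, S i ∈ holomorphicSections E n) (e : ∀ x, E x) (z : M)
    {ℓ : Fin d → ℂ} (hℓ : ∀ i, ℓ i = deriv (localRep e' (S i) ∘ c'.symm) (c' q)) :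
    conditionalKernel S q c' e' e z =
      ((∑ i, ‖localRep e (S i) z‖ ^ 2 -
        ‖∑ i, conj (ℓ i) * localRep e (S i) z‖ ^ 2 / ∑ i, ‖ℓ i‖ ^ 2 : ℝ) : ℂ) := by
  have hA : ∀ i, AnalyticAt ℂ (localRep e' (S i) ∘ c'.symm) (c' q) := fun i =>
    analyticAt_localRep (hS i) ha.frame ha.chart ha.mem
  have hR : ∀ i {ζ}, AnalyticAt ℂ (localRep e' (S i) ∘ c'.symm) ζ →
      DifferentiableAt ℝ (fun ζ => localRep e' (S i) (c'.symm ζ)) ζ := fun i ζ h =>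
    h.differentiableAt.restrictScalars ℝ
  have hRc : ∀ i {ζ}, AnalyticAt ℂ (localRep e' (S i) ∘ c'.symm) ζ →
      DifferentiableAt ℝ (fun ζ => conj (localRep e' (S i) (c'.symm ζ))) ζ := fun i ζ h =>
    Complex.conjCLE.differentiableAt.comp ζ (hR i h)
  have hbar : ∀ i {ζ}, AnalyticAt ℂ (localRep e' (S i) ∘ c'.symm) ζ →
      wirtingerBar (fun ζ => conj (localRep e' (S i) (c'.symm ζ))) ζ =
        conj (deriv (localRep e' (S i) ∘ c'.symm) ζ) := by
    intro i ζ h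
    rw [wirtingerBar_conj]
    exact congrArg conj (wirtinger_of_differentiableAt h.differentiableAt)
  have h1 : kernel S e e z z = ((∑ i, ‖localRep e (S i) z‖ ^ 2 : ℝ) : ℂ) := by
    simp only [kernel, Complex.mul_conj, Complex.normSq_eq_norm_sq]
    push_cast; rfl
  have h2 : wirtingerBar (fun ζ => kernel S e e' z (c'.symm ζ)) (c' q) =
      ∑ i, conj (ℓ i) * localRep e (S i) z := by
    simp only [kernel]
    rw [wirtingerBar_sum _ fun i _ => (differentiableAt_const _).fun_mul (hRc i (hA i))]
    refine Finset.sum_congr rfl fun i _ => ?_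
    rw [wirtingerBar_mul (differentiableAt_const _) (hRc i (hA i)), hbar i (hA i), ← hℓ,
      wirtingerBar_of_differentiableAt (differentiableAt_const _)]
    ring
  have h3 : wirtingerBar (fun ζ => kernel S e' e' (c'.symm ζ) (c'.symm ζ)) =ᶠ[𝓝 (c' q)]
      fun ζ => ∑ i, (localRep e' (S i) ∘ c'.symm) ζ *
        conj (deriv (localRep e' (S i) ∘ c'.symm) ζ) := by
    have hev : ∀ᶠ ζ in 𝓝 (c' q), ∀ i, AnalyticAt ℂ (localRep e' (S i) ∘ c'.symm) ζ :=
      Filter.eventually_all.2 fun i => (hA i).eventually_analyticAt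
    filter_upwards [hev] with ζ hζ
    simp only [kernel]
    rw [wirtingerBar_sum _ fun i _ => (hR i (hζ i)).fun_mul (hRc i (hζ i))]
    refine Finset.sum_congr rfl fun i _ => ?_
    rw [wirtingerBar_mul (hR i (hζ i)) (hRc i (hζ i)), hbar i (hζ i),
      show wirtingerBar (fun ζ => localRep e' (S i) (c'.symm ζ)) ζ = 0 from
        wirtingerBar_of_differentiableAt (hζ i).differentiableAt]
    simp
  have h4 : wirtinger (wirtingerBar fun ζ => kernel S e' e' (c'.symm ζ) (c'.symm ζ)) (c' q) =
      ((∑ i, ‖ℓ i‖ ^ 2 : ℝ) : ℂ) := by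
    have hD : ∀ i, DifferentiableAt ℝ
        (fun ζ => conj (deriv (localRep e' (S i) ∘ c'.symm) ζ)) (c' q) := fun i =>
      Complex.conjCLE.differentiableAt.comp (c' q)
        ((hA i).deriv.differentiableAt.restrictScalars ℝ)
    rw [wirtinger_congr h3, wirtinger_sum _ fun i _ =>
      ((hA i).differentiableAt.restrictScalars ℝ).fun_mul (hD i), Complex.ofReal_sum]
    refine Finset.sum_congr rfl fun i _ => ?_
    rw [wirtinger_mul ((hA i).differentiableAt.restrictScalars ℝ) (hD i), wirtinger_conj,
      wirtingerBar_of_differentiableAt (hA i).deriv.differentiableAt,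
      wirtinger_of_differentiableAt (hA i).differentiableAt, ← hℓ, map_zero, mul_zero, add_zero,
      Complex.mul_conj, Complex.normSq_eq_norm_sq]
  rw [conditionalKernel, h1, h2, h4]
  push_cast; rfl

/-- The conditional kernel is the Bergman kernel of the space of sections that are critical
at `q`. -/
theorem conditionalKernel_eq_sum (ha : IsAdapted h q c' U' e') {S : Fin d → PowSection E n}
    {T : Fin m → PowSection E n} (hS : IsOrthonormalBasis h (holomorphicSections E n) S)
    (hT : IsOrthonormalBasis h (criticalSections h n q) T) (e : ∀ x, E x) (z : M) :
    conditionalKernel S q c' e' e z = ((∑ k, ‖localRep e (T k) z‖ ^ 2 : ℝ) : ℂ) := by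
  have hSh := holomorphicSections_of_isOrthonormalBasis le_rfl hS
  have hTh := holomorphicSections_of_isOrthonormalBasis (criticalSections_le q) hT
  set ℓ : Fin d → ℂ := fun i => deriv (localRep e' (S i) ∘ c'.symm) (c' q) with hℓ
  rw [conditionalKernel_eq_of_isAdapted ha hSh e z (ℓ := ℓ) fun i => rfl]
  have hTS : ∀ k, ∃ a : Fin d → ℂ, ∑ i, a i • S i = T k := fun k =>
    (Submodule.mem_span_range_iff_exists_fun ℂ).1 (hS.span_eq ▸ hTh k)
  choose A hA using hTS
  have hder : ∀ a : Fin d → ℂ,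
      deriv (localRep e' (∑ i, a i • S i) ∘ c'.symm) (c' q) = ∑ i, a i * ℓ i := by
    intro a
    have h1 : localRep e' (∑ i, a i • S i) ∘ c'.symm =
        fun ζ => ∑ i, a i * (localRep e' (S i) ∘ c'.symm) ζ := by
      funext ζ; exact localRep_sum _ _ _ _ _
    have hd : ∀ i, DifferentiableAt ℂ (localRep e' (S i) ∘ c'.symm) (c' q) := fun i =>
      (analyticAt_localRep (hSh i) ha.frame ha.chart ha.mem).differentiableAt
    rw [h1, deriv_fun_sum fun i _ => (hd i).const_mul (a i)]
    exact Finset.sum_congr rfl fun i _ => deriv_const_mul _ (hd i)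
  -- `⟪u k, v⟫` is the value of `T k` at `z`, and `⟪w, v⟫` is the `w̄`-derivative at `q` of the kernel;
  -- the coordinates of `u k` are conjugated since the inner product is conjugate-linear in its
  -- first argument
  set u : Fin m → EuclideanSpace ℂ (Fin d) := fun k => WithLp.toLp 2 fun i => conj (A k i) with hu
  set w : EuclideanSpace ℂ (Fin d) := WithLp.toLp 2 ℓ with hw
  set v : EuclideanSpace ℂ (Fin d) := WithLp.toLp 2 fun i => localRep e (S i) z with hv
  have huo : Orthonormal ℂ u := by
    rw [orthonormal_iff_ite]
    intro k l
    rw [← hT.orthonormal k l, ← hA k, ← hA l, sectionInner_sum hSh hS.orthonormal]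
    simp [hu, EuclideanSpace.inner_eq_star_dotProduct, dotProduct, mul_comm]
  have huw : ∀ k, inner ℂ (u k) w = 0 := by
    intro k
    have h1 : T k ∈ criticalSections h n q := hT.span_eq ▸ Submodule.subset_span (mem_range_self k)
    have h2 := (ha.mem_criticalSections_iff.1 h1).2
    rw [← hA k, hder] at h2
    rw [← h2]
    simp [hu, hw, EuclideanSpace.inner_eq_star_dotProduct, dotProduct, mul_comm]
  have hspan : ∀ y, inner ℂ w y = 0 → y ∈ Submodule.span ℂ (range u) := by
    intro y hy
    have h1 : ∑ i, conj (y i) * ℓ i = 0 := by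
      have := congrArg conj hy
      rw [inner_conj_symm, map_zero] at this
      rw [← this]
      simp [hw, EuclideanSpace.inner_eq_star_dotProduct, dotProduct, mul_comm]
    have h2 : ∑ i, conj (y i) • S i ∈ criticalSections h n q :=
      ha.mem_criticalSections_iff.2
        ⟨Submodule.sum_mem _ fun i _ => Submodule.smul_mem _ _ (hSh i), by rw [hder, h1]⟩
    rw [← hT.span_eq] at h2
    obtain ⟨b, hb⟩ := (Submodule.mem_span_range_iff_exists_fun ℂ).1 h2
    have h3 : ∑ i, (∑ k, b k * A k i) • S i = ∑ i, conj (y i) • S i := by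
      rw [← hb]
      simp only [← hA, Finset.smul_sum, Finset.sum_smul, smul_smul]
      exact Finset.sum_comm
    have h4 := eq_of_sum_smul_eq hSh hS.orthonormal h3
    refine (Submodule.mem_span_range_iff_exists_fun ℂ).2 ⟨fun k => conj (b k), ?_⟩
    ext i
    have h5 := congrArg conj (congrFun h4 i)
    simp only [map_sum, map_mul, Complex.conj_conj] at h5
    rw [← h5]
    simp [hu]
  have key := sum_norm_inner_sq_eq_sub huo huw hspan v
  have e1 : ∀ k, inner ℂ (u k) v = localRep e (T k) z := by
    intro k
    rw [← hA k, localRep_sum]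
    simp [hu, hv, EuclideanSpace.inner_eq_star_dotProduct, dotProduct, mul_comm]
  have e2 : inner ℂ w v = ∑ i, conj (ℓ i) * localRep e (S i) z := by
    simp [hw, hv, EuclideanSpace.inner_eq_star_dotProduct, dotProduct, mul_comm]
  rw [e2, EuclideanSpace.norm_sq_eq, EuclideanSpace.norm_sq_eq] at key
  simp only [e1] at key
  rw [key]

end Kernel

/-! ### Test functions in a chart -/

section Patch

variable {M : Type*} [TopologicalSpace M] [ChartedSpace ℂ M]

/-- The function `ψ` read in the chart `c`, and extended by zero outside the chart. -/
def chartExtension (ψ : M → ℝ) (c : OpenPartialHomeomorph M ℂ) : ℂ → ℂ :=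
  c.target.indicator fun ζ => ((ψ (c.symm ζ) : ℝ) : ℂ)

variable {ψ : M → ℝ} {c : OpenPartialHomeomorph M ℂ}

lemma chartExtension_eventuallyEq {ζ : ℂ} (hζ : ζ ∈ c.target) :
    chartExtension ψ c =ᶠ[𝓝 ζ] fun ξ => ((ψ (c.symm ξ) : ℝ) : ℂ) := by
  filter_upwards [c.open_target.mem_nhds hζ] with ξ hξ
  exact indicator_of_mem hξ _

lemma chartExtension_apply {x : M} (hx : x ∈ c.source) : chartExtension ψ c (c x) = (ψ x : ℂ) := by
  rw [chartExtension, indicator_of_mem (c.map_source hx), c.left_inv hx]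

lemma re_ddbar_chartExtension {ζ : ℂ} (hζ : ζ ∈ c.target) :
    (wirtinger (wirtingerBar (chartExtension ψ c)) ζ).re = ddbar ψ c ζ := by
  refine congrArg Complex.re (wirtinger_congr ?_)
  filter_upwards [c.open_target.mem_nhds hζ] with ξ hξ
  exact wirtingerBar_congr (chartExtension_eventuallyEq hξ)

variable [CompactSpace M]

lemma isCompact_image_tsupport (hsupp : tsupport ψ ⊆ c.source) : IsCompact (c '' tsupport ψ) :=
  (isClosed_tsupport ψ).isCompact.image_of_continuousOn (c.continuousOn.mono hsupp)

lemma tsupport_chartExtension_subset (hsupp : tsupport ψ ⊆ c.source) :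
    tsupport (chartExtension ψ c) ⊆ c '' tsupport ψ := by
  refine closure_minimal (fun ζ hζ => ?_) (isCompact_image_tsupport hsupp).isClosed
  have hζt : ζ ∈ c.target := by
    by_contra h
    exact hζ (indicator_of_notMem h _)
  refine ⟨c.symm ζ, subset_tsupport ψ fun h => hζ ?_, c.right_inv hζt⟩
  rw [chartExtension, indicator_of_mem hζt, h, Complex.ofReal_zero]

lemma hasCompactSupport_chartExtension (hsupp : tsupport ψ ⊆ c.source) :
    HasCompactSupport (chartExtension ψ c) :=
  (isCompact_image_tsupport hsupp).of_isClosed_subset (isClosed_tsupport _)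
    (tsupport_chartExtension_subset hsupp)

lemma contDiff_chartExtension [IsManifold 𝓘(ℂ) ω M] (hc : IsHolomorphicChart c)
    (hψ : ContMDiff 𝓘(ℝ, ℂ) 𝓘(ℝ, ℝ) ∞ ψ) (hsupp : tsupport ψ ⊆ c.source) :
    ContDiff ℝ 2 (chartExtension ψ c) := by
  rw [contDiff_iff_contDiffAt]
  intro ζ
  by_cases hζ : ζ ∈ c.target
  · refine ContDiffAt.congr_of_eventuallyEq ?_ (chartExtension_eventuallyEq hζ)
    have h1 := contDiffAt_comp_symm_of_real hc (c.map_target hζ) (hψ (c.symm ζ))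
    rw [c.right_inv hζ] at h1
    exact Complex.ofRealCLM.contDiff.contDiffAt.comp ζ (h1.of_le (WithTop.coe_le_coe.2 (le_top : (2 : ℕ∞) ≤ ⊤)))
  · have h0 : ζ ∉ tsupport (chartExtension ψ c) := fun h => by
      obtain ⟨x, hx, rfl⟩ := tsupport_chartExtension_subset hsupp h
      exact hζ (c.map_source (hsupp hx))
    rw [notMem_tsupport_iff_eventuallyEq] at h0
    exact contDiffAt_const.congr_of_eventuallyEq h0

end Patch

/-! ### The zeros of a Gaussian section -/

section Zeros

variable {M : Type*} [TopologicalSpace M] [ChartedSpace ℂ M] [IsManifold 𝓘(ℂ) ω M]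
  {E : M → Type*} [∀ x, AddCommGroup (E x)] [∀ x, Module ℂ (E x)]
  [∀ x, TopologicalSpace (E x)] [TopologicalSpace (TotalSpace ℂ E)]
  [FiberBundle ℂ E] [VectorBundle ℂ ℂ E] [ContMDiffVectorBundle ω ℂ E 𝓘(ℂ)]
  {n m : ℕ} {s : PowSection E n}

lemma IsHolomorphicFrame.mono {U V : Set M} {e : ∀ x, E x} (he : IsHolomorphicFrame E U e)
    (hV : IsOpen V) (hVU : V ⊆ U) : IsHolomorphicFrame E V e :=
  ⟨hV, he.holomorphic.mono hVU, fun x hx => he.ne_zero x (hVU hx)⟩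

lemma apply_eq_zero_of_zeroOrder_ne_zero {x : M} (hx : zeroOrder s x ≠ 0) : s x = 0 := by
  have h1 := apply_eq_zero_of_analyticOrderAt_ne_zero hx
  rw [Function.comp_apply, (chartAt ℂ x).left_inv (mem_chart_source ℂ x)] at h1
  exact (localRep_eq_zero_iff (baseFrame_ne_zero (mem_baseSet_self x)) s).1 h1

/-- The zeros of a section are isolated, hence finite in number. -/
lemma finite_zeroOrder_ne_zero [CompactSpace M] (hs : s ∈ holomorphicSections E n)
    (hord : ∀ x, zeroOrder s x ≠ ⊤) : {x : M | zeroOrder s x ≠ 0}.Finite := by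
  suffices h : (univ ∩ {x : M | zeroOrder s x ≠ 0}).Finite by rwa [univ_inter] at h
  refine isCompact_univ.induction_on (p := fun t : Set M => (t ∩ {x | zeroOrder s x ≠ 0}).Finite)
    (by simp) (fun t t' htt' h => h.subset (inter_subset_inter_left _ htt'))
    (fun t t' h h' => by rw [union_inter_distrib_right]; exact h.union h') fun x _ => ?_
  have hxc := mem_chart_source ℂ x
  have hb := isHolomorphicFrame_baseFrame (E := E) x
  have ha := analyticAt_localRep hs hb (isHolomorphicChart_chartAt x) ⟨mem_baseSet_self x, hxc⟩
  have h := ha.eventually_eq_zero_or_eventually_ne_zero.resolve_left fun h =>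
    hord x (analyticOrderAt_eq_top.2 h)
  rw [eventually_nhdsWithin_iff] at h
  have hN := Filter.inter_mem (((chartAt ℂ x).continuousAt hxc).eventually h)
    (Filter.inter_mem ((chartAt ℂ x).open_source.mem_nhds hxc)
      (hb.isOpen.mem_nhds (mem_baseSet_self x)))
  refine ⟨_, by rw [nhdsWithin_univ]; exact hN, (finite_singleton x).subset ?_⟩
  rintro y ⟨⟨hy1, hy2, hy3⟩, hy⟩
  by_contra hyx
  refine hy1 (fun h => hyx ((chartAt ℂ x).injOn hy2 hxc h)) ?_
  rw [Function.comp_apply, (chartAt ℂ x).left_inv hy2]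
  exact (localRep_eq_zero_iff (hb.ne_zero _ hy3) s).2 (apply_eq_zero_of_zeroOrder_ne_zero hy)

lemma zeroSum_finsetSum [CompactSpace M] (hs : s ∈ holomorphicSections E n)
    (hord : ∀ x, zeroOrder s x ≠ ⊤) {ι : Type*} (I : Finset ι) (ψ : ι → M → ℝ) :
    zeroSum s (fun x => ∑ i ∈ I, ψ i x) = ∑ i ∈ I, zeroSum s (ψ i) := by
  simp only [zeroSum, Finset.mul_sum]
  refine finsum_sum_comm I _ fun i _ => (finite_zeroOrder_ne_zero hs hord).subset fun x hx h => ?_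
  exact hx (by simp [h])

/-- In a coordinate patch containing the support of `ψ`, the sum of `ψ` over the zeros of a section
is a sum over the zeros of the holomorphic function that represents the section. -/
lemma ofReal_zeroSum_eq {U : Set M} {e : ∀ x, E x} {c : OpenPartialHomeomorph M ℂ}
    (hs : s ∈ holomorphicSections E n) (he : IsHolomorphicFrame E U e) (hc : IsHolomorphicChart c)
    {ψ : M → ℝ} (hU : U ⊆ c.source) (hsupp : tsupport ψ ⊆ U) {f : ℂ → ℂ}
    (hf : f = localRep e s ∘ c.symm) :
    ((zeroSum s ψ : ℝ) : ℂ) =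
      ∑ᶠ ζ, ((analyticOrderAt f ζ).toNat : ℂ) * chartExtension ψ c ζ := by
  have h1 : ((zeroSum s ψ : ℝ) : ℂ) = ∑ᶠ x, ((zeroOrder s x).toNat : ℂ) * (ψ x : ℂ) := by
    have := (Complex.ofRealHom.toAddMonoidHom).map_finsum_of_injective Complex.ofReal_injective
      fun x => ((zeroOrder s x).toNat : ℝ) * ψ x
    simpa [zeroSum] using this
  have h2 : c.source.indicator (fun x => ((zeroOrder s x).toNat : ℂ) * (ψ x : ℂ)) =
      fun x => ((zeroOrder s x).toNat : ℂ) * (ψ x : ℂ) := by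
    refine indicator_eq_self.2 fun x hx => hU (hsupp (subset_tsupport ψ fun h => hx ?_))
    simp [h]
  have h3 : c.target.indicator (fun ζ => ((analyticOrderAt f ζ).toNat : ℂ) * chartExtension ψ c ζ) =
      fun ζ => ((analyticOrderAt f ζ).toNat : ℂ) * chartExtension ψ c ζ := by
    refine indicator_eq_self.2 fun ζ hζ => ?_
    by_contra h
    exact hζ (by simp [chartExtension, h])
  rw [h1, ← h2, ← h3, ← finsum_mem_def, ← finsum_mem_def]
  refine finsum_mem_eq_of_bijOn c c.bijOn fun x hx => ?_
  rw [chartExtension_apply hx]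
  by_cases hxU : x ∈ U
  · rw [zeroOrder_eq hs he hc ⟨hxU, hx⟩, hf]
  · rw [image_eq_zero_of_notMem_tsupport fun h => hxU (hsupp h)]
    simp

variable [MeasurableSpace M] [BorelSpace M] {h : HermitianMetric E}
  {W : Submodule ℂ (PowSection E n)} {T : Fin m → PowSection E n}

lemma IsOrthonormalBasis.pos_of_ne_bot (hT : IsOrthonormalBasis h W T) (hW : W ≠ ⊥) : 0 < m := by
  rcases Nat.eq_zero_or_pos m with rfl | hm
  · exact absurd (by rw [← hT.span_eq, range_eq_empty, Submodule.span_empty]) hW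
  · exact hm

lemma IsOrthonormalBasis.randomSection_mem (hT : IsOrthonormalBasis h W T) (a : Fin m → ℂ) :
    randomSection T a ∈ W :=
  Submodule.sum_mem _ fun j _ => Submodule.smul_mem _ _
    (hT.span_eq ▸ Submodule.subset_span (mem_range_self j))

lemma IsOrthonormalBasis.zeroOrder_randomSection_ne_top [ConnectedSpace M]
    (hT : IsOrthonormalBasis h W T) (hW : W ≤ holomorphicSections E n) {a : Fin m → ℂ}
    (ha : a ≠ 0) (x : M) : zeroOrder (randomSection T a) x ≠ ⊤ := by
  intro hx
  have h0 := eq_zero_of_zeroOrder_eq_top (hW (hT.randomSection_mem a)) hx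
  refine ha (eq_of_sum_smul_eq (holomorphicSections_of_isOrthonormalBasis hW hT) hT.orthonormal ?_)
  simpa [randomSection] using h0

variable [T2Space M] [CompactSpace M] [ConnectedSpace M]

/-- The expected zero current of a Gaussian section in a coordinate patch: it is
`(i/2π) ∂∂̄ log` of the diagonal of the Bergman kernel of the space of sections. -/
theorem integral_zeroSum_of_tsupport_subset (hm : 0 < m) (hT : IsOrthonormalBasis h W T)
    (hW : W ≤ holomorphicSections E n) {c : OpenPartialHomeomorph M ℂ} {U : Set M} {e : ∀ x, E x}
    (hc : IsHolomorphicChart c) (he : IsHolomorphicFrame E U e) (hU : U ⊆ c.source) {ψ : M → ℝ}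
    (hψ : ContMDiff 𝓘(ℝ, ℂ) 𝓘(ℝ, ℝ) ∞ ψ) (hsupp : tsupport ψ ⊆ U) :
    Integrable (fun a => zeroSum (randomSection T a) ψ) (complexGaussian m) ∧
    IntegrableOn (fun ζ => Real.log (∑ j, ‖localRep e (T j) (c.symm ζ)‖ ^ 2) * ddbar ψ c ζ)
      (c '' U) ∧
    ∫ a, zeroSum (randomSection T a) ψ ∂complexGaussian m =
      1 / Real.pi * ∫ ζ in c '' U,
        Real.log (∑ j, ‖localRep e (T j) (c.symm ζ)‖ ^ 2) * ddbar ψ c ζ := by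
  set G := chartExtension ψ c with hGdef
  have hsc := hsupp.trans hU
  have hGs : tsupport G ⊆ c '' U :=
    (tsupport_chartExtension_subset hsc).trans (image_mono hsupp)
  have hUt : c '' U ⊆ c.target := by
    rintro _ ⟨x, hx, rfl⟩
    exact c.map_source (hU hx)
  have hUo : IsOpen (c '' U) := c.isOpen_image_of_subset_source he.isOpen hU
  have hTh := holomorphicSections_of_isOrthonormalBasis hW hT
  have hrep : ∀ a : Fin m → ℂ, (fun ζ => ∑ j, a j * (localRep e (T j) ∘ c.symm) ζ) =
      localRep e (randomSection T a) ∘ c.symm := fun a => by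
    funext ζ
    exact (localRep_randomSection e T a _).symm
  obtain ⟨h1, h2, h3⟩ := integral_sum_zeros (f := fun j => localRep e (T j) ∘ c.symm) hm
    (contDiff_chartExtension hc hψ hsc) (hasCompactSupport_chartExtension hsc)
    (fun j ζ hζ => by
      obtain ⟨x, hx, rfl⟩ := hGs hζ
      exact analyticAt_localRep (hTh j) he hc ⟨hx, hU hx⟩)
    (fun a ha ζ hζ => by
      obtain ⟨x, hx, rfl⟩ := hGs hζ
      rw [hrep, ← zeroOrder_eq (hW (hT.randomSection_mem a)) he hc ⟨hx, hU hx⟩]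
      exact hT.zeroOrder_randomSection_ne_top hW ha x)
  have hz : ∀ a : Fin m → ℂ, ∑ᶠ ζ, ((analyticOrderAt (fun ζ => ∑ j, a j *
      (localRep e (T j) ∘ c.symm) ζ) ζ).toNat : ℂ) * chartExtension ψ c ζ =
      ((zeroSum (randomSection T a) ψ : ℝ) : ℂ) := fun a =>
    (ofReal_zeroSum_eq (hW (hT.randomSection_mem a)) he hc hU hsupp (hrep a)).symm
  simp only [hz] at h1 h3
  have hre : ∀ ζ ∈ c '' U,
      ((Real.log (∑ j, ‖(localRep e (T j) ∘ c.symm) ζ‖ ^ 2) : ℂ) *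
        wirtinger (wirtingerBar (chartExtension ψ c)) ζ).re =
      Real.log (∑ j, ‖localRep e (T j) (c.symm ζ)‖ ^ 2) * ddbar ψ c ζ := fun ζ hζ => by
    rw [Complex.re_ofReal_mul, re_ddbar_chartExtension (hUt hζ)]
    rfl
  have hout : ∀ ζ, ζ ∉ c '' U → ((Real.log (∑ j, ‖(localRep e (T j) ∘ c.symm) ζ‖ ^ 2) : ℂ) *
        wirtinger (wirtingerBar (chartExtension ψ c)) ζ).re = 0 := fun ζ hζ => by
    rw [image_eq_zero_of_notMem_tsupport fun h => hζ (hGs (tsupport_ddbar_subset h))]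
    simp
  refine ⟨by simpa using h1.re, ?_, ?_⟩
  · exact (h2.re.integrableOn (s := c '' U)).congr_fun hre hUo.measurableSet
  · have h4 := congrArg Complex.re h3
    rw [integral_complex_ofReal, Complex.ofReal_re] at h4
    rw [h4, ← setIntegral_congr_fun hUo.measurableSet hre,
      setIntegral_eq_integral_of_forall_compl_eq_zero hout]
    have h5 := integral_re h2
    rw [show (1 / (Real.pi : ℂ)) = ((1 / Real.pi : ℝ) : ℂ) by push_cast; rfl,
      Complex.re_ofReal_mul]
    exact congrArg _ h5.symm

/-- A Riemann surface is a smooth real manifold. -/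
lemma isManifold_real : IsManifold 𝓘(ℝ, ℂ) ∞ M := by
  refine isManifold_of_contDiffOn _ _ _ fun c c' hc hc' ζ hζ => ?_
  have h1 : ζ ∈ c.target ∧ c.symm ζ ∈ c'.source := by simpa [mfld_simps] using hζ
  have h2 := analyticAt_transition (IsManifold.subset_maximalAtlas (I := 𝓘(ℂ)) (n := ω) hc')
    (IsManifold.subset_maximalAtlas (I := 𝓘(ℂ)) (n := ω) hc) h1.2 (c.map_target h1.1)
  rw [c.right_inv h1.1] at h2
  exact (h2.contDiffAt.restrict_scalars ℝ).contDiffWithinAt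

/-- The expected sum of a smooth function over the zeros exists: a partition of unity reduces this
to functions supported in a coordinate patch. -/
theorem integrable_zeroSum (hm : 0 < m) (hT : IsOrthonormalBasis h W T)
    (hW : W ≤ holomorphicSections E n) {ψ : M → ℝ} (hψ : ContMDiff 𝓘(ℝ, ℂ) 𝓘(ℝ, ℝ) ∞ ψ) :
    Integrable (fun a => zeroSum (randomSection T a) ψ) (complexGaussian m) := by
  have := isManifold_real (M := M)
  obtain ⟨χ, hχ⟩ := SmoothPartitionOfUnity.exists_isSubordinate 𝓘(ℝ, ℂ) isClosed_univ
    (fun x : M => (trivializationAt ℂ E x).baseSet ∩ (chartAt ℂ x).source)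
    (fun x => (trivializationAt ℂ E x).open_baseSet.inter (chartAt ℂ x).open_source)
    (fun x _ => mem_iUnion.2 ⟨x, mem_baseSet_self x, mem_chart_source ℂ x⟩)
  have hfin : {i | (Function.support (χ i)).Nonempty}.Finite :=
    χ.locallyFinite.finite_nonempty_of_compact
  have hsum : ∀ x, ∑ i ∈ hfin.toFinset, χ i x * ψ x = ψ x := by
    intro x
    rw [← Finset.sum_mul, ← finsum_eq_sum_of_support_subset, χ.sum_eq_one (mem_univ x), one_mul]
    intro i hi
    exact hfin.mem_toFinset.2 ⟨x, hi⟩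
  have hpatch : ∀ i, Integrable (fun a => zeroSum (randomSection T a) fun x => χ i x * ψ x)
      (complexGaussian m) := fun i =>
    (integral_zeroSum_of_tsupport_subset hm hT hW (isHolomorphicChart_chartAt i)
      ((isHolomorphicFrame_baseFrame (E := E) i).mono
        ((trivializationAt ℂ E i).open_baseSet.inter (chartAt ℂ i).open_source)
        inter_subset_left) inter_subset_right ((χ i).contMDiff.mul hψ)
      ((tsupport_mul_subset_left).trans (hχ i))).1
  refine (integrable_finsetSum hfin.toFinset fun i _ => hpatch i).congr ?_
  -- a nonzero combination has only finitely many zeros, so `zeroSum` is additive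
  filter_upwards [ae_ne_zero hm] with a ha
  rw [← zeroSum_finsetSum (hW (hT.randomSection_mem a))
    (hT.zeroOrder_randomSection_ne_top hW ha)]
  simp only [hsum]

/-- Without base points, almost surely all zeros are simple: by compactness it suffices to show
this near each point, where some `T i` has no zeros. -/
theorem ae_zeroOrder_le_one (hT : IsOrthonormalBasis h W T) (hW : W ≤ holomorphicSections E n)
    (hbase : ∀ x : M, ∃ s ∈ W, s x ≠ 0) :
    ∀ᵐ a ∂complexGaussian m, ∀ x : M, zeroOrder (randomSection T a) x ≤ 1 := by
  suffices H : ∀ᵐ a ∂complexGaussian m, ∀ x ∈ (univ : Set M),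
      zeroOrder (randomSection T a) x ≤ 1 by
    filter_upwards [H] with a ha x using ha x (mem_univ x)
  refine isCompact_univ.induction_on
    (p := fun t : Set M => ∀ᵐ a ∂complexGaussian m, ∀ x ∈ t, zeroOrder (randomSection T a) x ≤ 1)
    (by simp) (fun t t' htt' h => h.mono fun a ha x hx => ha x (htt' hx))
    (fun t t' h h' => by
      filter_upwards [h, h'] with a ha ha' x hx using hx.elim (ha x) (ha' x)) fun x _ => ?_
  have hTh := holomorphicSections_of_isOrthonormalBasis hW hT
  obtain ⟨i, hi⟩ : ∃ i, T i x ≠ 0 := by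
    by_contra! h0
    obtain ⟨s, hs, hsx⟩ := hbase x
    rw [← hT.span_eq] at hs
    obtain ⟨b, rfl⟩ := (Submodule.mem_span_range_iff_exists_fun ℂ).1 hs
    exact hsx (by simp [h0])
  set c := chartAt ℂ x with hcdef
  have hc : IsHolomorphicChart c := isHolomorphicChart_chartAt x
  have hxc : x ∈ c.source := mem_chart_source ℂ x
  have hb := isHolomorphicFrame_baseFrame (E := E) x
  have hxb := mem_baseSet_self (E := E) x
  have hix : (localRep (baseFrame x) (T i) ∘ c.symm) (c x) ≠ 0 := by
    rw [Function.comp_apply, c.left_inv hxc]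
    exact fun h => hi ((localRep_eq_zero_iff (hb.ne_zero x hxb) _).1 h)
  have hev : ∀ᶠ ζ in 𝓝 (c x), (localRep (baseFrame x) (T i) ∘ c.symm) ζ ≠ 0 ∧ ζ ∈ c.target ∧
      c.symm ζ ∈ (trivializationAt ℂ E x).baseSet :=
    ((analyticAt_localRep (hTh i) hb hc ⟨hxb, hxc⟩).continuousAt.eventually_ne hix).and
      ((c.open_target.eventually_mem (c.map_source hxc)).and
        (eventually_symm_mem hxc (hb.isOpen.mem_nhds hxb)))
  obtain ⟨ε, hε, hball⟩ := Metric.nhds_basis_closedBall.eventually_iff.1 hev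
  have hae := ae_analyticOrderAt_le_one (f := fun j => localRep (baseFrame x) (T j) ∘ c.symm)
    (isCompact_closedBall (c x) ε)
    (fun j ζ hζ => by
      obtain ⟨-, h2, h3⟩ := hball hζ
      have := analyticAt_localRep (hTh j) hb hc ⟨h3, c.map_target h2⟩
      rwa [c.right_inv h2] at this) i (fun ζ hζ => (hball hζ).1)
  refine ⟨c.source ∩ c ⁻¹' Metric.closedBall (c x) ε, ?_, ?_⟩
  · rw [nhdsWithin_univ]
    exact Filter.inter_mem (c.open_source.mem_nhds hxc)
      (c.continuousAt hxc (Metric.closedBall_mem_nhds _ hε))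
  · filter_upwards [hae] with a ha y hy
    have hyb := (hball hy.2).2.2
    rw [c.left_inv hy.1] at hyb
    rw [zeroOrder_eq (hW (hT.randomSection_mem a)) hb hc ⟨hyb, hy.1⟩]
    convert ha (c y) hy.2 using 2
    funext ζ
    exact localRep_randomSection _ T a _

end Zeros

end RandomSections

end

theorem theorem3 {M : Type*} [TopologicalSpace M] [T2Space M] [CompactSpace M] [ConnectedSpace M]
    [ChartedSpace ℂ M] [IsManifold 𝓘(ℂ) ω M] [MeasurableSpace M] [BorelSpace M]
    (E : M → Type*) [∀ x, AddCommGroup (E x)] [∀ x, Module ℂ (E x)]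
    [∀ x, TopologicalSpace (E x)] [TopologicalSpace (TotalSpace ℂ E)]
    [FiberBundle ℂ E] [VectorBundle ℂ ℂ E] [ContMDiffVectorBundle ω ℂ E 𝓘(ℂ)]
    (h : RandomSections.HermitianMetric E) (hpos : h.IsPositive)
    (n : ℕ) (hn : 1 ≤ n) (q : M) (hq : RandomSections.criticalSections h n q ≠ ⊥) :
    FiniteDimensional ℂ (RandomSections.holomorphicSections E n) ∧
    (∃ (c' : OpenPartialHomeomorph M ℂ) (U' : Set M) (e' : ∀ x, E x),
      RandomSections.IsAdapted h q c' U' e') ∧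
    ∀ (d m : ℕ) (S : Fin d → RandomSections.PowSection E n)
      (T : Fin m → RandomSections.PowSection E n),
      RandomSections.IsOrthonormalBasis h (RandomSections.holomorphicSections E n) S →
      RandomSections.IsOrthonormalBasis h (RandomSections.criticalSections h n q) T →
      -- the expectation of the sum of `ψ` over the zeros exists
      (∀ ψ : M → ℝ, ContMDiff 𝓘(ℝ, ℂ) 𝓘(ℝ, ℝ) ∞ ψ →
        Integrable (fun a => RandomSections.zeroSum (RandomSections.randomSection T a) ψ)
          (RandomSections.complexGaussian m)) ∧
      -- it is the current `(i/2π) ∂∂̄ log |Π^q(z,z)|` on each coordinate patch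
      (∀ (c' : OpenPartialHomeomorph M ℂ) (U' : Set M) (e' : ∀ x, E x),
        RandomSections.IsAdapted h q c' U' e' →
        ∀ (c : OpenPartialHomeomorph M ℂ) (U : Set M) (e : ∀ x, E x),
        RandomSections.IsHolomorphicChart c → RandomSections.IsHolomorphicFrame E U e →
        U ⊆ c.source →
        ∀ ψ : M → ℝ, ContMDiff 𝓘(ℝ, ℂ) 𝓘(ℝ, ℝ) ∞ ψ → tsupport ψ ⊆ U →
        IntegrableOn (fun ζ =>
          Real.log ‖RandomSections.conditionalKernel S q c' e' e (c.symm ζ)‖ *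
            RandomSections.ddbar ψ c ζ) (c '' U) ∧
        ∫ a, RandomSections.zeroSum (RandomSections.randomSection T a) ψ
            ∂(RandomSections.complexGaussian m) =
          1 / Real.pi * ∫ ζ in c '' U,
            Real.log ‖RandomSections.conditionalKernel S q c' e' e (c.symm ζ)‖ *
              RandomSections.ddbar ψ c ζ) ∧
      -- without base points, almost surely all the zeros are simple
      ((∀ x : M, ∃ s ∈ RandomSections.criticalSections h n q, s x ≠ 0) →
        ∀ᵐ a ∂(RandomSections.complexGaussian m), ∀ x : M,
          RandomSections.zeroOrder (RandomSections.randomSection T a) x ≤ 1) := by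
  have : Nonempty M := ⟨q⟩
  refine ⟨RandomSections.finiteDimensional_holomorphicSections n h,
    RandomSections.exists_isAdapted h q, fun d m S T hS hT => ?_⟩
  have hm : 0 < m := hT.pos_of_ne_bot hq
  have hW := RandomSections.criticalSections_le (h := h) (n := n) q
  refine ⟨fun ψ hψ => RandomSections.integrable_zeroSum hm hT hW hψ, ?_,
    RandomSections.ae_zeroOrder_le_one hT hW⟩
  intro c' U' e' ha c U e hc he hU ψ hψ hsupp
  have hlog : ∀ z, ‖RandomSections.conditionalKernel S q c' e' e z‖ =
      ∑ k, ‖RandomSections.localRep e (T k) z‖ ^ 2 := fun z => by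
    rw [RandomSections.conditionalKernel_eq_sum ha hS hT, Complex.norm_real, Real.norm_of_nonneg]
    positivity
  simp only [hlog]
  exact (RandomSections.integral_zeroSum_of_tsupport_subset hm hT hW hc he hU hψ hsupp).2
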